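/- Let $G=\mathrm{SU}_2\times \mathrm{SU}_2$, let $\mathcal B$ be the Cartan–Killing form of $\mathfrak{su}_2$, let $H\in\mathfrak{su}_2$ be such that $\operatorname{ad}(H)$ is a complex structure on $\mathfrak n=H^{\perp_{\mathcal B}}$, let $E\in\mathfrak n$ with $\mathcal B(E,E)=-1$ and $V=[H,E]$, and put $U=(H,H)$, $A=(H,-H)$, $E_1=(E,0)$, $V_1=(V,0)$, $E_2=(0,E)$, $V_2=(0,V)$ in $\mathfrak{su}_2+\mathfrak{su}_2$. Let $M=G\times_{(\mathrm{SU}_2)_{\rm diag}}\mathfrak{su}_2\cong TS^3\cong S^3\times\mathbb R^3$, where $(\mathrm{SU}_2)_{\rm diag}$ acts on $\mathfrak{su}_2$ by the adjoint action, let $\gamma_t=[e,tH]$ (here $U$ is identified with $H$), let $S=G\cdot\gamma_0\cong S^3$ be the singular orbit, and let $\xi=\gamma_t'$. For $X\in\mathfrak{su}_2+\mathfrak{su}_2$ denote by $\widehat X$ the corresponding fundamental vector field on $M$. For $t\neq 0$ the vectors $(\xi,\widehat A,\widehat E_1,\widehat V_1,\widehat E_2,\widehat V_2)$ form a basis of $T_{\gamma_t}M$;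 denote its dual basis by $(\xi^*,A^*,E_1^*,V_1^*,E_2^*,V_2^*)$ and put $$\omega^1=\xi^*\wedge A^*,\quad \omega^2=E_1^*\wedge V_1^*,\quad \omega^3=E_2^*\wedge V_2^*,\quad \omega^4=E_1^*\wedge E_2^*+V_1^*\wedge V_2^*,\quad \omega^5=E_1^*\wedge V_2^*-V_1^*\wedge E_2^*,$$ with $(\alpha\wedge\beta)(v,w)=\alpha(v)\beta(w)-\alpha(w)\beta(v)$. Let $a>0$, $\mu>0$, and let $f_1,\dots,f_5$ be smooth real functions on $]-a,a[$ such that (i) $f_4\equiv 0$, and $f_1$ is even with $f_1<0$; (ii) $f_2,f_3,f_5$ are odd, with $f_3'(0)=\tfrac12 f_1(0)+f_2'(0)$ and $f_5'(0)=-\tfrac14 f_1(0)-f_2'(0)\neq 0$; (iii) on $]-a,a[$ the functions satisfy the system $$\big[(f_2'+\tfrac14 f_1)f_1\big]'+12\mu f_1f_2=0,\qquad \big[(f_3'-\tfrac14 f_1)f_1\big]'+12\mu f_1f_3=0,$$ $$(f_5'f_1)'-4\frac{f_5}{f_1}+12\mu f_1f_5=0,\qquad f_1\big(f_2'-f_3'+\tfrac12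 f_1\big)+48\mu\,(f_2f_3-f_5^2)=0,$$ and at some $t_o\in\,]-a,a[$ the algebraic condition $$4f_5^2-\Big((f_5')^2-\big(f_2'+\tfrac14 f_1\big)\big(f_3'-\tfrac14 f_1\big)\Big)f_1^2\Big|_{t=t_o}=0 .$$ Then there exists $\varepsilon$ with $0<\varepsilon\le a$ such that $\mathcal T_\varepsilon=G\cdot\gamma([0,\varepsilon[)$ is an open neighbourhood of $S$ and there is a smooth $G$-invariant strict nearly Kähler structure $(g,J)$ on $\mathcal T_\varepsilon$ whose Kähler form $\omega=g(J\cdot,\cdot)$ satisfies $\omega_{\gamma_t}=\sum_{i=1}^5 f_i(t)\,\omega^i|_{\gamma_t}$ for $0<|t|<\varepsilon$. Here a strict nearly Kähler structure is a Riemannian (positive definite) metric $g$ with an almost complex structure $J$ such that $g$ is $J$-Hermitian and the Levi-Civita connection $\nabla$ of $g$ satisfies $(\nabla_XJ)X=0$ for every vector field $X$ and $\nabla_vJ\neq0$ for every nonzero tangent vector $v$. -/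

import Mathlib

open scoped Manifold ContDiff Quaternion
open Set

noncomputable section

/-! ### Nearly Kaehler structures on an open subset of a smooth manifold -/

namespace NearlyKahler

section General

variable {E : Type*} [NormedAddCommGroup E] [NormedSpace ℝ E]
  {H : Type*} [TopologicalSpace H] (I : ModelWithCorners ℝ E H)
  {M : Type*} [TopologicalSpace M] [ChartedSpace H M] [IsManifold I ∞ M]

/-- The vector field `X` is differentiable at `x`. -/
def VectorFieldDiffAt (X : ∀ x : M, TangentSpace I x) (x : M) : Prop :=
  MDifferentiableAt I I.tangent (fun y => (⟨y, X y⟩ : TangentBundle I M)) x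

/-- `g` is a smooth Riemannian metric (symmetric, positive definite) on the open set `U`. -/
structure IsRiemannianMetricOn
    (g : ∀ x : M, TangentSpace I x →L[ℝ] TangentSpace I x →L[ℝ] ℝ) (U : Set M) : Prop where
  symm : ∀ x ∈ U, ∀ v w : TangentSpace I x, g x v w = g x w v
  pos : ∀ x ∈ U, ∀ v : TangentSpace I x, v ≠ 0 → 0 < g x v v
  smooth : ContMDiffOn I (I.prod 𝓘(ℝ, E →L[ℝ] E →L[ℝ] ℝ)) ∞
    (fun x => Bundle.TotalSpace.mk' (E →L[ℝ] E →L[ℝ] ℝ)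
      (E := fun x : M => TangentSpace I x →L[ℝ] TangentSpace I x →L[ℝ] ℝ) x (g x)) U

/-- `J` is a smooth almost complex structure on the open set `U`. -/
structure IsAlmostComplexOn
    (J : ∀ x : M, TangentSpace I x →L[ℝ] TangentSpace I x) (U : Set M) : Prop where
  sq : ∀ x ∈ U, ∀ v : TangentSpace I x, J x (J x v) = -v
  smooth : ContMDiffOn I (I.prod 𝓘(ℝ, E →L[ℝ] E)) ∞
    (fun x => Bundle.TotalSpace.mk' (E →L[ℝ] E)
      (E := fun x : M => TangentSpace I x →L[ℝ] TangentSpace I x) x (J x)) U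

/-- `cov` is the Levi-Civita connection of the metric `g` on the open set `U`: a covariant
derivative on the tangent bundle which is metric and torsion free.  As in Mathlib,
`cov Y x v` stands for `(∇_v Y)(x)`. -/
structure IsLeviCivitaOn
    (g : ∀ x : M, TangentSpace I x →L[ℝ] TangentSpace I x →L[ℝ] ℝ)
    (cov : (∀ x : M, TangentSpace I x) → (∀ x : M, TangentSpace I x →L[ℝ] TangentSpace I x))
    (U : Set M) : Prop where
  isCovariantDerivativeOn : IsCovariantDerivativeOn E cov U
  metric : ∀ x ∈ U, ∀ (v : TangentSpace I x) (Y Z : ∀ x : M, TangentSpace I x),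
    VectorFieldDiffAt I Y x → VectorFieldDiffAt I Z x →
    mvfderiv I (fun y => g y (Y y) (Z y)) x v
      = g x (cov Y x v) (Z x) + g x (Y x) (cov Z x v)
  torsionFree : ∀ x ∈ U, ∀ X Y : ∀ x : M, TangentSpace I x,
    VectorFieldDiffAt I X x → VectorFieldDiffAt I Y x →
    cov Y x (X x) - cov X x (Y x) = VectorField.mlieBracket I X Y x

/-- `((∇_v J) Y)(x) = ∇_v (J Y) - J (∇_v Y)`. -/
def covJ
    (cov : (∀ x : M, TangentSpace I x) → (∀ x : M, TangentSpace I x →L[ℝ] TangentSpace I x))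
    (J : ∀ x : M, TangentSpace I x →L[ℝ] TangentSpace I x)
    (Y : ∀ x : M, TangentSpace I x) (x : M) (v : TangentSpace I x) : TangentSpace I x :=
  cov (fun y => J y (Y y)) x v - J x (cov Y x v)

/-- `(g, J)` is a strict nearly Kaehler structure on the open set `U`: `g` is a Riemannian metric,
`J` is an almost complex structure, `g` is Hermitian with respect to `J`, and the Levi-Civita
connection of `g` satisfies `(∇_X J) X = 0` for all vector fields `X`, and `∇_v J ≠ 0` for every
nonzero tangent vector `v`. -/
structure IsStrictNearlyKahlerOn
    (g : ∀ x : M, TangentSpace I x →L[ℝ] TangentSpace I x →L[ℝ] ℝ)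
    (J : ∀ x : M, TangentSpace I x →L[ℝ] TangentSpace I x) (U : Set M) : Prop where
  riemannian : IsRiemannianMetricOn I g U
  almostComplex : IsAlmostComplexOn I J U
  hermitian : ∀ x ∈ U, ∀ v w : TangentSpace I x, g x (J x v) (J x w) = g x v w
  strictNearlyKahler : ∃ cov, IsLeviCivitaOn I g cov U ∧
    (∀ x ∈ U, ∀ X : ∀ x : M, TangentSpace I x, VectorFieldDiffAt I X x →
      covJ I cov J X x (X x) = 0) ∧
    (∀ x ∈ U, ∀ v : TangentSpace I x, v ≠ 0 →
      ∃ Y : ∀ x : M, TangentSpace I x, VectorFieldDiffAt I Y x ∧ covJ I cov J Y x v ≠ 0)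

/-- The tensors `g` and `J` are invariant on `U` under all the maps `Φ a`. -/
def IsInvariantOn {G : Type*} (Φ : G → M → M)
    (g : ∀ x : M, TangentSpace I x →L[ℝ] TangentSpace I x →L[ℝ] ℝ)
    (J : ∀ x : M, TangentSpace I x →L[ℝ] TangentSpace I x) (U : Set M) : Prop :=
  ∀ (a : G), ∀ x ∈ U, Φ a x ∈ U ∧
    (∀ v w : TangentSpace I x,
      g (Φ a x) (mfderiv I I (Φ a) x v) (mfderiv I I (Φ a) x w) = g x v w) ∧
    (∀ v : TangentSpace I x,
      J (Φ a x) (mfderiv I I (Φ a) x v) = mfderiv I I (Φ a) x (J x v))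

end General

/-! ### The cohomogeneity one manifold `G ×_H V` for `G = SU(2) × SU(2)`

`SU(2)` is the group of unit quaternions, its Lie algebra `su(2)` is the space of imaginary
quaternions with bracket `[x, y] = x y - y x`, `H` is the diagonal subgroup of `G`, and `V = su(2)`
with the adjoint action of `H`. -/

instance factFinrankQuaternion : Fact (Module.finrank ℝ ℍ[ℝ] = 3 + 1) :=
  ⟨Quaternion.finrank_eq_four⟩

/-- `SU(2)`, as the group of unit quaternions. -/
abbrev SU2 : Type := Metric.sphere (0 : ℍ[ℝ]) 1

/-- The Lie algebra `su(2)`, as the space of imaginary quaternions. -/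
def su2 : Submodule ℝ ℍ[ℝ] where
  carrier := {x | x.re = 0}
  add_mem' := by
    intro x y hx hy
    simp only [mem_ofPred_eq] at hx hy ⊢
    simp [hx, hy]
  zero_mem' := by simp
  smul_mem' := by
    intro c x hx
    simp only [mem_ofPred_eq] at hx ⊢
    simp [hx]

theorem mem_su2 (x : ℍ[ℝ]) : x ∈ su2 ↔ x.re = 0 := Iff.rfl

theorem conj_mem_su2 (b : SU2) (w : su2) :
    (b : ℍ[ℝ]) * (w : ℍ[ℝ]) * ((b⁻¹ : SU2) : ℍ[ℝ]) ∈ su2 := by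
  have hb : (b : ℍ[ℝ]) * ((b⁻¹ : SU2) : ℍ[ℝ]) = 1 := by
    rw [← Metric.unitSphere.coe_mul, mul_inv_cancel, Metric.unitSphere.coe_one]
  have hb' : ((b⁻¹ : SU2) : ℍ[ℝ]) * (b : ℍ[ℝ]) = 1 := by
    rw [← Metric.unitSphere.coe_mul, inv_mul_cancel, Metric.unitSphere.coe_one]
  have hre : ∀ x y : ℍ[ℝ], (x * y).re = (y * x).re := by
    intro x y
    simp only [Quaternion.re_mul]
    ring
  have hw : (w : ℍ[ℝ]).re = 0 := w.2
  rw [mem_su2, hre, ← mul_assoc, hb', one_mul, hw]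

/-- The adjoint action of `SU(2)` on `su(2)`. -/
def Ad (b : SU2) (w : su2) : su2 :=
  ⟨(b : ℍ[ℝ]) * (w : ℍ[ℝ]) * ((b⁻¹ : SU2) : ℍ[ℝ]), conj_mem_su2 b w⟩

theorem Ad_one (w : su2) : Ad 1 w = w := by
  ext1
  simp [Ad]

theorem Ad_mul (b c : SU2) (w : su2) : Ad (b * c) w = Ad b (Ad c w) := by
  ext1
  simp [Ad, mul_assoc]

/-- The manifold `M = G ×_H V`, in the standard trivialization
`G ×_H V → SU(2) × su(2)`, `[(a, b), v] ↦ (a b⁻¹, Ad_b v)`; see `proj` and the facts below it. -/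
abbrev TotSpace : Type := SU2 × su2

/-- The model with corners (without corners) of the 6-dimensional manifold `M`. -/
abbrev 𝓘M : ModelWithCorners ℝ (EuclideanSpace ℝ (Fin 3) × su2)
    (ModelProd (EuclideanSpace ℝ (Fin 3)) su2) :=
  (𝓡 3).prod 𝓘(ℝ, su2)

/-- The action of `G = SU(2) × SU(2)` on `M`. -/
def act (a : SU2 × SU2) (p : TotSpace) : TotSpace := (a.1 * p.1 * a.2⁻¹, Ad a.2 p.2)

theorem act_one (p : TotSpace) : act 1 p = p := by
  simp [act, Ad_one]

theorem act_mul (a b : SU2 × SU2) (p : TotSpace) : act (a * b) p = act a (act b p) := by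
  simp [act, Ad_mul, mul_assoc]

/-- The quotient map `G × V → G ×_H V = M`. -/
def proj (x : (SU2 × SU2) × su2) : TotSpace := (x.1.1 * x.1.2⁻¹, Ad x.1.2 x.2)

theorem proj_equivariant (a c : SU2 × SU2) (v : su2) : proj (a * c, v) = act a (proj (c, v)) := by
  simp [proj, act, Ad_mul, mul_assoc]

/-- `p ↦ ((p.1, 1), p.2)` is a global section of `proj`. -/
theorem proj_section (p : TotSpace) : proj ((p.1, 1), p.2) = p := by
  simp [proj, Ad_one]

/-- The fibres of `proj` are the orbits of `H`, acting by `h · (c, v) = (c h⁻¹, Ad_h v)`. -/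
theorem proj_eq_iff (c d : SU2 × SU2) (v w : su2) :
    proj (c, v) = proj (d, w) ↔ ∃ h : SU2, d = c * (h, h)⁻¹ ∧ w = Ad h v := by
  constructor
  · intro hp
    simp only [proj, Prod.mk.injEq] at hp
    obtain ⟨h1, h2⟩ := hp
    refine ⟨d.2⁻¹ * c.2, ?_, ?_⟩
    · ext1
      · simp only [Prod.fst_mul, Prod.fst_inv, mul_inv_rev, inv_inv]
        rw [← mul_assoc, h1, inv_mul_cancel_right]
      · simp
    · rw [Ad_mul, h2, ← Ad_mul, inv_mul_cancel, Ad_one]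
  · rintro ⟨h, rfl, rfl⟩
    simp [proj, ← Ad_mul]

/-! ### The basis of `su(2)` and the frame along the curve `γ` -/

/-- The coordinates of an imaginary quaternion with respect to `(i, j, k)`. -/
def su2Coord : su2 ≃ₗ[ℝ] (Fin 3 → ℝ) where
  toFun x := ![(x : ℍ[ℝ]).imI, (x : ℍ[ℝ]).imJ, (x : ℍ[ℝ]).imK]
  invFun c := ⟨⟨0, c 0, c 1, c 2⟩, rfl⟩
  map_add' x y := by
    ext n
    fin_cases n <;> simp
  map_smul' r x := by
    ext n
    fin_cases n <;> simp
  left_inv x := by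
    have hx : (x : ℍ[ℝ]).re = 0 := x.2
    apply Subtype.ext
    apply Quaternion.ext <;> simp [hx]
  right_inv c := by
    ext n
    fin_cases n <;> rfl

/-- `ad x = [x, ·]` on `su(2)`. -/
def ad (x : su2) : su2 →ₗ[ℝ] su2 where
  toFun y := ⟨(x : ℍ[ℝ]) * (y : ℍ[ℝ]) - (y : ℍ[ℝ]) * (x : ℍ[ℝ]), by
    rw [mem_su2, Quaternion.re_sub, Quaternion.re_mul, Quaternion.re_mul]
    ring⟩
  map_add' y z := by
    apply Subtype.ext
    simp only [Submodule.coe_add]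
    noncomm_ring
  map_smul' r y := by
    apply Subtype.ext
    simp [smul_sub]

/-- The Cartan-Killing form of `su(2)`. -/
def killing (x y : su2) : ℝ := LinearMap.trace ℝ su2 (ad x ∘ₗ ad y)

/-- `H`, a generator of a Cartan subalgebra of `su(2)`. -/
def vecH : su2 := su2Coord.symm ![1 / 2, 0, 0]

/-- `E`, orthogonal to `H` and of length `-1` for the Killing form. -/
def vecE : su2 := su2Coord.symm ![0, 1 / (2 * √2), 0]

/-- `V = [H, E]`. -/
def vecV : su2 := su2Coord.symm ![0, 0, 1 / (2 * √2)]

theorem su2Coord_ad (x y : su2) : su2Coord (ad x y) =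
    ![2 * (su2Coord x 1 * su2Coord y 2 - su2Coord x 2 * su2Coord y 1),
      2 * (su2Coord x 2 * su2Coord y 0 - su2Coord x 0 * su2Coord y 2),
      2 * (su2Coord x 0 * su2Coord y 1 - su2Coord x 1 * su2Coord y 0)] := by
  have hx : (x : ℍ[ℝ]).re = 0 := x.2
  have hy : (y : ℍ[ℝ]).re = 0 := y.2
  ext n
  fin_cases n <;> simp [su2Coord, ad, hx, hy] <;> ring

/-- The Killing form of `su(2)` is `-8` times the Euclidean product. -/
theorem killing_eq (x y : su2) : killing x y = -8 * (su2Coord x 0 * su2Coord y 0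
    + su2Coord x 1 * su2Coord y 1 + su2Coord x 2 * su2Coord y 2) := by
  have hb : ∀ n, su2Coord (Module.Basis.ofEquivFun su2Coord n) = Pi.single n 1 := by
    intro n
    simp
  rw [killing, LinearMap.trace_eq_matrix_trace ℝ (Module.Basis.ofEquivFun su2Coord),
    Matrix.trace, Fin.sum_univ_three]
  simp only [Matrix.diag_apply, LinearMap.toMatrix_apply, Module.Basis.ofEquivFun_repr_apply,
    LinearMap.comp_apply, su2Coord_ad, hb]
  simp
  ring

theorem bracket_H_E : ad vecH vecE = vecV := by
  apply su2Coord.injective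
  rw [su2Coord_ad]
  ext n
  fin_cases n <;> simp [vecH, vecE, vecV]

theorem bracket_H_V : ad vecH vecV = -vecE := by
  apply su2Coord.injective
  rw [su2Coord_ad]
  ext n
  fin_cases n <;> simp [vecH, vecE, vecV]

/-- `E` and `V` are Killing-orthogonal to `H` and have length `-1`. -/
theorem killing_basis : killing vecH vecE = 0 ∧ killing vecH vecV = 0 ∧
    killing vecE vecE = -1 ∧ killing vecV vecV = -1 := by
  have h : √2 * √2 = 2 := Real.mul_self_sqrt (by norm_num)
  have h' : √2 ≠ 0 := by positivity
  refine ⟨?_, ?_, ?_, ?_⟩ <;> rw [killing_eq] <;> simp [vecH, vecE, vecV] <;> field_simp <;>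
    nlinarith

/-- The one-parameter subgroup `s ↦ exp (s x)` of `SU(2)` for `x` in `su(2)`, at `s = 1`. -/
def expSU2 (x : su2) : SU2 :=
  ⟨NormedSpace.exp (x : ℍ[ℝ]), by
    have hx : (x : ℍ[ℝ]).re = 0 := x.2
    rw [mem_sphere_zero_iff_norm, Quaternion.norm_exp, hx]
    simp⟩

/-- The orbit `s ↦ exp (s X) · p` of the one-parameter subgroup of `G` generated by
`X = (X₁, X₂)` in `su(2) + su(2)`. -/
def orbitCurve (X : su2 × su2) (p : TotSpace) (s : ℝ) : TotSpace :=
  act (expSU2 (s • X.1), expSU2 (s • X.2)) p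

theorem orbitCurve_zero (X : su2 × su2) (p : TotSpace) : orbitCurve X p 0 = p := by
  have h : expSU2 0 = 1 := by
    ext1
    simp [expSU2]
  simp only [orbitCurve, zero_smul, h]
  exact act_one p

/-- The value `X̂_p` of the fundamental vector field of `X`: the velocity at `s = 0` of
`s ↦ exp (s X) · p`.  (The velocity lies in the tangent space at `orbitCurve X p 0 = p`.) -/
def fundVec (X : su2 × su2) (p : TotSpace) : TangentSpace 𝓘M p :=
  orbitCurve_zero X p ▸ mfderiv 𝓘(ℝ, ℝ) 𝓘M (orbitCurve X p) 0 (1 : ℝ)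

/-- The curve `γ_t = [e, t U]`; here `U = (H, H)` corresponds to `H` in `V = su(2)`. -/
def γ (t : ℝ) : TotSpace := proj (1, t • vecH)

/-- The frame `B_t = (ξ, Â, Ê₁, V̂₁, Ê₂, V̂₂)` at `γ_t`, where `ξ` is the velocity of `γ` and
`A = (H, -H)`, `E₁ = (E, 0)`, `V₁ = (V, 0)`, `E₂ = (0, E)`, `V₂ = (0, V)`. -/
def frame (t : ℝ) : Fin 6 → TangentSpace 𝓘M (γ t) :=
  ![mfderiv 𝓘(ℝ, ℝ) 𝓘M γ t (1 : ℝ),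
    fundVec (vecH, -vecH) (γ t),
    fundVec (vecE, 0) (γ t),
    fundVec (vecV, 0) (γ t),
    fundVec (0, vecE) (γ t),
    fundVec (0, vecV) (γ t)]

/-- The wedge product of two linear forms, evaluated on a pair of vectors. -/
def wedge {W : Type*} [AddCommGroup W] [Module ℝ W] (α β : W →ₗ[ℝ] ℝ) (v w : W) : ℝ :=
  α v * β w - α w * β v

/-- For a basis `b = (ξ, A, E₁, V₁, E₂, V₂)` with dual basis `(ξ*, A*, E₁*, V₁*, E₂*, V₂*)`, the
2-form `c₁ ω¹ + … + c₅ ω⁵`, where `ω¹ = ξ* ∧ A*`, `ω² = E₁* ∧ V₁*`, `ω³ = E₂* ∧ V₂*`,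
`ω⁴ = E₁* ∧ E₂* + V₁* ∧ V₂*` and `ω⁵ = E₁* ∧ V₂* - V₁* ∧ E₂*`. -/
def invForm {W : Type*} [AddCommGroup W] [Module ℝ W] (b : Module.Basis (Fin 6) ℝ W)
    (c₁ c₂ c₃ c₄ c₅ : ℝ) (v w : W) : ℝ :=
  c₁ * wedge (b.coord 0) (b.coord 1) v w
    + c₂ * wedge (b.coord 2) (b.coord 3) v w
    + c₃ * wedge (b.coord 4) (b.coord 5) v w
    + c₄ * (wedge (b.coord 2) (b.coord 4) v w + wedge (b.coord 3) (b.coord 5) v w)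
    + c₅ * (wedge (b.coord 2) (b.coord 5) v w - wedge (b.coord 3) (b.coord 4) v w)

/-- The singular orbit `S = G · γ_0`, diffeomorphic to `S³`. -/
def singularOrbit : Set TotSpace := range fun a : SU2 × SU2 => act a (γ 0)

/-- The tube `G · γ([0, ε[)` around the singular orbit. -/
def tube (ε : ℝ) : Set TotSpace := {p | ∃ a : SU2 × SU2, ∃ t : ℝ, 0 ≤ t ∧ t < ε ∧ p = act a (γ t)}

/-- The differential system for `(f₁, f₂, f₃, φ)`, at the point `t`. -/
def SystemAt (μ : ℝ) (f₁ f₂ f₃ φ : ℝ → ℝ) (t : ℝ) : Prop :=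
  deriv (fun s => (deriv f₂ s + f₁ s / 4) * f₁ s) t + 12 * μ * f₁ t * f₂ t = 0 ∧
  deriv (fun s => (deriv f₃ s - f₁ s / 4) * f₁ s) t + 12 * μ * f₁ t * f₃ t = 0 ∧
  deriv (fun s => deriv φ s * f₁ s) t - 4 * (φ t / f₁ t) + 12 * μ * f₁ t * φ t = 0 ∧
  f₁ t * (deriv f₂ t - deriv f₃ t + f₁ t / 2) + 48 * μ * (f₂ t * f₃ t - φ t ^ 2) = 0

/-- The algebraic condition on `(f₁, f₂, f₃, φ)` and their first derivatives, at the point `t`. -/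
def AlgebraicConditionAt (f₁ f₂ f₃ φ : ℝ → ℝ) (t : ℝ) : Prop :=
  4 * φ t ^ 2
    - (deriv φ t ^ 2 - (deriv f₂ t + f₁ t / 4) * (deriv f₃ t - f₁ t / 4)) * f₁ t ^ 2 = 0

end NearlyKahler

end

noncomputable section

set_option maxSynthPendingDepth 3
set_option linter.unusedSectionVars false
set_option linter.unusedSimpArgs false

namespace NearlyKahler

/-! ### Smooth even and odd functions of one real variable -/

section EvenFunctions

open MeasureTheory Filter Topology

/-! In the trivialization by points (q, w) of SU(2) × su(2) and the left invariant frame (q⁻¹dq,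
dw), the group G acts on tangent vectors through the diagonal adjoint action (`frameMap_act`). An
invariant tensor is therefore an Ad-equivariant function of w alone, and γ_t lies at w = tH, of norm
|t|/2. The forms and endomorphisms used here are given by nine functions of s = ‖w‖
(`Coefficients`).

Smoothness across the singular orbit: a smooth even function of ‖w‖ is smooth in w, so the
coefficients computed from the fᵢ must be smooth and even. This means dividing by powers of s, by
Hadamard's lemma. The parities and the initial conditions at 0, together with the algebraic relation
below, give the vanishing needed at s = 0 (`Profile.exists_represents`).

The differential system: with p = (f₂' + f₁/4)f₁, q = (f₃' - f₁/4)f₁, S = f₅'f₁ it is of first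
order. Differentiating the constraint gives p f₃ + q f₂ = 2 S f₅. This relation makes pq - S² + 4f₅²
constant, and it is 0 at the singular orbit. Differentiating once more gives f₁²(p - q) = (64/3)f₅².
In terms of the coefficients these relations say that J² = -1, that g is symmetric, and that dω and
the Nijenhuis tensor N are in the right ratio (`Profile.hermitian_relations`,
`Profile.torsion_relations`). Definiteness holds at s = 0 because f₁(0) < 0, hence on a small tube.

The nearly Kähler condition: for every almost Hermitian structure, 2g((∇_X J)Y, Z) = dω(X,Y,Z) -
dω(X,JY,JZ) + g(N(Y,Z), JX) (`HermitianJet.two_mul_g_nablaJ`). If dω has type (3,0) + (0,3) and g(J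
N(Y,Z), X) = (4/3) dω(X,Y,Z), then g((∇_X J)Y, Z) = (1/3) dω(X,Y,Z). This is alternating, so (∇_X
J)X = 0. Strictness holds because no nonzero X annihilates dω. By equivariance these identities need
checking only at w = s·i, where they are the scalar identities `TorsionAt`.
`Parallelism.isStrictNearlyKahlerOn` transfers the pointwise algebra to the manifold. -/

theorem hasDerivAt_integral_pow_mul (k : ℕ) {h : ℝ → ℝ} (hh : ContDiff ℝ ∞ h) (x : ℝ) :
    HasDerivAt (fun x => ∫ t in (0 : ℝ)..1, t ^ k * h (x * t))
      (∫ t in (0 : ℝ)..1, t ^ (k + 1) * deriv h (x * t)) x := by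
  have hc : Continuous h := hh.continuous
  have hd : Differentiable ℝ h := hh.differentiable (by simp)
  have hc' : Continuous (deriv h) := hh.continuous_deriv (by exact_mod_cast le_top)
  obtain ⟨C, hC⟩ := (isCompact_Icc (a := -(|x| + 1)) (b := |x| + 1)).exists_bound_of_continuousOn
    hc'.continuousOn
  have hC0 : 0 ≤ C := (norm_nonneg _).trans (hC 0 ⟨by linarith [abs_nonneg x],
    by linarith [abs_nonneg x]⟩)
  refine (intervalIntegral.hasDerivAt_integral_of_dominated_loc_of_deriv_le
    (F := fun x t => t ^ k * h (x * t)) (F' := fun x t => t ^ (k + 1) * deriv h (x * t))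
    (bound := fun _ => C) (Metric.ball_mem_nhds x one_pos) ?_ ?_ ?_ ?_ ?_ ?_).2
  · exact Eventually.of_forall fun y => (by fun_prop : Continuous _).aestronglyMeasurable
  · exact (by fun_prop : Continuous _).intervalIntegrable _ _
  · exact (by fun_prop : Continuous _).aestronglyMeasurable
  · refine ae_of_all _ fun t ht y hy => ?_
    rw [uIoc_of_le zero_le_one] at ht
    have hy' : |y| ≤ |x| + 1 := by
      have h1 : |y - x| < 1 := by simpa [Real.dist_eq] using hy
      have h2 := abs_sub_abs_le_abs_sub y x
      linarith
    have ht0 : |t| ≤ 1 := by rw [abs_of_pos ht.1]; exact ht.2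
    have hyt : |y * t| ≤ |x| + 1 := by
      rw [abs_mul]
      nlinarith [abs_nonneg y, abs_nonneg t]
    rw [norm_mul, norm_pow, Real.norm_eq_abs t]
    calc |t| ^ (k + 1) * ‖deriv h (y * t)‖ ≤ 1 * C :=
          mul_le_mul (pow_le_one₀ (abs_nonneg t) ht0) (hC _ (abs_le.1 hyt)) (norm_nonneg _)
            zero_le_one
      _ = C := one_mul C
  · exact intervalIntegrable_const
  · refine ae_of_all _ fun t _ y _ => ?_
    have h1 : HasDerivAt (fun y => h (y * t)) (deriv h (y * t) * t) y := by
      have := (hd (y * t)).hasDerivAt.comp y (hasDerivAt_mul_const t)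
      exact this
    convert! h1.const_mul (t ^ k) using 1
    ring

/-- Each differentiation under the integral sign raises the exponent of t, so the induction on n has
to run over all k and all h at once. -/
theorem contDiff_integral_pow_mul (n : ℕ) : ∀ (k : ℕ) {h : ℝ → ℝ}, ContDiff ℝ ∞ h →
    ContDiff ℝ n (fun x => ∫ t in (0 : ℝ)..1, t ^ k * h (x * t)) := by
  induction n with
  | zero =>
    intro k h hh
    have := hh.continuous
    rw [Nat.cast_zero, contDiff_zero]
    exact continuous_iff_continuousAt.2 fun x => (hasDerivAt_integral_pow_mul k hh x).continuousAt
  | succ n ih =>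
    intro k h hh
    rw [Nat.cast_succ, contDiff_succ_iff_deriv]
    refine ⟨fun x => (hasDerivAt_integral_pow_mul k hh x).differentiableAt, by simp, ?_⟩
    rw [funext fun x => (hasDerivAt_integral_pow_mul k hh x).deriv]
    exact ih (k + 1) ((contDiff_infty_iff_deriv.1 hh).2)

/-- Hadamard's lemma in one variable. -/
theorem exists_eq_mul_of_contDiff {f : ℝ → ℝ} (hf : ContDiff ℝ ∞ f) (h0 : f 0 = 0) :
    ∃ g : ℝ → ℝ, ContDiff ℝ ∞ g ∧ ∀ t, f t = t * g t := by
  have hd : Differentiable ℝ f := hf.differentiable (by simp)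
  have hc' : Continuous (deriv f) := hf.continuous_deriv (by exact_mod_cast le_top)
  refine ⟨fun x => ∫ t in (0 : ℝ)..1, t ^ 0 * deriv f (x * t),
    contDiff_infty.2 fun n => contDiff_integral_pow_mul n 0 (contDiff_infty_iff_deriv.1 hf).2,
    fun x => ?_⟩
  have h1 : ∀ t ∈ uIcc (0 : ℝ) 1,
      HasDerivAt (fun t => f (x * t)) (x * (t ^ 0 * deriv f (x * t))) t := by
    intro t _
    have := (hd (x * t)).hasDerivAt.comp t (hasDerivAt_const_mul x)
    convert! this using 1
    ring
  have h2 := intervalIntegral.integral_eq_sub_of_hasDerivAt h1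
    ((by fun_prop : Continuous fun t => x * (t ^ 0 * deriv f (x * t))).intervalIntegrable _ _)
  rw [intervalIntegral.integral_const_mul] at h2
  simpa [h0] using h2.symm

theorem _root_.Function.Odd.exists_eq_mul {f : ℝ → ℝ} (ho : f.Odd) (hf : ContDiff ℝ ∞ f) :
    ∃ g : ℝ → ℝ, ContDiff ℝ ∞ g ∧ g.Even ∧ ∀ t, f t = t * g t := by
  obtain ⟨g, hg, hfg⟩ := exists_eq_mul_of_contDiff hf ho.map_zero
  refine ⟨g, hg, fun t => ?_, hfg⟩
  rcases eq_or_ne t 0 with rfl | ht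
  · simp
  · have := ho t
    rw [hfg, hfg] at this
    apply mul_left_cancel₀ ht
    linarith

/-- Hadamard's lemma is applied twice. The first quotient is odd away from 0 by cancellation and at
0 by density, so it vanishes at 0 and can be divided again. -/
theorem _root_.Function.Even.exists_eq_sq_mul {f : ℝ → ℝ} (he : f.Even) (hf : ContDiff ℝ ∞ f)
    (h0 : f 0 = 0) : ∃ g : ℝ → ℝ, ContDiff ℝ ∞ g ∧ g.Even ∧ ∀ t, f t = t ^ 2 * g t := by
  obtain ⟨g, hg, hfg⟩ := exists_eq_mul_of_contDiff hf h0
  have ho : g.Odd := by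
    have key : ∀ t : ℝ, t ≠ 0 → g (-t) = -g t := by
      intro t ht
      have := he t
      rw [hfg, hfg] at this
      apply mul_left_cancel₀ ht
      linarith
    have hcl : IsClosed {t | g (-t) = -g t} :=
      isClosed_eq (hg.continuous.comp continuous_neg) hg.continuous.neg
    intro t
    have : t ∈ closure {t : ℝ | t ≠ 0} := by
      have : Dense {t : ℝ | t ≠ 0} := dense_compl_singleton (0 : ℝ)
      exact this t
    exact closure_minimal (fun t ht => key t ht) hcl this
  obtain ⟨k, hk, hke, hgk⟩ := ho.exists_eq_mul hg
  exact ⟨k, hk, hke, fun t => by rw [hfg, hgk]; ring⟩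

theorem _root_.Function.Even.deriv_odd {f : ℝ → ℝ} (he : f.Even) : (deriv f).Odd := by
  intro t
  have h : (fun s => f (-s)) = f := funext he
  have := deriv_comp_neg f t
  rw [h] at this
  linarith

theorem _root_.Function.Odd.deriv_even {f : ℝ → ℝ} (ho : f.Odd) : (deriv f).Even := by
  intro t
  have h : (fun s => f (-s)) = fun s => -f s := funext ho
  have := deriv_comp_neg f t
  rw [h, deriv.fun_neg] at this
  linarith

theorem contDiff_deriv_of_contDiff_infty {f : ℝ → ℝ} (hf : ContDiff ℝ ∞ f) :
    ContDiff ℝ ∞ (deriv f) :=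
  (contDiff_infty_iff_deriv.1 hf).2

section Radial

variable {E : Type*} [NormedAddCommGroup E] [InnerProductSpace ℝ E]

/-- The gradient of f(‖w‖) is (f'(r)/r) w. Writing f' = t·g removes the singularity of the norm: at
the origin f'(0) = 0 makes f(‖w‖) - f(0) negligible against ‖w‖. -/
theorem hasFDerivAt_radial {f g : ℝ → ℝ} (hf : ContDiff ℝ ∞ f)
    (hfg : ∀ t, deriv f t = t * g t) (w : E) :
    HasFDerivAt (fun w : E => f ‖w‖) (g ‖w‖ • innerSL ℝ w) w := by
  have hd : Differentiable ℝ f := hf.differentiable (by simp)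
  rcases eq_or_ne w 0 with rfl | hw
  · have h0 : deriv f 0 = 0 := by rw [hfg]; simp
    have h1 : HasDerivAt f 0 0 := by simpa only [h0] using (hd 0).hasDerivAt
    have h2 := hasDerivAt_iff_isLittleO_nhds_zero.1 h1
    rw [hasFDerivAt_iff_isLittleO_nhds_zero]
    have h3 : Tendsto (fun h : E => ‖h‖) (𝓝 0) (𝓝 0) := by
      simpa using (continuous_norm (E := E)).tendsto 0
    have h4 := (h2.comp_tendsto h3).norm_right
    simp only [Function.comp_def, norm_norm] at h4
    simpa using h4.of_norm_right
  · have h1 : HasFDerivAt (fun w : E => ‖w‖) (‖w‖⁻¹ • innerSL ℝ w) w := by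
      have h2 := (hasStrictFDerivAt_norm_sq w).hasFDerivAt.sqrt
        (by positivity : (‖w‖ ^ 2 : ℝ) ≠ 0)
      simp only [Real.sqrt_sq (norm_nonneg _)] at h2
      convert! h2 using 1
      ext v
      simp
      field_simp
    have h3 := (hd ‖w‖).hasDerivAt.comp_hasFDerivAt w h1
    convert! h3 using 1
    rw [hfg, smul_smul]
    congr 1
    have := norm_ne_zero_iff.2 hw
    field_simp

/-- The gradient is g(‖w‖) w with g = f'(t)/t again smooth and even, which drives the induction. -/
theorem contDiff_radial_nat (n : ℕ) : ∀ {f : ℝ → ℝ}, f.Even → ContDiff ℝ ∞ f →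
    ContDiff ℝ n (fun w : E => f ‖w‖) := by
  induction n with
  | zero =>
    intro f _ hf
    have := hf.continuous
    rw [Nat.cast_zero, contDiff_zero]
    fun_prop
  | succ n ih =>
    intro f he hf
    obtain ⟨g, hg, hge, hfg⟩ := he.deriv_odd.exists_eq_mul (contDiff_deriv_of_contDiff_infty hf)
    rw [Nat.cast_succ, contDiff_succ_iff_hasFDerivAt]
    exact ⟨fun w => g ‖w‖ • innerSL ℝ w, (ih hge hg).smul (innerSL ℝ).contDiff,
      hasFDerivAt_radial hf hfg⟩

/-- A smooth even function of the norm is smooth. -/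
theorem _root_.Function.Even.contDiff_radial {f : ℝ → ℝ} (he : f.Even) (hf : ContDiff ℝ ∞ f) :
    ContDiff ℝ ∞ (fun w : E => f ‖w‖) :=
  contDiff_infty.2 fun n => contDiff_radial_nat n he hf

theorem _root_.Function.Even.hasFDerivAt_radial {f : ℝ → ℝ} (he : f.Even) (hf : ContDiff ℝ ∞ f)
    {s : ℝ} (hs : 0 ≤ s) {u : E} (hu : ‖u‖ = 1) :
    HasFDerivAt (fun w : E => f ‖w‖) (deriv f s • innerSL ℝ u) (s • u) := by
  obtain ⟨g, -, -, hfg⟩ := he.deriv_odd.exists_eq_mul (contDiff_deriv_of_contDiff_infty hf)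
  have hn : ‖s • u‖ = s := by rw [norm_smul, hu, mul_one, Real.norm_of_nonneg hs]
  have h := NearlyKahler.hasFDerivAt_radial hf hfg (s • u)
  rw [hn] at h
  convert! h using 1
  rw [hfg, map_smul, smul_smul, mul_comm]

end Radial

/-- A smooth function on a symmetric interval agrees near `0` with a globally smooth one, obtained
by multiplication with an even cutoff function. -/
theorem exists_even_cutoff {a : ℝ} (ha : 0 < a) : ∃ χ : ℝ → ℝ, ContDiff ℝ ∞ χ ∧ χ.Even ∧
    (∀ t, |t| ≤ a / 3 → χ t = 1) ∧ (∀ t, a / 2 ≤ |t| → χ t = 0) := by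
  let χ : ContDiffBump (0 : ℝ) := ⟨a / 3, a / 2, by positivity, by linarith⟩
  refine ⟨χ, χ.contDiff, χ.neg, fun t ht => χ.one_of_mem_closedBall (by simpa using ht),
    fun t ht => χ.zero_of_le_dist (by simpa using ht)⟩

theorem contDiff_cutoff_mul {a : ℝ} (ha : 0 < a) {χ f : ℝ → ℝ} (hχ : ContDiff ℝ ∞ χ)
    (hχ0 : ∀ t, a / 2 ≤ |t| → χ t = 0) (hf : ContDiffOn ℝ ∞ f (Ioo (-a) a)) :
    ContDiff ℝ ∞ (fun t => χ t * f t) := by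
  rw [contDiff_iff_contDiffAt]
  intro t
  by_cases ht : |t| < a
  · exact hχ.contDiffAt.mul (hf.contDiffAt (isOpen_Ioo.mem_nhds (abs_lt.1 ht)))
  · have : (fun t => χ t * f t) =ᶠ[𝓝 t] fun _ => 0 := by
      have ho : IsOpen {s : ℝ | a / 2 < |s|} := isOpen_lt continuous_const continuous_abs
      filter_upwards [ho.mem_nhds (show a / 2 < |t| by linarith [not_lt.1 ht])] with s hs
      rw [hχ0 s (le_of_lt hs), zero_mul]
    exact contDiffAt_const.congr_of_eventuallyEq this

/-- A nonvanishing smooth even function has, near `0`, a smooth even inverse. -/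
theorem _root_.Function.Even.exists_inv {h : ℝ → ℝ} (he : h.Even) (hh : ContDiff ℝ ∞ h)
    (h0 : h 0 ≠ 0) : ∃ u : ℝ → ℝ, ContDiff ℝ ∞ u ∧ u.Even ∧
      ∃ η > 0, ∀ t, |t| < η → h t * u t = 1 := by
  obtain ⟨r, hr, hball⟩ := Metric.eventually_nhds_iff.1
    (hh.continuous.continuousAt.eventually_ne h0)
  obtain ⟨χ, hχ, hχe, hχ1, hχ0⟩ := exists_even_cutoff hr
  have hne : ∀ t ∈ Ioo (-r) r, h t ≠ 0 := fun t ht => hball (by simpa using abs_lt.2 ht)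
  refine ⟨fun t => χ t * (h t)⁻¹, contDiff_cutoff_mul hr hχ hχ0
    (hh.contDiffOn.inv hne), fun t => ?_, r / 3, by positivity, fun t ht => ?_⟩
  · simp only [hχe t, he t]
  · have := hne t (abs_lt.1 (by linarith))
    simp only [hχ1 t ht.le]
    field_simp

end EvenFunctions

/-! ### The coefficient functions of an invariant almost Hermitian structure -/

/-- The coefficients of the 2-form
`α (x·y' - x'·y) + β ((w·x)(w·y') - (w·x')(w·y)) + δ w·(x × x') + κ w·(y × y')`
and of the endomorphism
`(x, y) ↦ (j₁ y + j₂ (w·y) w + j₃ w × x, k₁ x + k₂ (w·x) w - j₃ w × y)`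
of `su(2) + su(2)`, as functions of the norm of `w`. -/
structure Coefficients where
  (α β δ κ j₁ j₂ j₃ k₁ k₂ : ℝ → ℝ)
  smooth : ContDiff ℝ ∞ α ∧ ContDiff ℝ ∞ β ∧ ContDiff ℝ ∞ δ ∧ ContDiff ℝ ∞ κ ∧
    ContDiff ℝ ∞ j₁ ∧ ContDiff ℝ ∞ j₂ ∧ ContDiff ℝ ∞ j₃ ∧ ContDiff ℝ ∞ k₁ ∧ ContDiff ℝ ∞ k₂
  even : α.Even ∧ β.Even ∧ δ.Even ∧ κ.Even ∧
    j₁.Even ∧ j₂.Even ∧ j₃.Even ∧ k₁.Even ∧ k₂.Even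

namespace Coefficients

variable (c : Coefficients) (s : ℝ)

/-- The eigenvalue of `J` from the radial `y`-direction to the radial `x`-direction. -/
def τ : ℝ := c.j₁ s + c.j₂ s * s ^ 2

/-- The eigenvalue of `J` from the radial `x`-direction to the radial `y`-direction. -/
def σ : ℝ := c.k₁ s + c.k₂ s * s ^ 2

/-- The coefficient of `dω` on two tangential vectors and one radial one. -/
def A : ℝ := c.δ s - 2 * c.α s

/-- The algebraic conditions at distance `s` from the singular orbit under which the coefficients
define an almost Hermitian structure. -/
structure HermitianAt : Prop where
  τ_mul_σ : c.τ s * c.σ s = -1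
  j_mul_k : c.j₁ s * c.k₁ s = s ^ 2 * c.j₃ s ^ 2 - 1
  compat : c.k₁ s * c.κ s + c.j₁ s * c.δ s + 2 * c.j₃ s * c.α s = 0
  pos_radial : 0 < c.α s + c.β s * s ^ 2
  pos_σ : 0 < c.σ s
  pos_tangential : 0 < c.α s * c.k₁ s + s ^ 2 * c.δ s * c.j₃ s
  pos_det : 0 < c.α s ^ 2 - s ^ 2 * c.δ s * c.κ s

/-- The conditions at distance `s` from the singular orbit expressing that `dω` is of type
`(3,0) + (0,3)` and equal to three quarters of the Nijenhuis tensor. -/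
structure TorsionAt : Prop where
  d_α : deriv c.α s - c.β s * s = c.τ s * c.A s * s * c.j₃ s
  d_κ : 3 * c.κ s + s * deriv c.κ s = -(c.τ s * c.A s * c.j₁ s)
  d_δ : -(2 * c.α s) - 2 * c.β s * s ^ 2 + c.δ s + s * deriv c.δ s = -(c.τ s * c.A s * c.k₁ s)
  nijenhuis_radial : (2 * c.k₁ s * c.j₃ s + 2 * s ^ 2 * c.j₃ s ^ 2 - 2)
    * (c.α s + c.β s * s ^ 2) = 4 / 3 * -(c.τ s * c.A s * c.k₁ s)
  nijenhuis_x : (c.σ s * (c.j₃ s + s * deriv c.j₃ s) + c.k₁ s * c.j₃ s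
      + 2 * s ^ 2 * c.j₃ s ^ 2 - 2) * (s * c.δ s)
    + (c.σ s * deriv c.k₁ s - s * c.k₁ s * c.k₂ s + 2 * s * c.k₁ s * c.j₃ s) * c.α s = 0
  nijenhuis_y : (c.σ s * (c.j₃ s + s * deriv c.j₃ s) + c.k₁ s * c.j₃ s
      + 2 * s ^ 2 * c.j₃ s ^ 2 - 2) * c.α s
    + (c.σ s * deriv c.k₁ s - s * c.k₁ s * c.k₂ s + 2 * s * c.k₁ s * c.j₃ s) * (s * c.κ s)
    = 4 / 3 * c.A s
  A_ne_zero : c.A s ≠ 0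
  k₁_ne_zero : c.k₁ s ≠ 0

end Coefficients

/-! ### Consequences of the differential system -/

open Filter Topology

theorem eq_zero_of_hasDerivAt_of_eqOn_zero {g : ℝ → ℝ} {g' r s : ℝ} (hg : HasDerivAt g g' s)
    (h0 : ∀ x, |x| < r → g x = 0) (hs : |s| < r) : g' = 0 := by
  have : g =ᶠ[𝓝 s] fun _ => 0 := by
    filter_upwards [(isOpen_lt continuous_abs continuous_const).mem_nhds hs] with x hx
    exact h0 x hx
  exact hg.unique ((hasDerivAt_const s (0 : ℝ)).congr_of_eventuallyEq this)

theorem eq_zero_of_continuous_of_punctured {g : ℝ → ℝ} {r : ℝ} (hr : 0 < r) (hg : Continuous g)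
    (h0 : ∀ x, x ≠ 0 → |x| < r → g x = 0) : g 0 = 0 := by
  have h1 : Tendsto g (𝓝[≠] 0) (𝓝 (g 0)) := hg.continuousAt.tendsto.mono_left nhdsWithin_le_nhds
  have h2 : Tendsto g (𝓝[≠] 0) (𝓝 0) := by
    refine tendsto_const_nhds.congr' ?_
    have : {x : ℝ | |x| < r} ∈ 𝓝 (0 : ℝ) :=
      (isOpen_lt continuous_abs continuous_const).mem_nhds (by simpa using hr)
    filter_upwards [mem_nhdsWithin_of_mem_nhds this, self_mem_nhdsWithin] with x hx hx'
    exact (h0 x hx' hx).symm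
  exact tendsto_nhds_unique h1 h2

/-- The profile functions `φᵢ(s) = fᵢ(2s)` near the singular orbit, extended to the whole line,
together with the functions `p`, `q`, `S`, in terms of which the system is of first order. -/
structure Profile (μ r : ℝ) where
  (φ₁ φ₂ φ₃ φ₅ p q S : ℝ → ℝ)
  r_pos : 0 < r
  smooth : ContDiff ℝ ∞ φ₁ ∧ ContDiff ℝ ∞ φ₂ ∧ ContDiff ℝ ∞ φ₃ ∧ ContDiff ℝ ∞ φ₅
  smooth' : ContDiff ℝ ∞ p ∧ ContDiff ℝ ∞ q ∧ ContDiff ℝ ∞ S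
  even : φ₁.Even ∧ p.Even ∧ q.Even ∧ S.Even
  odd : φ₂.Odd ∧ φ₃.Odd ∧ φ₅.Odd
  neg : ∀ s, |s| < r → φ₁ s < 0
  d_φ₂ : ∀ s, deriv φ₂ s * φ₁ s = 2 * p s - φ₁ s ^ 2 / 2
  d_φ₃ : ∀ s, deriv φ₃ s * φ₁ s = 2 * q s + φ₁ s ^ 2 / 2
  d_φ₅ : ∀ s, deriv φ₅ s * φ₁ s = 2 * S s
  d_p : ∀ s, |s| < r → deriv p s = -(24 * μ * φ₁ s * φ₂ s)
  d_q : ∀ s, |s| < r → deriv q s = -(24 * μ * φ₁ s * φ₃ s)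
  d_S : ∀ s, |s| < r → deriv S s = 8 * (φ₅ s / φ₁ s) - 24 * μ * φ₁ s * φ₅ s
  constraint : ∀ s, |s| < r → p s - q s + 48 * μ * (φ₂ s * φ₃ s - φ₅ s ^ 2) = 0
  p_zero : p 0 = -S 0
  q_zero : q 0 = -S 0
  S_zero : S 0 ≠ 0

namespace Profile

variable {μ r : ℝ} (P : Profile μ r) {s : ℝ}

theorem ne_zero (hs : |s| < r) : P.φ₁ s ≠ 0 := (P.neg s hs).ne

theorem hasDerivAt_φ₂ (hs : |s| < r) :
    HasDerivAt P.φ₂ (2 * P.p s / P.φ₁ s - P.φ₁ s / 2) s := by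
  have h := (P.smooth.2.1.differentiable (by simp) s).hasDerivAt
  have h0 := P.ne_zero hs
  convert! h using 1
  rw [← mul_left_inj' h0, P.d_φ₂]
  field_simp

theorem hasDerivAt_φ₃ (hs : |s| < r) :
    HasDerivAt P.φ₃ (2 * P.q s / P.φ₁ s + P.φ₁ s / 2) s := by
  have h := (P.smooth.2.2.1.differentiable (by simp) s).hasDerivAt
  have h0 := P.ne_zero hs
  convert! h using 1
  rw [← mul_left_inj' h0, P.d_φ₃]
  field_simp

theorem hasDerivAt_φ₅ (hs : |s| < r) : HasDerivAt P.φ₅ (2 * P.S s / P.φ₁ s) s := by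
  have h := (P.smooth.2.2.2.differentiable (by simp) s).hasDerivAt
  have h0 := P.ne_zero hs
  convert! h using 1
  rw [← mul_left_inj' h0, P.d_φ₅]
  field_simp

theorem hasDerivAt_p (hs : |s| < r) : HasDerivAt P.p (-(24 * μ * P.φ₁ s * P.φ₂ s)) s :=
  P.d_p s hs ▸ (P.smooth'.1.differentiable (by simp) s).hasDerivAt

theorem hasDerivAt_q (hs : |s| < r) : HasDerivAt P.q (-(24 * μ * P.φ₁ s * P.φ₃ s)) s :=
  P.d_q s hs ▸ (P.smooth'.2.1.differentiable (by simp) s).hasDerivAt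

theorem hasDerivAt_S (hs : |s| < r) :
    HasDerivAt P.S (8 * (P.φ₅ s / P.φ₁ s) - 24 * μ * P.φ₁ s * P.φ₅ s) s :=
  P.d_S s hs ▸ (P.smooth'.2.2.differentiable (by simp) s).hasDerivAt

/-- The derivative of the constraint. -/
theorem orthogonality (hμ : μ ≠ 0) (hs : |s| < r) :
    P.p s * P.φ₃ s + P.q s * P.φ₂ s - 2 * P.S s * P.φ₅ s = 0 := by
  have h0 := P.ne_zero hs
  have h := eq_zero_of_hasDerivAt_of_eqOn_zero
    (((P.hasDerivAt_p hs).sub (P.hasDerivAt_q hs)).add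
      ((((P.hasDerivAt_φ₂ hs).mul (P.hasDerivAt_φ₃ hs)).sub
        ((P.hasDerivAt_φ₅ hs).pow 2)).const_mul (48 * μ))) P.constraint hs
  norm_num at h
  field_simp at h
  have h1 : μ * 96 * (P.p s * P.φ₃ s + P.q s * P.φ₂ s - 2 * P.S s * P.φ₅ s) = 0 := by
    linear_combination (1 / 2) * h
  simpa [hμ] using h1

/-- The algebraic condition is preserved by the system, and holds at `0`. -/
theorem algebraic (hμ : μ ≠ 0) (hs : |s| < r) : P.p s * P.q s - P.S s ^ 2 + 4 * P.φ₅ s ^ 2 = 0 := by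
  have hd : ∀ s ∈ Ioo (-r) r, HasDerivAt
      (fun s => P.p s * P.q s - P.S s ^ 2 + 4 * P.φ₅ s ^ 2) 0 s := by
    intro s hs
    have hs := abs_lt.2 hs
    have h0 := P.ne_zero hs
    convert! (((P.hasDerivAt_p hs).mul (P.hasDerivAt_q hs)).sub ((P.hasDerivAt_S hs).pow 2)).add
      (((P.hasDerivAt_φ₅ hs).pow 2).const_mul 4) using 1
    -- The derivative of the quantity is -24μφ₁ times the orthogonality relation.
    have h := P.orthogonality hμ hs
    field_simp
    linear_combination (24 * μ * P.φ₁ s ^ 2) * h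
  have hc := isOpen_Ioo.is_const_of_deriv_eq_zero (isPreconnected_Ioo)
    (fun s hs => (hd s hs).differentiableAt.differentiableWithinAt)
    (fun s hs => (hd s hs).deriv) (abs_lt.1 hs)
    (show (0 : ℝ) ∈ Ioo (-r) r from ⟨by linarith [P.r_pos], P.r_pos⟩)
  rw [hc, P.odd.2.2.map_zero, P.p_zero, P.q_zero]
  ring

/-- The derivative of the orthogonality relation, which fixes the normalization of the volume. -/
theorem normalization (hμ : μ ≠ 0) (hs : |s| < r) :
    P.φ₁ s ^ 2 * (P.p s - P.q s) = 64 / 3 * P.φ₅ s ^ 2 := by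
  have h0 := P.ne_zero hs
  have h := eq_zero_of_hasDerivAt_of_eqOn_zero
    ((((P.hasDerivAt_p hs).mul (P.hasDerivAt_φ₃ hs)).add
      ((P.hasDerivAt_q hs).mul (P.hasDerivAt_φ₂ hs))).sub
      (((P.hasDerivAt_S hs).const_mul 2).mul (P.hasDerivAt_φ₅ hs)))
          (fun x hx => P.orthogonality hμ hx)
    hs
  -- After differentiation, pq - S² is eliminated by the algebraic relation and φ₂φ₃ - φ₅² by the
  -- constraint; only p - q and φ₅² survive.
  have h1 := P.algebraic hμ hs
  have h2 := P.constraint s hs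
  field_simp at h
  linear_combination (1 / 3) * h - (8 / 3) * h1 + (2 / 3) * P.φ₁ s ^ 2 * h2

end Profile

/-! ### From the profile functions to the coefficients -/

open Filter Topology

namespace Profile

variable {μ r : ℝ} (P : Profile μ r)

/-- The relations between the profile functions and the coefficients. -/
structure Represents (c : Coefficients) (s : ℝ) : Prop where
  α_eq : 8 * (P.φ₂ s + P.φ₅ s) = 2 * s * c.α s
  β_eq : s ^ 2 * c.β s = -(2 * P.φ₁ s) - c.α s
  δ_eq : 8 * P.φ₂ s = s * c.δ s
  κ_eq : 8 * (P.φ₂ s + P.φ₃ s + 2 * P.φ₅ s) = 4 * s ^ 3 * c.κ s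
  j₁_eq : 4 * s * P.φ₅ s * c.j₁ s = P.p s + P.q s + 2 * P.S s
  j₂_eq : s ^ 2 * c.j₂ s * P.φ₁ s = 2 - c.j₁ s * P.φ₁ s
  j₃_eq : 2 * s * P.φ₅ s * c.j₃ s = -(P.p s + P.S s)
  k₁_eq : P.φ₅ s * c.k₁ s = s * P.p s
  k₂_eq : s ^ 2 * c.k₂ s = -(P.φ₁ s / 2) - c.k₁ s

/-- The relations are solved by dividing by powers of s. After writing φᵢ = s hᵢ, each remaining
quotient is an even function divided by s², and the point is that its numerator vanishes at 0. Since
φ₅ = s h₅ with h₅(0) ≠ 0, division by φ₅ costs one power of s and a local smooth even inverse of h₅.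
-/
theorem exists_represents (hμ : μ ≠ 0) : ∃ (c : Coefficients) (η : ℝ), 0 < η ∧ η ≤ r ∧
    (∀ s, |s| < η → P.Represents c s) ∧ (∀ s, s ≠ 0 → |s| < η → P.φ₅ s ≠ 0) ∧
    c.A 0 ≠ 0 ∧ c.k₁ 0 = -(P.φ₁ 0 / 2) := by
  have hr := P.r_pos
  have hr0 : |(0 : ℝ)| < r := by simpa using hr
  obtain ⟨s₁, s₂, s₃, s₅⟩ := P.smooth
  obtain ⟨sp, sq, sS⟩ := P.smooth'
  obtain ⟨e₁, ep, eq, eS⟩ := P.even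
  obtain ⟨o₂, o₃, o₅⟩ := P.odd
  obtain ⟨h₂, sh₂, eh₂, hh₂⟩ := o₂.exists_eq_mul s₂
  obtain ⟨h₃, sh₃, eh₃, hh₃⟩ := o₃.exists_eq_mul s₃
  obtain ⟨h₅, sh₅, eh₅, hh₅⟩ := o₅.exists_eq_mul s₅
  have deriv_zero : ∀ {f h : ℝ → ℝ} {d : ℝ}, ContDiff ℝ ∞ h → (∀ s, f s = s * h s) →
      HasDerivAt f d 0 → h 0 = d := by
    intro f h d sh hf hd
    have h1 := (hasDerivAt_id (0 : ℝ)).mul (sh.differentiable (by simp) 0).hasDerivAt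
    have h2 : f = id * h := funext hf
    have h3 := (h2 ▸ hd).unique h1
    simpa using h3.symm
  have n₁ := P.ne_zero hr0
  have v₂ : h₂ 0 * P.φ₁ 0 = -(2 * P.S 0) - P.φ₁ 0 ^ 2 / 2 := by
    rw [deriv_zero sh₂ hh₂ (P.hasDerivAt_φ₂ hr0), P.p_zero]
    field_simp
  have v₃ : h₃ 0 * P.φ₁ 0 = -(2 * P.S 0) + P.φ₁ 0 ^ 2 / 2 := by
    rw [deriv_zero sh₃ hh₃ (P.hasDerivAt_φ₃ hr0), P.q_zero]
    field_simp
  have v₅ : h₅ 0 * P.φ₁ 0 = 2 * P.S 0 := by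
    rw [deriv_zero sh₅ hh₅ (P.hasDerivAt_φ₅ hr0)]
    field_simp
  have n₅ : h₅ 0 ≠ 0 := by
    intro h
    rw [h, zero_mul] at v₅
    exact P.S_zero (by linarith)
  obtain ⟨u, su, eu, η₁, hη₁, hu⟩ := eh₅.exists_inv sh₅ n₅
  obtain ⟨v, sv, ev, η₂, hη₂, hv⟩ := e₁.exists_inv s₁ n₁
  have hu0 := hu 0 (by simpa using hη₁)
  have hv0 := hv 0 (by simpa using hη₂)
  have even_of : ∀ {f : ℝ → ℝ}, (∀ s, f (-s) = f s) → f.Even := fun h => h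
  obtain ⟨β, sβ, eβ, hβ⟩ := Function.Even.exists_eq_sq_mul
    (f := fun s => -(2 * P.φ₁ s) - 4 * (h₂ s + h₅ s))
    (fun s => by simp only [e₁ s, eh₂ s, eh₅ s]) (by fun_prop)
    (by rw [← mul_left_inj' n₁]; linear_combination (-4) * v₂ - 4 * v₅)
  obtain ⟨κ, sκ, eκ, hκ⟩ := Function.Even.exists_eq_sq_mul
    (f := fun s => 2 * (h₂ s + h₃ s + 2 * h₅ s))
    (fun s => by simp only [eh₂ s, eh₃ s, eh₅ s]) (by fun_prop)
    (by rw [← mul_left_inj' n₁]; linear_combination 2 * v₂ + 2 * v₃ + 4 * v₅)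
  obtain ⟨m, sm, em, hm⟩ := Function.Even.exists_eq_sq_mul
    (f := fun s => P.p s + P.q s + 2 * P.S s)
    (fun s => by simp only [ep s, eq s, eS s]) (by fun_prop)
    (by simp only [P.p_zero, P.q_zero]; ring)
  obtain ⟨b, sb, eb, hb⟩ := Function.Even.exists_eq_sq_mul
    (f := fun s => P.p s + P.S s)
    (fun s => by simp only [ep s, eS s]) (by fun_prop)
    (by simp only [P.p_zero]; ring)
  -- Since pq - S² = p(p + q + 2S) - (p + S)², the algebraic relation divided by s² reads p m - s²
  -- b² + 4 h₅² = 0 for s ≠ 0, and passes to the limit s = 0.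
  have hpm : P.p 0 * m 0 = -(4 * h₅ 0 ^ 2) := by
    have h := eq_zero_of_continuous_of_punctured hr
      (g := fun s => P.p s * m s - s ^ 2 * b s ^ 2 + 4 * h₅ s ^ 2)
      (by
        have := sp.continuous
        have := sm.continuous
        have := sb.continuous
        have := sh₅.continuous
        fun_prop) ?_
    · linear_combination h
    · intro s hs hsr
      have h1 := P.algebraic hμ hsr
      have h2 := hm s
      have h3 := hb s
      have h4 := hh₅ s
      rw [← mul_right_inj' (pow_ne_zero 2 hs), mul_zero]
      linear_combination h1 - P.p s * h2 + (P.p s + P.S s + s ^ 2 * b s) * h3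
        - 4 * (P.φ₅ s + s * h₅ s) * h4
  have hm0 : P.φ₁ 0 * m 0 = 8 * h₅ 0 := by
    rw [P.p_zero] at hpm
    rw [← mul_left_inj' n₅]
    linear_combination (m 0) * v₅ - 2 * hpm
  -- The numerator of j₂ is 2/φ₁ - j₁; its vanishing at 0 is the value of m(0) just found. Here the
  -- algebraic relation, and not only the initial conditions, is needed for smoothness.
  obtain ⟨l, sl, el, hl⟩ := Function.Even.exists_eq_sq_mul
    (f := fun s => 2 * v s - m s * u s / 4)
    (fun s => by simp only [em s, eu s, ev s]) (by fun_prop)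
    (by
      rw [← mul_left_inj' n₁, ← mul_left_inj' n₅]
      linear_combination (2 * h₅ 0) * hv0 - (m 0 * P.φ₁ 0 / 4) * hu0 - hm0 / 4)
  obtain ⟨k, sk, ek, hk⟩ := Function.Even.exists_eq_sq_mul
    (f := fun s => -(P.φ₁ s / 2) - P.p s * u s)
    (fun s => by simp only [e₁ s, ep s, eu s]) (by fun_prop)
    (by
      rw [← mul_left_inj' n₅]
      linear_combination (-P.p 0) * hu0 - v₅ / 2 - P.p_zero)
  refine ⟨{ α := fun s => 4 * (h₂ s + h₅ s), β := β, δ := fun s => 8 * h₂ s, κ := κ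
            j₁ := fun s => m s * u s / 4, j₂ := l, j₃ := fun s => -(b s * u s / 2)
            k₁ := fun s => P.p s * u s, k₂ := k
            smooth := ⟨by fun_prop, sβ, by fun_prop, sκ, by fun_prop, sl, by fun_prop,
              by fun_prop, sk⟩
            even := ⟨fun s => by simp only [eh₂ s, eh₅ s], eβ, fun s => by simp only [eh₂ s], eκ,
              fun s => by simp only [em s, eu s], el, fun s => by simp only [eb s, eu s],
              fun s => by simp only [ep s, eu s], ek⟩ },
    min r (min η₁ η₂), by positivity, min_le_left _ _, fun s hs => ?_, fun s hs0 hs => ?_, ?_, ?_⟩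
  · have hsr : |s| < r := lt_of_lt_of_le hs (min_le_left _ _)
    have hs1 := hu s (lt_of_lt_of_le hs ((min_le_right _ _).trans (min_le_left _ _)))
    have hs2 := hv s (lt_of_lt_of_le hs ((min_le_right _ _).trans (min_le_right _ _)))
    have w₂ := hh₂ s
    have w₃ := hh₃ s
    have w₅ := hh₅ s
    have wβ := hβ s
    have wκ := hκ s
    have wm := hm s
    have wb := hb s
    have wl := hl s
    have wk := hk s
    constructor <;> try simp only
    · linear_combination 8 * w₂ + 8 * w₅
    · linear_combination -wβ
    · linear_combination 8 * w₂
    · linear_combination 8 * w₂ + 8 * w₃ + 16 * w₅ + 4 * s * wκ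
    · linear_combination (s * m s * u s) * w₅ + s ^ 2 * m s * hs1 - wm
    · linear_combination (-P.φ₁ s) * wl + 2 * hs2
    · linear_combination (-(s * b s * u s)) * w₅ - s ^ 2 * b s * hs1 + wb
    · linear_combination (P.p s * u s) * w₅ + s * P.p s * hs1
    · linear_combination -wk
  · have hs1 := hu s (lt_of_lt_of_le hs ((min_le_right _ _).trans (min_le_left _ _)))
    rw [hh₅]
    exact mul_ne_zero hs0 (left_ne_zero_of_mul_eq_one hs1)
  · simp only [Coefficients.A]
    intro h
    exact n₅ (by linarith)
  · simp only
    rw [← mul_left_inj' n₅]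
    linear_combination P.p 0 * hu0 + v₅ / 2 + P.p_zero

end Profile

open Filter Topology

theorem Coefficients.hasDerivAt (c : Coefficients) (s : ℝ) :
    HasDerivAt c.α (deriv c.α s) s ∧ HasDerivAt c.δ (deriv c.δ s) s ∧
    HasDerivAt c.κ (deriv c.κ s) s ∧ HasDerivAt c.j₃ (deriv c.j₃ s) s ∧
    HasDerivAt c.k₁ (deriv c.k₁ s) s := by
  obtain ⟨h1, -, h3, h4, -, -, h7, h8, -⟩ := c.smooth
  refine ⟨?_, ?_, ?_, ?_, ?_⟩ <;> apply DifferentiableAt.hasDerivAt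
  exacts [h1.differentiable (by simp) s, h3.differentiable (by simp) s,
    h4.differentiable (by simp) s, h7.differentiable (by simp) s, h8.differentiable (by simp) s]

namespace Profile

variable {μ r : ℝ} {P : Profile μ r} {c : Coefficients} {η s : ℝ}

/-- The defining relations are differentiated in product form on the whole interval, so no division
by s or φ₅ occurs and the derivatives of the profile can be replaced through the system. -/
theorem deriv_relations (hη : η ≤ r) (h : ∀ s, |s| < η → P.Represents c s) (hs : |s| < η) :
    8 * ((2 * P.p s / P.φ₁ s - P.φ₁ s / 2) + 2 * P.S s / P.φ₁ s)
      = 2 * c.α s + 2 * s * deriv c.α s ∧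
    8 * (2 * P.p s / P.φ₁ s - P.φ₁ s / 2) = c.δ s + s * deriv c.δ s ∧
    8 * ((2 * P.p s / P.φ₁ s - P.φ₁ s / 2) + (2 * P.q s / P.φ₁ s + P.φ₁ s / 2)
      + 2 * (2 * P.S s / P.φ₁ s)) = 12 * s ^ 2 * c.κ s + 4 * s ^ 3 * deriv c.κ s ∧
    2 * P.φ₅ s * c.j₃ s + 2 * s * (2 * P.S s / P.φ₁ s) * c.j₃ s + 2 * s * P.φ₅ s * deriv c.j₃ s
      = 24 * μ * P.φ₁ s * P.φ₂ s - 8 * (P.φ₅ s / P.φ₁ s) + 24 * μ * P.φ₁ s * P.φ₅ s ∧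
    2 * P.S s / P.φ₁ s * c.k₁ s + P.φ₅ s * deriv c.k₁ s
      = P.p s - s * (24 * μ * P.φ₁ s * P.φ₂ s) := by
  have hsr := lt_of_lt_of_le hs hη
  have d₂ := P.hasDerivAt_φ₂ hsr
  have d₃ := P.hasDerivAt_φ₃ hsr
  have d₅ := P.hasDerivAt_φ₅ hsr
  have dp := P.hasDerivAt_p hsr
  have dS := P.hasDerivAt_S hsr
  obtain ⟨dα, dδ, dκ, dj, dk⟩ := c.hasDerivAt s
  have di := hasDerivAt_id s
  refine ⟨?_, ?_, ?_, ?_, ?_⟩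
  · have := eq_zero_of_hasDerivAt_of_eqOn_zero
      (((d₂.add d₅).const_mul 8).sub ((di.const_mul 2).mul dα))
      (fun x hx => sub_eq_zero.2 (h x hx).α_eq) hs
    simp only [id_eq] at this
    linear_combination this
  · have := eq_zero_of_hasDerivAt_of_eqOn_zero ((d₂.const_mul 8).sub (di.mul dδ))
      (fun x hx => sub_eq_zero.2 (h x hx).δ_eq) hs
    simp only [id_eq] at this
    linear_combination this
  · have := eq_zero_of_hasDerivAt_of_eqOn_zero
      ((((d₂.add d₃).add (d₅.const_mul 2)).const_mul 8).sub (((di.pow 3).const_mul 4).mul dκ))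
      (fun x hx => sub_eq_zero.2 (h x hx).κ_eq) hs
    norm_num [id_eq] at this
    linear_combination this
  · have := eq_zero_of_hasDerivAt_of_eqOn_zero
      ((((di.const_mul 2).mul d₅).mul dj).sub (dp.add dS).neg)
      (fun x hx => sub_eq_zero.2 (h x hx).j₃_eq) hs
    simp only [id_eq, Pi.mul_apply] at this
    linear_combination this
  · have := eq_zero_of_hasDerivAt_of_eqOn_zero ((d₅.mul dk).sub (di.mul dp))
      (fun x hx => sub_eq_zero.2 (h x hx).k₁_eq) hs
    simp only [id_eq] at this
    linear_combination this

/-- Away from the singular orbit the relations can be solved explicitly. The radial eigenvalues τ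
and σ and the radial coefficient of ω depend on φ₁ only, and A on φ₅ only. -/
theorem values (hs : s ≠ 0) (h1 : P.φ₁ s ≠ 0) (h5 : P.φ₅ s ≠ 0) (h : P.Represents c s) :
    c.α s = 4 * (P.φ₂ s + P.φ₅ s) / s ∧
    c.δ s = 8 * P.φ₂ s / s ∧
    c.κ s = 2 * (P.φ₂ s + P.φ₃ s + 2 * P.φ₅ s) / s ^ 3 ∧
    c.j₁ s = (P.p s + P.q s + 2 * P.S s) / (4 * s * P.φ₅ s) ∧
    c.j₃ s = -(P.p s + P.S s) / (2 * s * P.φ₅ s) ∧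
    c.k₁ s = s * P.p s / P.φ₅ s ∧
    c.τ s = 2 / P.φ₁ s ∧ c.σ s = -P.φ₁ s / 2 ∧ c.A s = -8 * P.φ₅ s / s ∧
    c.α s + c.β s * s ^ 2 = -2 * P.φ₁ s := by
  have hα := h.α_eq
  have hβ := h.β_eq
  have hδ := h.δ_eq
  have hκ := h.κ_eq
  have hj₁ := h.j₁_eq
  have hj₂ := h.j₂_eq
  have hj₃ := h.j₃_eq
  have hk₁ := h.k₁_eq
  have hk₂ := h.k₂_eq
  refine ⟨?_, ?_, ?_, ?_, ?_, ?_, ?_, ?_, ?_, ?_⟩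
  · rw [eq_div_iff hs]; linarith
  · rw [eq_div_iff hs]; linarith
  · rw [eq_div_iff (pow_ne_zero 3 hs)]; linarith
  · rw [eq_div_iff (by positivity)]; linarith
  · rw [eq_div_iff (by positivity)]; linarith
  · rw [eq_div_iff h5]; linarith
  · rw [Coefficients.τ, eq_div_iff h1]; linarith
  · rw [Coefficients.σ]; linarith
  · rw [Coefficients.A, eq_div_iff hs]; linarith
  · linarith

/-- After clearing denominators the second identity is the algebraic relation and the third is the
orthogonality relation; the first is immediate from τ = 2/φ₁ and σ = -φ₁/2. -/
theorem hermitian_relations (hμ : μ ≠ 0) (hs : s ≠ 0) (hsr : |s| < r) (h5 : P.φ₅ s ≠ 0)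
    (h : P.Represents c s) :
    c.τ s * c.σ s = -1 ∧ c.j₁ s * c.k₁ s = s ^ 2 * c.j₃ s ^ 2 - 1 ∧
    c.k₁ s * c.κ s + c.j₁ s * c.δ s + 2 * c.j₃ s * c.α s = 0 := by
  have h1 := P.ne_zero hsr
  have hc := P.constraint s hsr
  have ho := P.orthogonality hμ hsr
  have ha := P.algebraic hμ hsr
  have hn := P.normalization hμ hsr
  obtain ⟨hα, hδ, hκ, hj₁, hj₃, hk₁, hτ, hσ, -, -⟩ := values hs h1 h5 h
  rw [hα, hδ, hκ, hj₁, hj₃, hk₁, hτ, hσ]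
  refine ⟨by field_simp, ?_, ?_⟩
  · field_simp
    linear_combination 4 * ha
  · field_simp
    linear_combination 8 * ho

/-- The first three identities, on the type of dω, use only the definitions of p, q, S as
derivatives of the φᵢ: J has been built from p, q, S so that they hold. The Nijenhuis identities
carry the content of the system: the radial one is the normalization, and the last combines the
constraint with the normalization. -/
theorem torsion_relations (hμ : μ ≠ 0) (hη : η ≤ r) (h : ∀ s, |s| < η → P.Represents c s)
    (hs : s ≠ 0) (hsr : |s| < η) (h5 : P.φ₅ s ≠ 0) :
    (deriv c.α s - c.β s * s = c.τ s * c.A s * s * c.j₃ s) ∧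
    (3 * c.κ s + s * deriv c.κ s = -(c.τ s * c.A s * c.j₁ s)) ∧
    (-(2 * c.α s) - 2 * c.β s * s ^ 2 + c.δ s + s * deriv c.δ s = -(c.τ s * c.A s * c.k₁ s)) ∧
    ((2 * c.k₁ s * c.j₃ s + 2 * s ^ 2 * c.j₃ s ^ 2 - 2)
      * (c.α s + c.β s * s ^ 2) = 4 / 3 * -(c.τ s * c.A s * c.k₁ s)) ∧
    ((c.σ s * (c.j₃ s + s * deriv c.j₃ s) + c.k₁ s * c.j₃ s
        + 2 * s ^ 2 * c.j₃ s ^ 2 - 2) * (s * c.δ s)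
      + (c.σ s * deriv c.k₁ s - s * c.k₁ s * c.k₂ s + 2 * s * c.k₁ s * c.j₃ s) * c.α s = 0) ∧
    ((c.σ s * (c.j₃ s + s * deriv c.j₃ s) + c.k₁ s * c.j₃ s
        + 2 * s ^ 2 * c.j₃ s ^ 2 - 2) * c.α s
      + (c.σ s * deriv c.k₁ s - s * c.k₁ s * c.k₂ s + 2 * s * c.k₁ s * c.j₃ s) * (s * c.κ s)
      = 4 / 3 * c.A s) := by
  have hsr' := lt_of_lt_of_le hsr hη
  have h1 := P.ne_zero hsr'
  have hc := P.constraint s hsr'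
  have ho := P.orthogonality hμ hsr'
  have ha := P.algebraic hμ hsr'
  have hn := P.normalization hμ hsr'
  obtain ⟨-, hjk, -⟩ := hermitian_relations hμ hs hsr' h5 (h s hsr)
  obtain ⟨hα, hδ, hκ, hj₁, hj₃, hk₁, hτ, hσ, hA, hF⟩ := values hs h1 h5 (h s hsr)
  obtain ⟨dα, dδ, dκ, dj, dk⟩ := deriv_relations hη h hsr
  have hβ : c.β s * s = (-2 * P.φ₁ s - c.α s) / s := by rw [eq_div_iff hs]; linarith
  -- The two tangential coefficients of the Nijenhuis tensor. The equations for p' and S' enter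
  -- here, and everything except terms proportional to μ cancels.
  have hn' : c.σ s * (c.j₃ s + s * deriv c.j₃ s) + c.k₁ s * c.j₃ s
        + 2 * s ^ 2 * c.j₃ s ^ 2 - 2 = -(6 * μ * P.φ₁ s ^ 2 * (P.φ₂ s + P.φ₅ s)) / P.φ₅ s := by
    have : c.j₃ s + s * deriv c.j₃ s = (24 * μ * P.φ₁ s * P.φ₂ s - 8 * (P.φ₅ s / P.φ₁ s)
        + 24 * μ * P.φ₁ s * P.φ₅ s - 2 * s * (2 * P.S s / P.φ₁ s) * c.j₃ s) / (2 * P.φ₅ s) := by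
      rw [eq_div_iff (by positivity)]
      linear_combination dj
    rw [this, hσ, hj₃, hk₁]
    field_simp
    ring
  have hm' : c.σ s * deriv c.k₁ s - s * c.k₁ s * c.k₂ s + 2 * s * c.k₁ s * c.j₃ s
      = 12 * μ * P.φ₁ s ^ 2 * P.φ₂ s * s / P.φ₅ s := by
    have : deriv c.k₁ s = (P.p s - s * (24 * μ * P.φ₁ s * P.φ₂ s)
        - 2 * P.S s / P.φ₁ s * c.k₁ s) / P.φ₅ s := by
      rw [eq_div_iff h5]
      linear_combination dk
    have hk₂ : c.k₂ s = (-(P.φ₁ s / 2) - c.k₁ s) / s ^ 2 := by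
      rw [eq_div_iff (pow_ne_zero 2 hs)]
      linear_combination (h s hsr).k₂_eq
    rw [hk₂, this, hσ, hj₃, hk₁]
    field_simp
    ring
  refine ⟨?_, ?_, ?_, ?_, ?_, ?_⟩
  · rw [← mul_right_inj' (mul_ne_zero two_ne_zero hs)]
    have : 2 * s * (deriv c.α s - c.β s * s) = (2 * c.α s + 2 * s * deriv c.α s) - 2 * c.α s
      - 2 * s * (c.β s * s) := by ring
    rw [this, ← dα, hβ, hα, hτ, hA, hj₃]
    field_simp
    ring
  · rw [← mul_right_inj' (mul_ne_zero four_ne_zero (pow_ne_zero 2 hs))]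
    have : 4 * s ^ 2 * (3 * c.κ s + s * deriv c.κ s)
        = 12 * s ^ 2 * c.κ s + 4 * s ^ 3 * deriv c.κ s := by ring
    rw [this, ← dκ, hτ, hA, hj₁]
    field_simp
    ring
  · have : -(2 * c.α s) - 2 * c.β s * s ^ 2 + c.δ s + s * deriv c.δ s
        = -2 * (c.α s + c.β s * s ^ 2) + (c.δ s + s * deriv c.δ s) := by ring
    rw [this, hF, ← dδ, hτ, hA, hk₁]
    field_simp
    ring
  -- The relation j₁k₁ = s²j₃² - 1 makes the radial coefficient factor, leaving p times the
  -- normalization.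
  · have : 2 * c.k₁ s * c.j₃ s + 2 * s ^ 2 * c.j₃ s ^ 2 - 2
        = 2 * c.k₁ s * (c.j₁ s + c.j₃ s) := by linear_combination (-2) * hjk
    rw [this, hF, hτ, hA, hk₁, hj₁, hj₃]
    field_simp
    linear_combination 6 * P.p s * hn
  · rw [hn', hm', hδ, hα]
    field_simp
    ring
  · rw [hn', hm', hα, hκ, hA]
    field_simp
    linear_combination (3 / 2) * P.φ₁ s ^ 2 * hc - (3 / 2) * hn

/-- Equalities are proved for s ≠ 0 and extended to s = 0 by continuity. Inequalities that do not
follow from φ₁ < 0 are checked at s = 0 and kept by shrinking the interval. -/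
theorem exists_coefficients (P : Profile μ r) (hμ : μ ≠ 0) :
    ∃ (c : Coefficients) (η : ℝ), 0 < η ∧ η ≤ r ∧ (∀ s, |s| < η → P.Represents c s) ∧
        (∀ s, |s| < η → c.HermitianAt s) ∧
    (∀ s, |s| < η → c.TorsionAt s) := by
  obtain ⟨c, η, hη, hηr, hrep, h5, hA0, hk0⟩ := P.exists_represents hμ
  have hη0 : |(0 : ℝ)| < η := by simpa using hη
  have hneg := P.neg 0 (by simpa using P.r_pos)
  obtain ⟨sα, sβ, sδ, sκ, sj₁, sj₂, sj₃, sk₁, sk₂⟩ := c.smooth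
  have cα := sα.continuous
  have cβ := sβ.continuous
  have cδ := sδ.continuous
  have cκ := sκ.continuous
  have cj₁ := sj₁.continuous
  have cj₂ := sj₂.continuous
  have cj₃ := sj₃.continuous
  have ck₁ := sk₁.continuous
  have ck₂ := sk₂.continuous
  have cdα := (contDiff_deriv_of_contDiff_infty sα).continuous
  have cdδ := (contDiff_deriv_of_contDiff_infty sδ).continuous
  have cdκ := (contDiff_deriv_of_contDiff_infty sκ).continuous
  have cdj₃ := (contDiff_deriv_of_contDiff_infty sj₃).continuous
  have cdk₁ := (contDiff_deriv_of_contDiff_infty sk₁).continuous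
  have extend : ∀ {f g : ℝ → ℝ}, Continuous f → Continuous g →
      (∀ s, s ≠ 0 → |s| < η → f s = g s) → ∀ s, |s| < η → f s = g s := by
    intro f g hf hg h s hs
    rcases eq_or_ne s 0 with rfl | hs0
    · exact sub_eq_zero.1 (eq_zero_of_continuous_of_punctured hη (hf.sub hg)
        fun x hx hx' => sub_eq_zero.2 (h x hx hx'))
    · exact h s hs0 hs
  have α0 : c.α 0 = -(2 * P.φ₁ 0) := by
    have := (hrep 0 hη0).β_eq
    linarith
  -- At s = 0 one has α = -2φ₁ and k₁ = -φ₁/2, so the first two expressions equal φ₁² and 4φ₁².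
  have ev : ∀ᶠ s in 𝓝 (0 : ℝ), (0 < c.α s * c.k₁ s + s ^ 2 * c.δ s * c.j₃ s) ∧
      (0 < c.α s ^ 2 - s ^ 2 * c.δ s * c.κ s) ∧ c.A s ≠ 0 ∧ c.k₁ s ≠ 0 := by
    have h1 : Continuous fun s => c.α s * c.k₁ s + s ^ 2 * c.δ s * c.j₃ s := by fun_prop
    have h2 : Continuous fun s => c.α s ^ 2 - s ^ 2 * c.δ s * c.κ s := by fun_prop
    have h3 : Continuous fun s => c.A s := by simp only [Coefficients.A]; fun_prop
    refine (h1.continuousAt.eventually (lt_mem_nhds ?_)).and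
      ((h2.continuousAt.eventually (lt_mem_nhds ?_)).and
      ((h3.continuousAt.eventually_ne hA0).and (ck₁.continuousAt.eventually_ne ?_)))
    · beta_reduce
      rw [α0, hk0]
      nlinarith
    · beta_reduce
      rw [α0]
      nlinarith
    · rw [hk0]
      linarith
  obtain ⟨ρ, hρ, hev⟩ := Metric.eventually_nhds_iff.1 ev
  have lt_η : ∀ {s}, |s| < min η ρ → |s| < η := fun h => lt_of_lt_of_le h (min_le_left _ _)
  have hev' : ∀ {s}, |s| < min η ρ → _ := fun {s} h =>
    hev (y := s) (by simpa using lt_of_lt_of_le h (min_le_right _ _))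
  have cτ : Continuous c.τ := by unfold Coefficients.τ; fun_prop
  have cσ : Continuous c.σ := by unfold Coefficients.σ; fun_prop
  have cA : Continuous c.A := by unfold Coefficients.A; fun_prop
  have herm := fun s hs0 hs => hermitian_relations hμ hs0 (lt_of_lt_of_le hs hηr) (h5 s hs0 hs)
    (hrep s hs)
  have tors := fun s hs0 hs => torsion_relations hμ hηr hrep hs0 hs (h5 s hs0 hs)
  refine ⟨c, min η ρ, lt_min hη hρ, (min_le_left _ _).trans hηr, fun s hs => hrep s (lt_η hs),
    fun s hs => ⟨?_, ?_, ?_, ?_, ?_, (hev' hs).1, (hev' hs).2.1⟩,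
    fun s hs => ⟨?_, ?_, ?_, ?_, ?_, ?_, (hev' hs).2.2.1, (hev' hs).2.2.2⟩⟩
  · exact extend (by fun_prop) (by fun_prop) (fun s h h' => (herm s h h').1) s (lt_η hs)
  · exact extend (by fun_prop) (by fun_prop) (fun s h h' => (herm s h h').2.1) s (lt_η hs)
  · exact extend (by fun_prop) (by fun_prop) (fun s h h' => (herm s h h').2.2) s (lt_η hs)
  · have := (hrep s (lt_η hs)).β_eq
    have := P.neg s (lt_of_lt_of_le (lt_η hs) hηr)
    linarith
  · have := (hrep s (lt_η hs)).k₂_eq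
    have := P.neg s (lt_of_lt_of_le (lt_η hs) hηr)
    rw [Coefficients.σ]
    linarith
  · exact extend (by fun_prop) (by fun_prop) (fun s h h' => (tors s h h').1) s (lt_η hs)
  · exact extend (by fun_prop) (by fun_prop) (fun s h h' => (tors s h h').2.1) s (lt_η hs)
  · exact extend (by fun_prop) (by fun_prop) (fun s h h' => (tors s h h').2.2.1) s (lt_η hs)
  · exact extend (by fun_prop) (by fun_prop) (fun s h h' => (tors s h h').2.2.2.1) s (lt_η hs)
  · exact extend (by fun_prop) (by fun_prop) (fun s h h' => (tors s h h').2.2.2.2.1) s (lt_η hs)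
  · exact extend (by fun_prop) (by fun_prop) (fun s h h' => (tors s h h').2.2.2.2.2) s (lt_η hs)

end Profile

/-! ### From a solution of the system to a profile -/

open Filter Topology

/-- A solution of the system gives a profile. -/
theorem exists_profile {a μ : ℝ} (ha : 0 < a) {f₁ f₂ f₃ f₅ : ℝ → ℝ}
    (hs₁ : ContDiffOn ℝ ∞ f₁ (Ioo (-a) a)) (hs₂ : ContDiffOn ℝ ∞ f₂ (Ioo (-a) a))
    (hs₃ : ContDiffOn ℝ ∞ f₃ (Ioo (-a) a)) (hs₅ : ContDiffOn ℝ ∞ f₅ (Ioo (-a) a))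
    (heven : ∀ t ∈ Ioo (-a) a, f₁ (-t) = f₁ t)
    (hneg : ∀ t ∈ Ioo (-a) a, f₁ t < 0)
    (hodd₂ : ∀ t ∈ Ioo (-a) a, f₂ (-t) = -f₂ t)
    (hodd₃ : ∀ t ∈ Ioo (-a) a, f₃ (-t) = -f₃ t)
    (hodd₅ : ∀ t ∈ Ioo (-a) a, f₅ (-t) = -f₅ t)
    (hd₃ : deriv f₃ 0 = f₁ 0 / 2 + deriv f₂ 0)
    (hd₅ : deriv f₅ 0 = -(f₁ 0 / 4) - deriv f₂ 0)
    (hd₅' : deriv f₅ 0 ≠ 0)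
    (hsys : ∀ t ∈ Ioo (-a) a, SystemAt μ f₁ f₂ f₃ f₅ t) :
    ∃ (r : ℝ) (P : Profile μ r), 2 * r ≤ a ∧ ∀ s, |s| < r →
      P.φ₁ s = f₁ (2 * s) ∧ P.φ₂ s = f₂ (2 * s) ∧ P.φ₃ s = f₃ (2 * s) ∧ P.φ₅ s = f₅ (2 * s) := by
  -- The variable s is half of t, so the functions live on |s| < a/2. An even cutoff makes them
  -- global without destroying parity, and equals 1 for |s| ≤ a/6 = r.
  obtain ⟨χ, hχ, hχe, hχ1, hχ0⟩ := exists_even_cutoff (half_pos ha)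
  have smooth : ∀ {f : ℝ → ℝ}, ContDiffOn ℝ ∞ f (Ioo (-a) a) →
      ContDiff ℝ ∞ (fun s => χ s * f (2 * s)) := by
    intro f hf
    refine contDiff_cutoff_mul (half_pos ha) hχ hχ0 (hf.comp (by fun_prop) ?_)
    rintro s ⟨h1, h2⟩
    exact ⟨by linarith, by linarith⟩
  have parity : ∀ {f : ℝ → ℝ} {e : ℝ}, (∀ t ∈ Ioo (-a) a, f (-t) = e * f t) →
      ∀ s, χ (-s) * f (2 * -s) = e * (χ s * f (2 * s)) := by
    intro f e h s
    rw [hχe s]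
    by_cases hs : |s| < a / 2
    · have := abs_lt.1 hs
      rw [mul_neg, h _ ⟨by linarith, by linarith⟩]
      ring
    · rw [hχ0 s (by linarith)]
      ring
  set r := a / 2 / 3 with hr
  have mem : ∀ {s}, |s| < r → 2 * s ∈ Ioo (-a) a := by
    intro s hs
    have := abs_lt.1 hs
    exact ⟨by linarith, by linarith⟩
  have val : ∀ (f : ℝ → ℝ) {s}, |s| < r → χ s * f (2 * s) = f (2 * s) := by
    intro f s hs
    rw [hχ1 s hs.le, one_mul]
  have near : ∀ {g h : ℝ → ℝ} {s}, (∀ s, |s| < r → g s = h (2 * s)) → |s| < r →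
      deriv g s = 2 * deriv h (2 * s) := by
    intro g h s hgh hs
    have : g =ᶠ[𝓝 s] fun x => h (2 * x) := by
      filter_upwards [(isOpen_lt continuous_abs continuous_const).mem_nhds hs] with x hx
      exact hgh x hx
    rw [this.deriv_eq, deriv_comp_mul_left, smul_eq_mul]
  have der : ∀ (f : ℝ → ℝ) {s}, |s| < r → deriv (fun s => χ s * f (2 * s)) s
      = 2 * deriv f (2 * s) := fun f _ hs => near (fun s hs => val f hs) hs
  have s₁ := smooth hs₁
  have s₂ := smooth hs₂
  have s₃ := smooth hs₃
  have s₅ := smooth hs₅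
  have d₂ := contDiff_deriv_of_contDiff_infty s₂
  have d₃ := contDiff_deriv_of_contDiff_infty s₃
  have d₅ := contDiff_deriv_of_contDiff_infty s₅
  have e₁ : Function.Even (fun s => χ s * f₁ (2 * s)) := fun s => by
    simpa using parity (e := 1) (by simpa using heven) s
  have o₂ : Function.Odd (fun s => χ s * f₂ (2 * s)) := fun s => by
    simpa using parity (e := -1) (by simpa using hodd₂) s
  have o₃ : Function.Odd (fun s => χ s * f₃ (2 * s)) := fun s => by
    simpa using parity (e := -1) (by simpa using hodd₃) s
  have o₅ : Function.Odd (fun s => χ s * f₅ (2 * s)) := fun s => by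
    simpa using parity (e := -1) (by simpa using hodd₅) s
  have e₂ := o₂.deriv_even
  have e₃ := o₃.deriv_even
  have e₅ := o₅.deriv_even
  have hr0 : |(0 : ℝ)| < r := by simpa [hr] using ha
  have v₁ := val f₁ hr0
  have w₂ := der f₂ hr0
  have w₃ := der f₃ hr0
  have w₅ := der f₅ hr0
  have hneg0 := hneg 0 (by simpa using mem hr0)
  let P : Profile μ r :=
    { φ₁ := fun s => χ s * f₁ (2 * s)
      φ₂ := fun s => χ s * f₂ (2 * s)
      φ₃ := fun s => χ s * f₃ (2 * s)
      φ₅ := fun s => χ s * f₅ (2 * s)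
      -- The factor 1/2 undoes the chain rule for s ↦ 2s: for |s| < r this is (f₂' + f₁/4) f₁ at 2s.
      -- The same holds for q and S.
      p := fun s => (deriv (fun s => χ s * f₂ (2 * s)) s / 2 + χ s * f₁ (2 * s) / 4)
        * (χ s * f₁ (2 * s))
      q := fun s => (deriv (fun s => χ s * f₃ (2 * s)) s / 2 - χ s * f₁ (2 * s) / 4)
        * (χ s * f₁ (2 * s))
      S := fun s => deriv (fun s => χ s * f₅ (2 * s)) s / 2 * (χ s * f₁ (2 * s))
      r_pos := by positivity
      smooth := ⟨s₁, s₂, s₃, s₅⟩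
      smooth' := ⟨((d₂.div_const 2).add (s₁.div_const 4)).mul s₁,
        ((d₃.div_const 2).sub (s₁.div_const 4)).mul s₁, (d₅.div_const 2).mul s₁⟩
      even := by
        have e₁' := fun s => e₁ s
        simp only at e₁'
        exact ⟨e₁, fun s => by simp only [e₁' s, e₂ s], fun s => by simp only [e₁' s, e₃ s],
          fun s => by simp only [e₁' s, e₅ s]⟩
      odd := ⟨o₂, o₃, o₅⟩
      neg := fun s hs => by
        rw [val f₁ hs]
        exact hneg _ (mem hs)
      d_φ₂ := fun s => by ring
      d_φ₃ := fun s => by ring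
      d_φ₅ := fun s => by ring
      d_p := fun s hs => by
        rw [near (h := fun t => (deriv f₂ t + f₁ t / 4) * f₁ t)
          (fun s hs => by rw [der f₂ hs, val f₁ hs]; ring) hs, val f₁ hs, val f₂ hs]
        linear_combination 2 * (hsys _ (mem hs)).1
      d_q := fun s hs => by
        rw [near (h := fun t => (deriv f₃ t - f₁ t / 4) * f₁ t)
          (fun s hs => by rw [der f₃ hs, val f₁ hs]; ring) hs, val f₁ hs, val f₃ hs]
        linear_combination 2 * (hsys _ (mem hs)).2.1
      d_S := fun s hs => by
        rw [near (h := fun t => deriv f₅ t * f₁ t)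
          (fun s hs => by rw [der f₅ hs, val f₁ hs]; ring) hs, val f₁ hs, val f₅ hs]
        linear_combination 2 * (hsys _ (mem hs)).2.2.1
      constraint := fun s hs => by
        rw [der f₂ hs, der f₃ hs, val f₁ hs, val f₂ hs, val f₃ hs, val f₅ hs]
        linear_combination (hsys _ (mem hs)).2.2.2
      p_zero := by
        rw [w₂, w₅, v₁]
        simp only [mul_zero]
        rw [hd₅]
        ring
      q_zero := by
        rw [w₃, w₅, v₁]
        simp only [mul_zero]
        rw [hd₅, hd₃]
        ring
      S_zero := by
        rw [w₅, v₁]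
        simp only [mul_zero]
        refine mul_ne_zero ?_ hneg0.ne
        simpa using hd₅' }
  exact ⟨r, P, by linarith, fun s hs => ⟨val f₁ hs, val f₂ hs, val f₃ hs, val f₅ hs⟩⟩

/-! ### Pointwise algebra of almost Hermitian structures in a Lie-algebra-valued parallelism -/

/-- The 1-jet at a point of an almost Hermitian structure, read in a parallelism with values in
`V`: the metric `g`, the almost complex structure `J`, their derivatives `Dg X`, `DJ X` in the
direction `X`, and the bracket `br` of the parallelism. -/
structure HermitianJet (V : Type*) [NormedAddCommGroup V] [NormedSpace ℝ V] where
  g : V →L[ℝ] V →L[ℝ] ℝ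
  J : V →L[ℝ] V
  Dg : V →L[ℝ] V →L[ℝ] V →L[ℝ] ℝ
  DJ : V →L[ℝ] V →L[ℝ] V
  br : V →L[ℝ] V →L[ℝ] V
  g_symm : ∀ X Y, g X Y = g Y X
  g_pos : ∀ X, X ≠ 0 → 0 < g X X
  J_sq : ∀ X, J (J X) = -X
  g_J : ∀ X Y, g (J X) (J Y) = g X Y
  Dg_symm : ∀ X Y Z, Dg X Y Z = Dg X Z Y
  DJ_J : ∀ X Y, DJ X (J Y) = -J (DJ X Y)
  Dg_J : ∀ X Y Z, Dg X (J Y) Z + g (DJ X Y) Z + Dg X Y (J Z) + g Y (DJ X Z) = 0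
  br_skew : ∀ X Y, br X Y = -br Y X

namespace HermitianJet

variable {V : Type*} [NormedAddCommGroup V] [NormedSpace ℝ V] (h : HermitianJet V)

/-- The Kähler form `ω = g(J·, ·)`. -/
def kahler (X Y : V) : ℝ := h.g (h.J X) Y

/-- The derivative of the Kähler form. -/
def Dkahler (X Y Z : V) : ℝ := h.Dg X (h.J Y) Z + h.g (h.DJ X Y) Z

/-- The exterior derivative of the Kähler form. -/
def dkahler (X Y Z : V) : ℝ := h.Dkahler X Y Z + h.Dkahler Y Z X + h.Dkahler Z X Y
  - h.kahler (h.br X Y) Z - h.kahler (h.br Y Z) X - h.kahler (h.br Z X) Y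

/-- The Nijenhuis tensor. -/
def nijenhuis (X Y : V) : V := h.DJ (h.J X) Y - h.DJ (h.J Y) X + h.J (h.DJ Y X) - h.J (h.DJ X Y)
  + h.br (h.J X) (h.J Y) - h.J (h.br (h.J X) Y) - h.J (h.br X (h.J Y)) - h.br X Y

/-- `Γ` is the Christoffel tensor of the Levi-Civita connection. -/
structure IsLeviCivita (Γ : V →ₗ[ℝ] V →ₗ[ℝ] V) : Prop where
  metric : ∀ X Y Z, h.Dg X Y Z = h.g (Γ X Y) Z + h.g Y (Γ X Z)
  torsionFree : ∀ X Y, Γ X Y - Γ Y X = h.br X Y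

/-- The covariant derivative of `J` for the Christoffel tensor `Γ`. -/
def nablaJ (Γ : V →ₗ[ℝ] V →ₗ[ℝ] V) (X Y : V) : V := h.DJ X Y + Γ X (h.J Y) - h.J (Γ X Y)

theorem g_J_left (X Y : V) : h.g (h.J X) Y = -h.g X (h.J Y) := by
  rw [← h.g_J X (h.J Y), h.J_sq, map_neg, neg_neg]

theorem g_neg_left (X Y : V) : h.g (-X) Y = -h.g X Y := by simp

theorem Dkahler_skew (X Y Z : V) : h.Dkahler X Y Z = -h.Dkahler X Z Y := by
  have h1 := h.Dg_J X Y Z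
  simp only [Dkahler]
  rw [h.Dg_symm X (h.J Z) Y, h.g_symm (h.DJ X Z) Y]
  linear_combination h1

theorem dkahler_cyclic (X Y Z : V) : h.dkahler X Y Z = h.dkahler Y Z X := by
  simp only [dkahler]
  ring

theorem dkahler_skew (X Y Z : V) : h.dkahler X Y Z = -h.dkahler Y X Z := by
  have hn : ∀ X Y Z, h.kahler (h.br X Y) Z = -h.kahler (h.br Y X) Z := by
    intro X Y Z
    rw [h.br_skew X Y, kahler, kahler]
    simp
  simp only [dkahler]
  rw [h.Dkahler_skew X Y Z, h.Dkahler_skew Y Z X, h.Dkahler_skew Z X Y, hn X Y Z, hn Y Z X,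
      hn Z X Y]
  ring

/-- Positivity makes g injective as a map into the dual, and the dimensions agree. -/
theorem exists_sharp [FiniteDimensional ℝ V] : ∃ S : (V →L[ℝ] ℝ) →ₗ[ℝ] V, ∀ φ Z, h.g (S φ) Z =
    φ Z := by
  have hinj : Function.Injective (h.g : V →ₗ[ℝ] (V →L[ℝ] ℝ)) := by
    rw [← LinearMap.ker_eq_bot, LinearMap.ker_eq_bot']
    intro X hX
    by_contra hne
    have h1 := h.g_pos X hne
    have h2 : h.g X = 0 := hX
    rw [h2] at h1
    exact lt_irrefl _ h1
  have hdim : Module.finrank ℝ V = Module.finrank ℝ (V →L[ℝ] ℝ) := by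
    rw [← (LinearMap.toContinuousLinearMap : (V →ₗ[ℝ] ℝ) ≃ₗ[ℝ] (V →L[ℝ] ℝ)).finrank_eq]
    exact (Subspace.dual_finrank_eq (K := ℝ) (V := V)).symm
  let e := LinearEquiv.ofInjectiveOfFinrankEq _ hinj hdim
  refine ⟨e.symm, fun φ Z => ?_⟩
  have h1 : e (e.symm φ) = φ := e.apply_symm_apply φ
  exact congrArg (fun φ => φ Z) h1

/-- Koszul's formula. -/
theorem exists_isLeviCivita [FiniteDimensional ℝ V] : ∃ Γ, h.IsLeviCivita Γ := by
  obtain ⟨S, hS⟩ := h.exists_sharp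
  -- Koszul's right-hand side, with `Dg` for the derivatives of the metric on parallel fields and
  -- `br` for their Lie brackets.
  let K : V → V → V →L[ℝ] ℝ := fun X Y => (1 / 2 : ℝ) • (h.Dg X Y + h.Dg Y X
    - (h.Dg.flip X).flip Y + h.g (h.br X Y) - (h.g.flip Y).comp (h.br X)
    - (h.g.flip X).comp (h.br Y))
  have hK : ∀ X Y Z, K X Y Z = (1 / 2 : ℝ) * (h.Dg X Y Z + h.Dg Y X Z - h.Dg Z X Y
      + h.g (h.br X Y) Z - h.g (h.br X Z) Y - h.g (h.br Y Z) X) := fun X Y Z => by simp [K]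
  let Γ : V →ₗ[ℝ] V →ₗ[ℝ] V := LinearMap.mk₂ ℝ (fun X Y => S (K X Y))
    (fun X X' Y => by
      rw [← map_add]; congr 1; ext Z
      simp only [add_apply, hK, map_add]; ring)
    (fun c X Y => by
      rw [← map_smul]; congr 1; ext Z
      simp only [smul_apply, hK, map_smul, smul_eq_mul]; ring)
    (fun X Y Y' => by
      rw [← map_add]; congr 1; ext Z
      simp only [add_apply, hK, map_add]; ring)
    (fun c X Y => by
      rw [← map_smul]; congr 1; ext Z
      simp only [smul_apply, hK, map_smul, smul_eq_mul]; ring)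
  have hΓ : ∀ X Y Z, h.g (Γ X Y) Z = K X Y Z := fun X Y Z => hS _ _
  refine ⟨Γ, fun X Y Z => ?_, fun X Y => ?_⟩
  · rw [h.g_symm Y, hΓ, hΓ, hK, hK, h.br_skew Z Y, h.Dg_symm X Z Y, h.Dg_symm Z X Y,
      h.Dg_symm Y X Z]
    simp only [map_neg, neg_apply]
    ring
  · have key : ∀ Z, h.g (Γ X Y - Γ Y X - h.br X Y) Z = 0 := by
      intro Z
      rw [map_sub, map_sub, sub_apply, sub_apply, hΓ, hΓ, hK, hK, h.br_skew Y X, h.Dg_symm _ Y X]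
      simp only [map_neg, neg_apply]
      ring
    rw [← sub_eq_zero]
    by_contra hne
    exact (h.g_pos _ hne).ne' (key _)

variable {Γ : V →ₗ[ℝ] V →ₗ[ℝ] V}

theorem nablaJ_J (X Y : V) : h.nablaJ Γ X (h.J Y) = -h.J (h.nablaJ Γ X Y) := by
  simp only [nablaJ, h.DJ_J, h.J_sq, map_add, map_sub, map_neg]
  abel

/-- The derivative of the identity g(JY, Z) + g(Y, JZ) = 0, recorded in `Dg_J`, becomes this once
the derivatives of g are expressed by Γ. -/
theorem g_nablaJ_skew (hΓ : h.IsLeviCivita Γ) (X Y Z : V) :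
    h.g (h.nablaJ Γ X Y) Z = -h.g (h.nablaJ Γ X Z) Y := by
  have h1 := h.Dg_J X Y Z
  rw [hΓ.metric, hΓ.metric] at h1
  simp only [nablaJ, map_add, map_sub, add_apply, sub_apply]
  rw [h.g_J_left, h.g_J_left (Γ X Z), h.g_symm (h.DJ X Z), h.g_symm (Γ X (h.J Z)),
    h.g_symm (Γ X Z)]
  linear_combination h1

/-- The derivative of ω along X differs from g((∇_X J)Y, Z) by two connection terms. In the cyclic
sum these combine into Γ X Y - Γ Y X and cancel the bracket terms by torsion-freeness. -/
theorem dkahler_eq_cyclic_nablaJ (hΓ : h.IsLeviCivita Γ) (X Y Z : V) :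
    h.dkahler X Y Z = h.g (h.nablaJ Γ X Y) Z + h.g (h.nablaJ Γ Y Z) X + h.g (h.nablaJ Γ Z X) Y := by
  have hD : ∀ X Y Z, h.Dkahler X Y Z
      = h.g (h.nablaJ Γ X Y) Z + h.kahler (Γ X Y) Z - h.kahler (Γ X Z) Y := by
    intro X Y Z
    simp only [Dkahler, nablaJ, hΓ.metric, kahler, map_add, map_sub, add_apply,
      sub_apply]
    rw [h.g_J_left (Γ X Z), h.g_symm (h.J Y)]
    ring
  simp only [dkahler, hD, ← hΓ.torsionFree, kahler, map_sub, sub_apply]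
  ring

theorem nijenhuis_eq_nablaJ (hΓ : h.IsLeviCivita Γ) (X Y : V) :
    h.nijenhuis X Y = h.nablaJ Γ (h.J X) Y - h.nablaJ Γ (h.J Y) X + h.J (h.nablaJ Γ Y X)
      - h.J (h.nablaJ Γ X Y) := by
  simp only [nijenhuis, nablaJ, ← hΓ.torsionFree, map_add, map_sub, h.J_sq]
  abel

/-- The covariant derivative of the Kähler form in terms of its exterior derivative and the
Nijenhuis tensor. -/
theorem two_mul_g_nablaJ (hΓ : h.IsLeviCivita Γ) (X Y Z : V) :
    2 * h.g (h.nablaJ Γ X Y) Z = h.dkahler X Y Z - h.dkahler X (h.J Y) (h.J Z)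
      + h.g (h.nijenhuis Y Z) (h.J X) := by
  have hJ : ∀ X Y Z, h.g (h.nablaJ Γ X (h.J Y)) Z = h.g (h.nablaJ Γ X Y) (h.J Z) := by
    intro X Y Z
    rw [nablaJ_J, g_neg_left, g_J_left, neg_neg]
  -- Everything is expanded in ∇J. Skewness of each ∇_X J and its anticommutation with J cancel all
  -- terms but the two copies of g((∇_X J)Y, Z).
  rw [h.dkahler_eq_cyclic_nablaJ hΓ, h.dkahler_eq_cyclic_nablaJ hΓ, h.nijenhuis_eq_nablaJ hΓ]
  simp only [map_add, map_sub, add_apply, sub_apply,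
    h.g_J, hJ, h.J_sq, map_neg]
  rw [h.g_nablaJ_skew hΓ (h.J Z) X (h.J Y), h.g_nablaJ_skew hΓ Z X Y, hJ (h.J Z)]
  ring

/-- If `dω` is of type `(3,0) + (0,3)` and determines the Nijenhuis tensor as below, then the
structure is nearly Kähler. -/
theorem g_nablaJ_eq (hΓ : h.IsLeviCivita Γ)
    (htype : ∀ X Y Z, h.dkahler X (h.J Y) (h.J Z) = -h.dkahler X Y Z)
    (hnij : ∀ X Y Z, h.kahler (h.nijenhuis Y Z) X = 4 / 3 * h.dkahler X Y Z) (X Y Z : V) :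
    h.g (h.nablaJ Γ X Y) Z = 1 / 3 * h.dkahler X Y Z := by
  have h1 := h.two_mul_g_nablaJ hΓ X Y Z
  have h2 := hnij X Y Z
  rw [kahler, g_J_left] at h2
  rw [htype] at h1
  linarith

/-- The squared length of (∇_X J)X is a third of dω(X, X, (∇_X J)X), which vanishes by skewness. -/
theorem nablaJ_self (hΓ : h.IsLeviCivita Γ)
    (htype : ∀ X Y Z, h.dkahler X (h.J Y) (h.J Z) = -h.dkahler X Y Z)
    (hnij : ∀ X Y Z, h.kahler (h.nijenhuis Y Z) X = 4 / 3 * h.dkahler X Y Z) (X : V) :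
    h.nablaJ Γ X X = 0 := by
  by_contra hne
  have h1 := h.g_pos _ hne
  have h2 := h.dkahler_skew X X (h.nablaJ Γ X X)
  rw [h.g_nablaJ_eq hΓ htype hnij] at h1
  linarith

theorem J_nijenhuis (X Y : V) : h.nijenhuis (h.J X) Y = -h.J (h.nijenhuis X Y) := by
  simp only [nijenhuis, h.J_sq, h.DJ_J, map_add, map_sub, map_neg, neg_apply]
  abel

theorem nijenhuis_skew (X Y : V) : h.nijenhuis X Y = -h.nijenhuis Y X := by
  simp only [nijenhuis]
  rw [h.br_skew (h.J X) (h.J Y), h.br_skew (h.J X) Y, h.br_skew X (h.J Y), h.br_skew X Y]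
  simp only [map_neg]
  abel

/-- The relation between the Nijenhuis tensor and `dω` need only be checked on vectors spanning
the tangent space over the complex numbers. -/
theorem nijenhuis_relation_of_span {W : Submodule ℝ V} (hW : ∀ X, ∃ Y ∈ W, ∃ Z ∈ W, X = Y + h.J Z)
    (htype : ∀ X Y Z, h.dkahler X (h.J Y) (h.J Z) = -h.dkahler X Y Z)
    (hnij : ∀ X, ∀ Y ∈ W, ∀ Z ∈ W, h.kahler (h.nijenhuis Y Z) X = 4 / 3 * h.dkahler X Y Z)
        (X Y Z : V) :
    h.kahler (h.nijenhuis Y Z) X = 4 / 3 * h.dkahler X Y Z := by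
  have hωJ : ∀ X Y, h.kahler (h.J X) Y = -h.kahler X (h.J Y) := by
    intro X Y
    simp only [kahler]
    rw [g_J_left]
  -- The type condition says that J may be moved between the arguments of dω. Since N is antilinear
  -- in its arguments, both sides of the relation transform alike when Y is replaced by JY.
  have hdJ : ∀ X Y Z, h.dkahler X (h.J Y) Z = h.dkahler (h.J X) Y Z := by
    intro X Y Z
    have neg_mid : ∀ X Y Z, h.dkahler X (-Y) Z = -h.dkahler X Y Z := by
      intro X Y Z
      simp only [dkahler, Dkahler, kahler, map_neg, neg_apply]
      ring
    have h1 := htype Z (h.J X) Y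
    have h2 : h.dkahler Z (h.J (h.J X)) (h.J Y) = -h.dkahler Z X (h.J Y) := by rw [h.J_sq, neg_mid]
    rw [← h.dkahler_cyclic Z X (h.J Y), ← h.dkahler_cyclic Z (h.J X) Y]
    linarith
  have left : ∀ Y Z, (∀ X, h.kahler (h.nijenhuis Y Z) X = 4 / 3 * h.dkahler X Y Z) →
      ∀ X, h.kahler (h.nijenhuis (h.J Y) Z) X = 4 / 3 * h.dkahler X (h.J Y) Z := by
    intro Y Z hYZ X
    rw [J_nijenhuis, hdJ, ← hYZ, kahler, map_neg, g_neg_left, ← kahler, hωJ, neg_neg]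
  have swap : ∀ Y Z, (∀ X, h.kahler (h.nijenhuis Y Z) X = 4 / 3 * h.dkahler X Y Z) →
      ∀ X, h.kahler (h.nijenhuis Z Y) X = 4 / 3 * h.dkahler X Z Y := by
    intro Y Z hYZ X
    rw [nijenhuis_skew, kahler, map_neg, g_neg_left, ← kahler, hYZ, h.dkahler_cyclic X Y Z,
        h.dkahler_cyclic X Z Y,
      h.dkahler_skew Y Z X]
    ring
  have add : ∀ Y Y' Z, (∀ X, h.kahler (h.nijenhuis Y Z) X = 4 / 3 * h.dkahler X Y Z) →
      (∀ X, h.kahler (h.nijenhuis Y' Z) X = 4 / 3 * h.dkahler X Y' Z) →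
      ∀ X, h.kahler (h.nijenhuis (Y + Y') Z) X = 4 / 3 * h.dkahler X (Y + Y') Z := by
    intro Y Y' Z h1 h2 X
    have e1 : h.kahler (h.nijenhuis (Y + Y') Z) X
        = h.kahler (h.nijenhuis Y Z) X + h.kahler (h.nijenhuis Y' Z) X := by
      simp only [nijenhuis, kahler, map_add, map_sub, add_apply,
        sub_apply]
      ring
    have e2 : h.dkahler X (Y + Y') Z = h.dkahler X Y Z + h.dkahler X Y' Z := by
      simp only [dkahler, Dkahler, kahler, map_add, add_apply]
      ring
    rw [e1, e2, h1, h2]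
    ring
  obtain ⟨Y₀, hY₀, Y₁, hY₁, rfl⟩ := hW Y
  obtain ⟨Z₀, hZ₀, Z₁, hZ₁, rfl⟩ := hW Z
  have base : ∀ Y ∈ W, ∀ X, h.kahler (h.nijenhuis Y (Z₀ + h.J Z₁)) X
      = 4 / 3 * h.dkahler X Y (Z₀ + h.J Z₁) := by
    intro Y hY
    exact swap _ _ (add _ _ _ (swap _ _ fun X => hnij X Y hY Z₀ hZ₀)
      (left _ _ (swap _ _ fun X => hnij X Y hY Z₁ hZ₁)))
  exact add _ _ _ (base Y₀ hY₀) (left _ _ (base Y₁ hY₁)) X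

end HermitianJet

/-! ### Inner product and cross product on imaginary quaternions -/

open scoped RealInnerProductSpace

/-- The space of imaginary quaternions, with its structure of a Euclidean vector space. -/
def Im : Type := su2

instance : NormedAddCommGroup Im := inferInstanceAs (NormedAddCommGroup su2)

instance : InnerProductSpace ℝ Im := inferInstanceAs (InnerProductSpace ℝ su2)

/-- The inclusion of the imaginary quaternions. -/
@[coe]
def Im.val (x : Im) : ℍ[ℝ] := Subtype.val (p := (· ∈ su2)) x

instance : CoeOut Im ℍ[ℝ] := ⟨Im.val⟩

namespace Im

theorem coe_injective : Function.Injective Im.val := Subtype.val_injective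
@[simp] theorem coe_add (x y : Im) : ((x + y : Im) : ℍ[ℝ]) = x + y := rfl
@[simp] theorem coe_sub (x y : Im) : ((x - y : Im) : ℍ[ℝ]) = x - y := rfl
@[simp] theorem coe_neg (x : Im) : ((-x : Im) : ℍ[ℝ]) = -x := rfl
@[simp] theorem coe_zero : ((0 : Im) : ℍ[ℝ]) = 0 := rfl
@[simp] theorem coe_smul (r : ℝ) (x : Im) : ((r • x : Im) : ℍ[ℝ]) = r • (x : ℍ[ℝ]) := rfl
theorem coe_norm (x : Im) : ‖x‖ = ‖(x : ℍ[ℝ])‖ := rfl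
theorem coe_inner (x y : Im) : ⟪x, y⟫ = ⟪(x : ℍ[ℝ]), (y : ℍ[ℝ])⟫ := rfl

end Im

/-- The identity of the space of imaginary quaternions. -/
def toIm : su2 ≃L[ℝ] Im where
  toFun x := (x : su2)
  invFun x := (x : Im)
  map_add' _ _ := rfl
  map_smul' _ _ := rfl
  left_inv _ := rfl
  right_inv _ := rfl
  continuous_toFun := (continuous_id : Continuous (id : su2 → su2))
  continuous_invFun := (continuous_id : Continuous (id : su2 → su2))

@[simp]
theorem coe_toIm (x : su2) : (toIm x : ℍ[ℝ]) = x := rfl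

@[simp]
theorem coe_toIm_symm (x : Im) : ((toIm.symm x : su2) : ℍ[ℝ]) = x := rfl

theorem Im.ext {x y : Im} (hI : (x : ℍ[ℝ]).imI = (y : ℍ[ℝ]).imI)
    (hJ : (x : ℍ[ℝ]).imJ = (y : ℍ[ℝ]).imJ) (hK : (x : ℍ[ℝ]).imK = (y : ℍ[ℝ]).imK) : x = y :=
  Subtype.ext (Quaternion.ext _ _ (x.2.trans y.2.symm) hI hJ hK)

theorem Im.re (x : Im) : (x : ℍ[ℝ]).re = 0 := x.2

instance : FiniteDimensional ℝ Im :=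
  FiniteDimensional.of_injective (V := su2) su2Coord.toLinearMap su2Coord.injective

theorem Im.finrank : Module.finrank ℝ Im = 3 := by
  exact su2Coord.finrank_eq.trans (by simp)

theorem Im.inner_eq (x y : Im) : ⟪x, y⟫ = (x : ℍ[ℝ]).imI * (y : ℍ[ℝ]).imI
    + (x : ℍ[ℝ]).imJ * (y : ℍ[ℝ]).imJ + (x : ℍ[ℝ]).imK * (y : ℍ[ℝ]).imK := by
  rw [Im.coe_inner, Quaternion.inner_def, Quaternion.re_mul]
  simp [Im.re]

/-- The cross product of imaginary quaternions. -/
def crossFun (x y : Im) : Im :=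
  ⟨⟨0, (x : ℍ[ℝ]).imJ * (y : ℍ[ℝ]).imK - (x : ℍ[ℝ]).imK * (y : ℍ[ℝ]).imJ,
    (x : ℍ[ℝ]).imK * (y : ℍ[ℝ]).imI - (x : ℍ[ℝ]).imI * (y : ℍ[ℝ]).imK,
    (x : ℍ[ℝ]).imI * (y : ℍ[ℝ]).imJ - (x : ℍ[ℝ]).imJ * (y : ℍ[ℝ]).imI⟩, rfl⟩

theorem crossFun_imI (x y : Im) : (crossFun x y : ℍ[ℝ]).imI
    = (x : ℍ[ℝ]).imJ * (y : ℍ[ℝ]).imK - (x : ℍ[ℝ]).imK * (y : ℍ[ℝ]).imJ := rfl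

theorem crossFun_imJ (x y : Im) : (crossFun x y : ℍ[ℝ]).imJ
    = (x : ℍ[ℝ]).imK * (y : ℍ[ℝ]).imI - (x : ℍ[ℝ]).imI * (y : ℍ[ℝ]).imK := rfl

theorem crossFun_imK (x y : Im) : (crossFun x y : ℍ[ℝ]).imK
    = (x : ℍ[ℝ]).imI * (y : ℍ[ℝ]).imJ - (x : ℍ[ℝ]).imJ * (y : ℍ[ℝ]).imI := rfl

/-- A bilinear map between finite-dimensional spaces as a continuous bilinear map. -/
def continuousBilin {E F G : Type*} [NormedAddCommGroup E] [NormedSpace ℝ E]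
    [FiniteDimensional ℝ E] [NormedAddCommGroup F] [NormedSpace ℝ F] [FiniteDimensional ℝ F]
    [NormedAddCommGroup G] [NormedSpace ℝ G] (B : E →ₗ[ℝ] F →ₗ[ℝ] G) : E →L[ℝ] F →L[ℝ] G :=
  LinearMap.toContinuousLinearMap
    ((LinearMap.toContinuousLinearMap : (F →ₗ[ℝ] G) ≃ₗ[ℝ] (F →L[ℝ] G)).toLinearMap ∘ₗ B)

@[simp]
theorem continuousBilin_apply {E F G : Type*} [NormedAddCommGroup E] [NormedSpace ℝ E]
    [FiniteDimensional ℝ E] [NormedAddCommGroup F] [NormedSpace ℝ F] [FiniteDimensional ℝ F]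
    [NormedAddCommGroup G] [NormedSpace ℝ G] (B : E →ₗ[ℝ] F →ₗ[ℝ] G) (x : E) (y : F) :
    continuousBilin B x y = B x y := rfl

/-- The cross product of imaginary quaternions, as a continuous bilinear map. -/
def cross : Im →L[ℝ] Im →L[ℝ] Im := continuousBilin <| LinearMap.mk₂ ℝ crossFun
  (fun x x' y => by apply Im.ext <;> simp [crossFun_imI, crossFun_imJ, crossFun_imK] <;> ring)
  (fun c x y => by apply Im.ext <;> simp [crossFun_imI, crossFun_imJ, crossFun_imK] <;> ring)
  (fun x y y' => by apply Im.ext <;> simp [crossFun_imI, crossFun_imJ, crossFun_imK] <;> ring)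
  (fun c x y => by apply Im.ext <;> simp [crossFun_imI, crossFun_imJ, crossFun_imK] <;> ring)

theorem cross_imI (x y : Im) : (cross x y : ℍ[ℝ]).imI
    = (x : ℍ[ℝ]).imJ * (y : ℍ[ℝ]).imK - (x : ℍ[ℝ]).imK * (y : ℍ[ℝ]).imJ := rfl

theorem cross_imJ (x y : Im) : (cross x y : ℍ[ℝ]).imJ
    = (x : ℍ[ℝ]).imK * (y : ℍ[ℝ]).imI - (x : ℍ[ℝ]).imI * (y : ℍ[ℝ]).imK := rfl

theorem cross_imK (x y : Im) : (cross x y : ℍ[ℝ]).imK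
    = (x : ℍ[ℝ]).imI * (y : ℍ[ℝ]).imJ - (x : ℍ[ℝ]).imJ * (y : ℍ[ℝ]).imI := rfl

theorem coe_two_smul_cross (x y : Im) : ((2 : ℝ) • (cross x y) : Im)
    = (x : ℍ[ℝ]) * y - (y : ℍ[ℝ]) * x := by
  apply Quaternion.ext <;> simp [Im.re, cross_imI, cross_imJ, cross_imK] <;> ring

/-! ### The adjoint action -/

theorem coe_mul_inv_self (b : SU2) : (b : ℍ[ℝ]) * ((b⁻¹ : SU2) : ℍ[ℝ]) = 1 := by
  rw [← Metric.unitSphere.coe_mul, mul_inv_cancel, Metric.unitSphere.coe_one]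

theorem coe_inv_mul_self (b : SU2) : ((b⁻¹ : SU2) : ℍ[ℝ]) * (b : ℍ[ℝ]) = 1 := by
  rw [← Metric.unitSphere.coe_mul, inv_mul_cancel, Metric.unitSphere.coe_one]

/-- The adjoint action as a continuous linear map. -/
def AdL (b : SU2) : Im →L[ℝ] Im := LinearMap.toContinuousLinearMap
  { toFun := fun x => toIm (Ad b (toIm.symm x))
    map_add' := fun x y => by
      apply Im.coe_injective
      simp [Ad, mul_add, add_mul]
    map_smul' := fun c x => by
      apply Im.coe_injective
      simp [Ad] }

theorem AdL_toIm (b : SU2) (x : su2) : AdL b (toIm x) = toIm (Ad b x) := rfl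

theorem coe_AdL (b : SU2) (x : Im) :
    (AdL b x : ℍ[ℝ]) = (b : ℍ[ℝ]) * (x : ℍ[ℝ]) * ((b⁻¹ : SU2) : ℍ[ℝ]) := rfl

theorem AdL_mul (b c : SU2) (x : Im) : AdL (b * c) x = AdL b (AdL c x) := by
  apply Im.coe_injective
  simp [coe_AdL, mul_assoc]

theorem AdL_one (x : Im) : AdL 1 x = x := by
  apply Im.coe_injective
  simp [coe_AdL]

theorem AdL_AdL_inv (b : SU2) (x : Im) : AdL b (AdL b⁻¹ x) = x := by
  rw [← AdL_mul, mul_inv_cancel, AdL_one]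

/-- Twice the cross product is the commutator, which conjugation preserves. -/
theorem AdL_cross (b : SU2) (x y : Im) : cross (AdL b x) (AdL b y) = AdL b (cross x y) := by
  have h : (2 : ℝ) • cross (AdL b x) (AdL b y) = (2 : ℝ) • AdL b (cross x y) := by
    rw [show (2 : ℝ) • AdL b (cross x y) = AdL b ((2 : ℝ) • cross x y) from
      (map_smul _ _ _).symm]
    apply Im.coe_injective
    rw [coe_two_smul_cross, coe_AdL b (_ • _), coe_two_smul_cross, coe_AdL, coe_AdL]
    have h := coe_inv_mul_self b
    have h1 : ∀ u v : ℍ[ℝ], (b : ℍ[ℝ]) * u * ((b⁻¹ : SU2) : ℍ[ℝ])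
        * ((b : ℍ[ℝ]) * v * ((b⁻¹ : SU2) : ℍ[ℝ])) = b * (u * v) * ((b⁻¹ : SU2) : ℍ[ℝ]) := by
      intro u v
      calc _ = (b : ℍ[ℝ]) * u * (((b⁻¹ : SU2) : ℍ[ℝ]) * b) * v * ((b⁻¹ : SU2) : ℍ[ℝ]) := by
            noncomm_ring
        _ = _ := by rw [h]; noncomm_ring
    rw [h1, h1]
    noncomm_ring
  exact smul_right_injective _ two_ne_zero h

theorem norm_AdL (b : SU2) (x : Im) : ‖AdL b x‖ = ‖x‖ := by
  have h1 : ∀ c : SU2, ‖(c : ℍ[ℝ])‖ = 1 := fun c => by simp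
  rw [Im.coe_norm, coe_AdL, norm_mul, norm_mul, h1, h1, one_mul, mul_one,
    Im.coe_norm]

theorem AdL_inner (b : SU2) (x y : Im) : ⟪AdL b x, AdL b y⟫ = ⟪x, y⟫ := by
  have h1 := norm_add_sq_real (AdL b x) (AdL b y)
  rw [← map_add, norm_AdL, norm_AdL, norm_AdL, norm_add_sq_real x y] at h1
  linarith

/-- The imaginary unit `i`. -/
def unitI : Im := ⟨⟨0, 1, 0, 0⟩, rfl⟩

@[simp] theorem unitI_imI : (unitI : ℍ[ℝ]).imI = 1 := rfl
@[simp] theorem unitI_imJ : (unitI : ℍ[ℝ]).imJ = 0 := rfl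
@[simp] theorem unitI_imK : (unitI : ℍ[ℝ]).imK = 0 := rfl

theorem norm_unitI : ‖unitI‖ = 1 := by
  have h : ‖unitI‖ ^ 2 = 1 := by
    rw [← real_inner_self_eq_norm_sq, Im.inner_eq]
    simp
  nlinarith [norm_nonneg unitI]

theorem toIm_vecH : toIm vecH = (1 / 2 : ℝ) • unitI := by
  apply Im.ext <;> simp <;> simp [vecH, su2Coord]

/-- It is enough to find a nonzero v with v i = u v and to normalize it. Since u² = i² = -1, the
choice v = u + i works: both sides equal u i - 1. In the exceptional case u = -i one takes v = j. -/
theorem exists_conj_unitI {u : Im} (hu : ‖u‖ = 1) : ∃ b : SU2, AdL b unitI = u := by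
  have husq : (u : ℍ[ℝ]) * u = -1 := by
    have h1 : (u : ℍ[ℝ]).imI ^ 2 + (u : ℍ[ℝ]).imJ ^ 2 + (u : ℍ[ℝ]).imK ^ 2 = 1 := by
      have := real_inner_self_eq_norm_sq u
      rw [Im.inner_eq, hu] at this
      linarith
    apply Quaternion.ext <;> simp [Im.re] <;> linarith
  have hisq : (unitI : ℍ[ℝ]) * unitI = -1 := by
    apply Quaternion.ext <;> simp [Im.re]
  have key : ∀ (v : ℍ[ℝ]) (hv : v ≠ 0), v * unitI = u * v → ∃ b : SU2, AdL b unitI = u := by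
    intro v hv h
    have hn : ‖v‖ ≠ 0 := norm_ne_zero_iff.2 hv
    let b : SU2 := ⟨(‖v‖⁻¹ : ℝ) • v, by
      rw [mem_sphere_zero_iff_norm, norm_smul, norm_inv, norm_norm, inv_mul_cancel₀ hn]⟩
    refine ⟨b, Im.coe_injective ?_⟩
    have hb : (b : ℍ[ℝ]) * unitI = u * b := by
      change ((‖v‖⁻¹ : ℝ) • v) * (unitI : ℍ[ℝ]) = u * ((‖v‖⁻¹ : ℝ) • v)
      rw [smul_mul_assoc, mul_smul_comm, h]
    rw [coe_AdL, hb, mul_assoc, coe_mul_inv_self, mul_one]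
  by_cases h : (u : ℍ[ℝ]) + unitI = 0
  · obtain ⟨v, hv0, hv1, hv2, hv3⟩ : ∃ v : ℍ[ℝ], v.re = 0 ∧ v.imI = 0 ∧ v.imJ = 1 ∧ v.imK = 0 :=
      ⟨⟨0, 0, 1, 0⟩, rfl, rfl, rfl, rfl⟩
    refine key v (fun h0 => ?_) ?_
    · simp [h0] at hv2
    · rw [eq_neg_of_add_eq_zero_left h]
      apply Quaternion.ext <;> simp [Im.re, hv0, hv1, hv2, hv3]
  · refine key _ h ?_
    rw [add_mul, mul_add, hisq, husq, add_comm]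

theorem exists_AdL_smul_unitI (w : Im) : ∃ b : SU2, AdL b (‖w‖ • unitI) = w := by
  rcases eq_or_ne w 0 with rfl | hw
  · exact ⟨1, by simp⟩
  · have hn : ‖w‖ ≠ 0 := norm_ne_zero_iff.2 hw
    obtain ⟨b, hb⟩ := exists_conj_unitI (u := ‖w‖⁻¹ • w)
      (by rw [norm_smul, norm_inv, norm_norm, inv_mul_cancel₀ hn])
    exact ⟨b, by rw [map_smul, hb, smul_smul, mul_inv_cancel₀ hn, one_smul]⟩

open scoped RealInnerProductSpace

/-! ### Almost Hermitian structures on `su(2) + su(2)` depending equivariantly on a point -/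

/-- The bracket of `su(2) ⋉ ℝ³`-valued vector fields in the left parallelism. -/
def brL : Im × Im →L[ℝ] Im × Im →L[ℝ] Im × Im :=
  continuousBilin <| LinearMap.mk₂ ℝ (fun u v => ((2 : ℝ) • cross u.1 v.1, 0))
    (fun u u' v => by simp) (fun r u v => by simp [smul_comm r])
    (fun u v v' => by simp) (fun r u v => by simp [smul_comm r])

theorem brL_apply (u v : Im × Im) : brL u v = ((2 : ℝ) • cross u.1 v.1, 0) := rfl

/-- The diagonal adjoint action on `su(2) + su(2)`. -/
def AdL₂ (b : SU2) : Im × Im →L[ℝ] Im × Im := (AdL b).prodMap (AdL b)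

theorem AdL₂_apply (b : SU2) (u : Im × Im) : AdL₂ b u = (AdL b u.1, AdL b u.2) := rfl

theorem AdL₂_AdL₂_inv (b : SU2) (u : Im × Im) : AdL₂ b (AdL₂ b⁻¹ u) = u := by
  simp [AdL₂_apply, AdL_AdL_inv]

theorem brL_AdL₂ (b : SU2) (u v : Im × Im) : brL (AdL₂ b u) (AdL₂ b v) = AdL₂ b (brL u v) := by
  simp [brL_apply, AdL₂_apply, AdL_cross]

theorem cross_skew (x y : Im) : cross x y = -cross y x := by
  apply Im.ext <;> simp [cross_imI, cross_imJ, cross_imK] <;> ring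

theorem brL_skew (u v : Im × Im) : brL u v = -brL v u := by
  rw [brL_apply, brL_apply, cross_skew u.1]
  simp

namespace Coefficients

variable (c : Coefficients)

/-- The 2-form with coefficients `c`. -/
def form (w : Im) : Im × Im →L[ℝ] Im × Im →L[ℝ] ℝ := continuousBilin <|
  LinearMap.mk₂ ℝ (fun u v => c.α ‖w‖ * (⟪u.1, v.2⟫ - ⟪v.1, u.2⟫)
      + c.β ‖w‖ * (⟪w, u.1⟫ * ⟪w, v.2⟫ - ⟪w, v.1⟫ * ⟪w, u.2⟫)
      + c.δ ‖w‖ * ⟪w, cross u.1 v.1⟫ + c.κ ‖w‖ * ⟪w, cross u.2 v.2⟫)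
    (fun u u' v => by simp [inner_add_left, inner_add_right]; ring)
    (fun r u v => by simp [inner_smul_left, inner_smul_right]; ring)
    (fun u v v' => by simp [inner_add_left, inner_add_right]; ring)
    (fun r u v => by simp [inner_smul_left, inner_smul_right]; ring)

theorem form_apply (w : Im) (u v : Im × Im) : c.form w u v =
    c.α ‖w‖ * (⟪u.1, v.2⟫ - ⟪v.1, u.2⟫)
      + c.β ‖w‖ * (⟪w, u.1⟫ * ⟪w, v.2⟫ - ⟪w, v.1⟫ * ⟪w, u.2⟫)
      + c.δ ‖w‖ * ⟪w, cross u.1 v.1⟫ + c.κ ‖w‖ * ⟪w, cross u.2 v.2⟫ := rfl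

/-- The endomorphism with coefficients `c`. -/
def cplx (w : Im) : Im × Im →L[ℝ] Im × Im := LinearMap.toContinuousLinearMap
  { toFun := fun u =>
      (c.j₁ ‖w‖ • u.2 + (c.j₂ ‖w‖ * ⟪w, u.2⟫) • w + c.j₃ ‖w‖ • cross w u.1,
        c.k₁ ‖w‖ • u.1 + (c.k₂ ‖w‖ * ⟪w, u.1⟫) • w - c.j₃ ‖w‖ • cross w u.2)
    map_add' := fun u v => by
      ext1
      · simp only [Prod.fst_add, Prod.snd_add, smul_add, inner_add_right, mul_add, add_smul,
          map_add]
        abel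
      · simp only [Prod.fst_add, Prod.snd_add, smul_add, inner_add_right, mul_add, add_smul,
          map_add]
        abel
    map_smul' := fun r u => by
      ext1
      · simp only [Prod.smul_fst, Prod.smul_snd, inner_smul_right, map_smul, RingHom.id_apply]
        module
      · simp only [Prod.smul_fst, Prod.smul_snd, inner_smul_right, map_smul, RingHom.id_apply]
        module }

theorem cplx_apply (w : Im) (u : Im × Im) : c.cplx w u =
    (c.j₁ ‖w‖ • u.2 + (c.j₂ ‖w‖ * ⟪w, u.2⟫) • w + c.j₃ ‖w‖ • cross w u.1,
      c.k₁ ‖w‖ • u.1 + (c.k₂ ‖w‖ * ⟪w, u.1⟫) • w - c.j₃ ‖w‖ • cross w u.2) := rfl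

/-- The bilinear form `g(u, v) = ω(u, Jv)`. -/
def metric (w : Im) : Im × Im →L[ℝ] Im × Im →L[ℝ] ℝ :=
  ((c.form w).flip.comp (c.cplx w)).flip

theorem metric_apply (w : Im) (u v : Im × Im) :
    c.metric w u v = c.form w u (c.cplx w v) := rfl

/-! #### Equivariance -/

theorem form_AdL (b : SU2) (w : Im) (u v : Im × Im) :
    c.form (AdL b w) (AdL₂ b u) (AdL₂ b v) = c.form w u v := by
  simp only [form_apply, AdL₂_apply, norm_AdL, AdL_cross, AdL_inner]

theorem cplx_AdL (b : SU2) (w : Im) (u : Im × Im) :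
    c.cplx (AdL b w) (AdL₂ b u) = AdL₂ b (c.cplx w u) := by
  simp only [cplx_apply, AdL₂_apply, norm_AdL, AdL_cross, AdL_inner, map_add, map_sub, map_smul]

theorem metric_AdL (b : SU2) (w : Im) (u v : Im × Im) :
    c.metric (AdL b w) (AdL₂ b u) (AdL₂ b v) = c.metric w u v := by
  rw [metric_apply, cplx_AdL, form_AdL, metric_apply]

/-! #### Smoothness -/

theorem contDiff_form : ContDiff ℝ ∞ c.form := by
  obtain ⟨hα, hβ, hδ, hκ, -⟩ := c.smooth
  obtain ⟨eα, eβ, eδ, eκ, -⟩ := c.even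
  have hin : ∀ x : Im, ContDiff ℝ ∞ fun w : Im => ⟪w, x⟫ := fun x =>
      contDiff_id.inner ℝ contDiff_const
  have h1 := eα.contDiff_radial (E := Im) hα
  have h2 := eβ.contDiff_radial (E := Im) hβ
  have h3 := eδ.contDiff_radial (E := Im) hδ
  have h4 := eκ.contDiff_radial (E := Im) hκ
  refine contDiff_clm_apply_iff.2 fun u => contDiff_clm_apply_iff.2 fun v => ?_
  simp only [form_apply]
  exact (((h1.mul contDiff_const).add
      (h2.mul (((hin _).mul (hin _)).sub ((hin _).mul (hin _))))).add
    (h3.mul (hin _))).add (h4.mul (hin _))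

theorem contDiff_cplx : ContDiff ℝ ∞ c.cplx := by
  obtain ⟨-, -, -, -, s1, s2, s3, s4, s5⟩ := c.smooth
  obtain ⟨-, -, -, -, e1, e2, e3, e4, e5⟩ := c.even
  have h1 := e1.contDiff_radial (E := Im) s1
  have h2 := e2.contDiff_radial (E := Im) s2
  have h3 := e3.contDiff_radial (E := Im) s3
  have h4 := e4.contDiff_radial (E := Im) s4
  have h5 := e5.contDiff_radial (E := Im) s5
  refine contDiff_clm_apply_iff.2 fun u => ?_
  simp only [cplx_apply]
  have hin : ∀ x : Im, ContDiff ℝ ∞ fun w : Im => ⟪w, x⟫ := fun x =>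
      contDiff_id.inner ℝ contDiff_const
  have i1 := hin u.1
  have i2 := hin u.2
  have hc : ∀ x : Im, ContDiff ℝ ∞ fun w : Im => cross w x := fun x => (cross.flip x).contDiff
  have hc1 := hc u.1
  have hc2 := hc u.2
  fun_prop

theorem contDiff_metric : ContDiff ℝ ∞ c.metric := by
  refine contDiff_clm_apply_iff.2 fun u => contDiff_clm_apply_iff.2 fun v => ?_
  simp only [metric_apply]
  exact (c.contDiff_form.clm_apply contDiff_const).clm_apply
      (c.contDiff_cplx.clm_apply contDiff_const)

/-! #### Coordinates at a point of the radius through `i` -/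

theorem norm_smul_unitI {s : ℝ} (hs : 0 ≤ s) : ‖s • unitI‖ = s := by
  rw [norm_smul, norm_unitI, mul_one, Real.norm_of_nonneg hs]

variable {c} {s : ℝ}

theorem form_radial (hs : 0 ≤ s) (u v : Im × Im) : c.form (s • unitI) u v =
    (c.α s + c.β s * s ^ 2) * ((u.1 : ℍ[ℝ]).imI * (v.2 : ℍ[ℝ]).imI
      - (v.1 : ℍ[ℝ]).imI * (u.2 : ℍ[ℝ]).imI)
    + c.α s * ((u.1 : ℍ[ℝ]).imJ * (v.2 : ℍ[ℝ]).imJ - (v.1 : ℍ[ℝ]).imJ * (u.2 : ℍ[ℝ]).imJ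
      + (u.1 : ℍ[ℝ]).imK * (v.2 : ℍ[ℝ]).imK - (v.1 : ℍ[ℝ]).imK * (u.2 : ℍ[ℝ]).imK)
    + s * c.δ s * ((u.1 : ℍ[ℝ]).imJ * (v.1 : ℍ[ℝ]).imK - (u.1 : ℍ[ℝ]).imK * (v.1 : ℍ[ℝ]).imJ)
    + s * c.κ s * ((u.2 : ℍ[ℝ]).imJ * (v.2 : ℍ[ℝ]).imK
      - (u.2 : ℍ[ℝ]).imK * (v.2 : ℍ[ℝ]).imJ) := by
  rw [form_apply, norm_smul_unitI hs]
  simp only [Im.inner_eq, cross_imI, cross_imJ, cross_imK, Im.coe_smul, Quaternion.imI_smul,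
    Quaternion.imJ_smul, Quaternion.imK_smul, unitI_imI, unitI_imJ, unitI_imK, smul_eq_mul]
  ring

theorem cplx_radial (hs : 0 ≤ s) (u : Im × Im) :
    ((c.cplx (s • unitI) u).1 : ℍ[ℝ]).imI = c.τ s * (u.2 : ℍ[ℝ]).imI ∧
    ((c.cplx (s • unitI) u).1 : ℍ[ℝ]).imJ
      = c.j₁ s * (u.2 : ℍ[ℝ]).imJ - s * c.j₃ s * (u.1 : ℍ[ℝ]).imK ∧
    ((c.cplx (s • unitI) u).1 : ℍ[ℝ]).imK
      = c.j₁ s * (u.2 : ℍ[ℝ]).imK + s * c.j₃ s * (u.1 : ℍ[ℝ]).imJ ∧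
    ((c.cplx (s • unitI) u).2 : ℍ[ℝ]).imI = c.σ s * (u.1 : ℍ[ℝ]).imI ∧
    ((c.cplx (s • unitI) u).2 : ℍ[ℝ]).imJ
      = c.k₁ s * (u.1 : ℍ[ℝ]).imJ + s * c.j₃ s * (u.2 : ℍ[ℝ]).imK ∧
    ((c.cplx (s • unitI) u).2 : ℍ[ℝ]).imK
      = c.k₁ s * (u.1 : ℍ[ℝ]).imK - s * c.j₃ s * (u.2 : ℍ[ℝ]).imJ := by
  rw [cplx_apply, norm_smul_unitI hs]
  simp only [Im.inner_eq, cross_imI, cross_imJ, cross_imK, Im.coe_smul, Quaternion.imI_smul,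
    Quaternion.imJ_smul, Quaternion.imK_smul, unitI_imI, unitI_imJ, unitI_imK, smul_eq_mul,
    Im.coe_add, Im.coe_sub, Quaternion.imI_add, Quaternion.imJ_add,
    Quaternion.imK_add, Quaternion.imI_sub, Quaternion.imJ_sub, Quaternion.imK_sub, τ, σ]
  refine ⟨?_, ?_, ?_, ?_, ?_, ?_⟩ <;> ring

/-! #### The almost Hermitian conditions -/

/-- The tangential part splits into the two binary forms in (x₂, y₃) and (x₃, y₂), both of
determinant D. Multiplying by G > 0 and completing squares shows definiteness. -/
theorem eq_zero_of_quadratic_nonpos {F σ τ G L M D x₁ x₂ x₃ y₁ y₂ y₃ : ℝ} (hF : 0 < F) (hσ : 0 < σ)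
    (hτ : 0 < τ) (hG : 0 < G) (hD : 0 < D) (hdet : G * L - M ^ 2 / 4 = D)
    (h : F * (σ * x₁ ^ 2 + τ * y₁ ^ 2) + (G * (x₂ ^ 2 + x₃ ^ 2) + L * (y₂ ^ 2 + y₃ ^ 2)
      + M * (x₂ * y₃ - x₃ * y₂)) ≤ 0) :
    x₁ = 0 ∧ x₂ = 0 ∧ x₃ = 0 ∧ y₁ = 0 ∧ y₂ = 0 ∧ y₃ = 0 := by
  have e : G * (G * (x₂ ^ 2 + x₃ ^ 2) + L * (y₂ ^ 2 + y₃ ^ 2) + M * (x₂ * y₃ - x₃ * y₂))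
      = (G * x₂ + M * y₃ / 2) ^ 2 + (G * x₃ - M * y₂ / 2) ^ 2 + D * y₂ ^ 2 + D * y₃ ^ 2 := by
    rw [← hdet]
    ring
  generalize G * (x₂ ^ 2 + x₃ ^ 2) + L * (y₂ ^ 2 + y₃ ^ 2) + M * (x₂ * y₃ - x₃ * y₂) = T at e h
  have r1 : 0 ≤ σ * x₁ ^ 2 := by positivity
  have r2 : 0 ≤ τ * y₁ ^ 2 := by positivity
  have t1 : 0 ≤ D * y₂ ^ 2 := by positivity
  have t2 : 0 ≤ D * y₃ ^ 2 := by positivity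
  have t3 := sq_nonneg (G * x₂ + M * y₃ / 2)
  have t4 := sq_nonneg (G * x₃ - M * y₂ / 2)
  have hT : 0 ≤ T := by
    by_contra hn
    have := mul_neg_of_pos_of_neg hG (not_le.1 hn)
    linarith
  have hR : 0 ≤ F * (σ * x₁ ^ 2 + τ * y₁ ^ 2) := by positivity
  have hT0 : T = 0 := by linarith
  have hR0 : F * (σ * x₁ ^ 2 + τ * y₁ ^ 2) = 0 := by linarith
  have hR1 := (mul_eq_zero.1 hR0).resolve_left hF.ne'
  rw [hT0, mul_zero] at e
  have s1 : σ * x₁ ^ 2 = 0 := by linarith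
  have s2 : τ * y₁ ^ 2 = 0 := by linarith
  have s3 : D * y₂ ^ 2 = 0 := by linarith
  have s4 : D * y₃ ^ 2 = 0 := by linarith
  have z2 : y₂ = 0 := by simpa [hD.ne'] using s3
  have z3 : y₃ = 0 := by simpa [hD.ne'] using s4
  have s5 : (G * x₂ + M * y₃ / 2) ^ 2 = 0 := by linarith
  have s6 : (G * x₃ - M * y₂ / 2) ^ 2 = 0 := by linarith
  refine ⟨by simpa [hσ.ne'] using s1, ?_, ?_, by simpa [hτ.ne'] using s2, z2, z3⟩
  · simpa [z3, hG.ne'] using s5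
  · simpa [z2, hG.ne'] using s6

theorem HermitianAt.cplx_cplx_radial (h : c.HermitianAt s) (hs : 0 ≤ s) (u : Im × Im) :
    c.cplx (s • unitI) (c.cplx (s • unitI) u) = -u := by
  obtain ⟨a1, a2, a3, a4, a5, a6⟩ := cplx_radial (c := c) hs u
  obtain ⟨b1, b2, b3, b4, b5, b6⟩ := cplx_radial (c := c) hs (c.cplx (s • unitI) u)
  have h1 := h.τ_mul_σ
  have h2 := h.j_mul_k
  ext1 <;> apply Im.ext <;>
    simp only [a1, a2, a3, a4, a5, a6, b1, b2, b3, b4, b5, b6, Prod.fst_neg, Prod.snd_neg,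
      Im.coe_neg, Quaternion.imI_neg, Quaternion.imJ_neg, Quaternion.imK_neg]
  · linear_combination (u.1 : ℍ[ℝ]).imI * h1
  · linear_combination (u.1 : ℍ[ℝ]).imJ * h2
  · linear_combination (u.1 : ℍ[ℝ]).imK * h2
  · linear_combination (u.2 : ℍ[ℝ]).imI * h1
  · linear_combination (u.2 : ℍ[ℝ]).imJ * h2
  · linear_combination (u.2 : ℍ[ℝ]).imK * h2

/-- The antisymmetric part of ω(u, Jv) is a multiple of the single scalar in `compat`. -/
theorem HermitianAt.metric_symm_radial (h : c.HermitianAt s) (hs : 0 ≤ s) (u v : Im × Im) :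
    c.metric (s • unitI) u v = c.metric (s • unitI) v u := by
  obtain ⟨a1, a2, a3, a4, a5, a6⟩ := cplx_radial (c := c) hs u
  obtain ⟨b1, b2, b3, b4, b5, b6⟩ := cplx_radial (c := c) hs v
  have h3 := h.compat
  rw [metric_apply, metric_apply, form_radial hs, form_radial hs]
  simp only [a1, a2, a3, a4, a5, a6, b1, b2, b3, b4, b5, b6]
  linear_combination s * ((u.1 : ℍ[ℝ]).imJ * (v.2 : ℍ[ℝ]).imK - (u.1 : ℍ[ℝ]).imK * (v.2 : ℍ[ℝ]).imJ
    - (u.2 : ℍ[ℝ]).imK * (v.1 : ℍ[ℝ]).imJ + (u.2 : ℍ[ℝ]).imJ * (v.1 : ℍ[ℝ]).imK) * h3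

theorem HermitianAt.metric_pos_radial (h : c.HermitianAt s) (hs : 0 ≤ s) (u : Im × Im)
    (hu : u ≠ 0) : 0 < c.metric (s • unitI) u u := by
  obtain ⟨a1, a2, a3, a4, a5, a6⟩ := cplx_radial (c := c) hs u
  have h1 := h.τ_mul_σ
  have h2 := h.j_mul_k
  have h3 := h.compat
  have hσ := h.pos_σ
  have hτ : 0 < -c.τ s := by
    by_contra hn
    nlinarith
  obtain ⟨G, hG⟩ : ∃ G, G = c.α s * c.k₁ s + s ^ 2 * c.δ s * c.j₃ s := ⟨_, rfl⟩
  obtain ⟨L, hL⟩ : ∃ L, L = -(c.α s * c.j₁ s + s ^ 2 * c.κ s * c.j₃ s) := ⟨_, rfl⟩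
  obtain ⟨M, hM⟩ : ∃ M, M = s * c.δ s * c.j₁ s - s * c.κ s * c.k₁ s := ⟨_, rfl⟩
  obtain ⟨F, hF⟩ : ∃ F, F = c.α s + c.β s * s ^ 2 := ⟨_, rfl⟩
  obtain ⟨D, hD⟩ : ∃ D, D = c.α s ^ 2 - s ^ 2 * c.δ s * c.κ s := ⟨_, rfl⟩
  have hGpos : 0 < G := hG ▸ h.pos_tangential
  have hFpos : 0 < F := hF ▸ h.pos_radial
  have hDpos : 0 < D := hD ▸ h.pos_det
  -- The determinant of the tangential metric block reduces, by J² = -1 and `compat`, to that of the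
  -- tangential part of ω, so L > 0 need not be assumed.
  have hdet : G * L - M ^ 2 / 4 = D := by
    rw [hG, hL, hM, hD]
    linear_combination (-c.α s ^ 2 + s ^ 2 * c.δ s * c.κ s) * h2 + (-(s ^ 2 * c.α s * c.j₃ s)
      - s ^ 2 / 4 * (c.k₁ s * c.κ s + c.j₁ s * c.δ s - 2 * c.j₃ s * c.α s)) * h3
  by_contra hneg
  apply hu
  have hval : c.metric (s • unitI) u u = F * (c.σ s * (u.1 : ℍ[ℝ]).imI ^ 2
      + -c.τ s * (u.2 : ℍ[ℝ]).imI ^ 2) + (G * ((u.1 : ℍ[ℝ]).imJ ^ 2 + (u.1 : ℍ[ℝ]).imK ^ 2)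
      + L * ((u.2 : ℍ[ℝ]).imJ ^ 2 + (u.2 : ℍ[ℝ]).imK ^ 2)
      + M * ((u.1 : ℍ[ℝ]).imJ * (u.2 : ℍ[ℝ]).imK - (u.1 : ℍ[ℝ]).imK * (u.2 : ℍ[ℝ]).imJ)) := by
    rw [metric_apply, form_radial hs, hF, hG, hL, hM]
    simp only [a1, a2, a3, a4, a5, a6]
    ring
  rw [hval] at hneg
  obtain ⟨z1, z2, z3, z4, z5, z6⟩ :=
    eq_zero_of_quadratic_nonpos hFpos hσ hτ hGpos hDpos hdet (not_lt.1 hneg)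
  ext1 <;> apply Im.ext <;> simp [z1, z2, z3, z4, z5, z6]

variable {η : ℝ} {w : Im}

/-- This is the reduction used throughout: any w is conjugate to a nonnegative multiple of i, so an
equivariant statement need only be checked at w = s·i with s = ‖w‖. -/
theorem exists_radial (w : Im) : ∃ b : SU2, AdL b (‖w‖ • unitI) = w ∧
    ∀ u : Im × Im, ∃ v, u = AdL₂ b v := by
  obtain ⟨b, hb⟩ := exists_AdL_smul_unitI w
  exact ⟨b, hb, fun u => ⟨AdL₂ b⁻¹ u, (AdL₂_AdL₂_inv b u).symm⟩⟩

theorem HermitianAt.cplx_cplx (h : c.HermitianAt ‖w‖) (u : Im × Im) :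
    c.cplx w (c.cplx w u) = -u := by
  obtain ⟨b, hb, hu⟩ := exists_radial w
  obtain ⟨v, rfl⟩ := hu u
  have h1 := h.cplx_cplx_radial (norm_nonneg w) v
  rw [← hb, cplx_AdL, cplx_AdL, h1, map_neg]

theorem HermitianAt.metric_symm (h : c.HermitianAt ‖w‖) (u v : Im × Im) :
    c.metric w u v = c.metric w v u := by
  obtain ⟨b, hb, hu⟩ := exists_radial w
  obtain ⟨u, rfl⟩ := hu u
  obtain ⟨v, rfl⟩ := hu v
  have h1 := h.metric_symm_radial (norm_nonneg w) u v
  rw [← hb, metric_AdL, metric_AdL, h1]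

theorem HermitianAt.metric_pos (h : c.HermitianAt ‖w‖) (u : Im × Im) (hu : u ≠ 0) :
    0 < c.metric w u u := by
  obtain ⟨b, hb, hu'⟩ := exists_radial w
  obtain ⟨u, rfl⟩ := hu' u
  have h1 := h.metric_pos_radial (norm_nonneg w) u (fun h0 => hu (by rw [h0, map_zero]))
  rwa [← hb, metric_AdL]

theorem form_skew (w : Im) (u v : Im × Im) : c.form w u v = -c.form w v u := by
  rw [form_apply, form_apply, cross_skew u.1, cross_skew u.2, inner_neg_right, inner_neg_right]
  ring

theorem HermitianAt.metric_cplx_left (h : c.HermitianAt ‖w‖) (u v : Im × Im) :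
    c.metric w (c.cplx w u) v = c.form w u v := by
  rw [h.metric_symm, metric_apply, h.cplx_cplx, map_neg, form_skew, neg_neg]

theorem HermitianAt.metric_cplx (h : c.HermitianAt ‖w‖) (u v : Im × Im) :
    c.metric w (c.cplx w u) (c.cplx w v) = c.metric w u v := by
  rw [h.metric_cplx_left, metric_apply]

/-! #### The first-order jet -/

theorem hasFDerivAt_form_apply (w : Im) (u v : Im × Im) :
    HasFDerivAt (fun w => c.form w u v) (((fderiv ℝ c.form w).flip u).flip v) w := by
  have h := (c.contDiff_form.contDiffAt (x := w)).differentiableAt (by simp) |>.hasFDerivAt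
  convert! (h.clm_apply (hasFDerivAt_const u w)).clm_apply (hasFDerivAt_const v w) using 1
  ext z
  simp

theorem hasFDerivAt_metric_apply (w : Im) (u v : Im × Im) :
    HasFDerivAt (fun w => c.metric w u v) (((fderiv ℝ c.metric w).flip u).flip v) w := by
  have h := (c.contDiff_metric.contDiffAt (x := w)).differentiableAt (by simp) |>.hasFDerivAt
  convert! (h.clm_apply (hasFDerivAt_const u w)).clm_apply (hasFDerivAt_const v w) using 1
  ext z
  simp

theorem hasFDerivAt_cplx_apply (w : Im) (u : Im × Im) :
    HasFDerivAt (fun w => c.cplx w u) ((fderiv ℝ c.cplx w).flip u) w := by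
  have h := (c.contDiff_cplx.contDiffAt (x := w)).differentiableAt (by simp) |>.hasFDerivAt
  have h1 := h.clm_apply (hasFDerivAt_const u w)
  rwa [ContinuousLinearMap.comp_zero, zero_add] at h1

/-- The Hermitian identities hold on an open ball, so they may be differentiated; the differential
axioms of the jet arise in this way. -/
theorem hasFDerivAt_unique_of_ball {F : Type*} [NormedAddCommGroup F] [NormedSpace ℝ F]
    {f g : Im → F} {f' g' : Im →L[ℝ] F} (hf : HasFDerivAt f f' w) (hg : HasFDerivAt g g' w)
    (hw : ‖w‖ < η) (h : ∀ w : Im, ‖w‖ < η → f w = g w) : f' = g' := by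
  refine hf.unique (hg.congr_of_eventuallyEq ?_)
  filter_upwards [(isOpen_lt continuous_norm continuous_const).mem_nhds hw] with x hx
  exact h x hx

/-- The jet at `w` of the almost Hermitian structure with coefficients `c`. -/
def jet (c : Coefficients) (η : ℝ) (h : ∀ s, |s| < η → c.HermitianAt s) (w : Im) (hw : ‖w‖ < η) :
    HermitianJet (Im × Im) where
  g := c.metric w
  J := c.cplx w
  Dg := fderiv ℝ c.metric w ∘L ContinuousLinearMap.snd ℝ Im Im
  DJ := fderiv ℝ c.cplx w ∘L ContinuousLinearMap.snd ℝ Im Im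
  br := brL
  g_symm := (h ‖w‖ (by rwa [abs_norm])).metric_symm
  g_pos := (h ‖w‖ (by rwa [abs_norm])).metric_pos
  J_sq := (h ‖w‖ (by rwa [abs_norm])).cplx_cplx
  g_J := (h ‖w‖ (by rwa [abs_norm])).metric_cplx
  Dg_symm X Y Z := by
    have := hasFDerivAt_unique_of_ball (c.hasFDerivAt_metric_apply w Y Z)
      (c.hasFDerivAt_metric_apply w Z Y) hw
      (fun w hw => (h ‖w‖ (by rwa [abs_norm])).metric_symm Y Z)
    exact congrArg (fun L => L X.2) this
  DJ_J X Y := by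
    have hd := (c.contDiff_cplx.contDiffAt (x := w)).differentiableAt (by simp) |>.hasFDerivAt
    have := hasFDerivAt_unique_of_ball (hd.clm_apply (c.hasFDerivAt_cplx_apply w Y))
      (hasFDerivAt_const (-Y) w) hw
      (fun w hw => (h ‖w‖ (by rwa [abs_norm])).cplx_cplx Y)
    have h1 := congrArg (fun L => L X.2) this
    simp only [add_apply, ContinuousLinearMap.comp_apply, ContinuousLinearMap.flip_apply,
      zero_apply] at h1
    exact eq_neg_of_add_eq_zero_right h1
  Dg_J X Y Z := by
    have hd := (c.contDiff_metric.contDiffAt (x := w)).differentiableAt (by simp) |>.hasFDerivAt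
    have h1 := (hd.clm_apply (c.hasFDerivAt_cplx_apply w Y)).clm_apply (hasFDerivAt_const Z w)
    have h2 := (hd.clm_apply (hasFDerivAt_const Y w)).clm_apply (c.hasFDerivAt_cplx_apply w Z)
    have := hasFDerivAt_unique_of_ball (h1.add h2) (hasFDerivAt_const (0 : ℝ) w) hw
      (fun w hw => by
        have h0 := h ‖w‖ (by rwa [abs_norm])
        change c.metric w (c.cplx w Y) Z + c.metric w Y (c.cplx w Z) = 0
        rw [← h0.metric_cplx Y, h0.cplx_cplx, map_neg]
        ring)
    have h1 := congrArg (fun L => L X.2) this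
    simp only [add_apply, ContinuousLinearMap.comp_apply, ContinuousLinearMap.flip_apply,
      zero_apply, map_zero, zero_add] at h1
    simp only [ContinuousLinearMap.comp_apply, ContinuousLinearMap.coe_snd']
    linear_combination h1
  br_skew := brL_skew

section Jet

variable (h : ∀ s, |s| < η → c.HermitianAt s) (hw : ‖w‖ < η)

theorem jet_kahler (X Y : Im × Im) : (c.jet η h w hw).kahler X Y = c.form w X Y :=
  (h ‖w‖ (by rwa [abs_norm])).metric_cplx_left X Y

/-- The product rule for g(JY, Z) produces both terms, and on the ball this function equals ω(Y, Z).
-/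
theorem jet_Dkahler (X Y Z : Im × Im) :
    (c.jet η h w hw).Dkahler X Y Z = fderiv ℝ c.form w X.2 Y Z := by
  have hd := (c.contDiff_metric.contDiffAt (x := w)).differentiableAt (by simp) |>.hasFDerivAt
  have h1 := (hd.clm_apply (c.hasFDerivAt_cplx_apply w Y)).clm_apply (hasFDerivAt_const Z w)
  have := hasFDerivAt_unique_of_ball h1 (c.hasFDerivAt_form_apply w Y Z) hw
    (fun w hw => (h ‖w‖ (by rwa [abs_norm])).metric_cplx_left Y Z)
  have h1 := congrArg (fun L => L X.2) this
  simp only [add_apply, ContinuousLinearMap.comp_apply, ContinuousLinearMap.flip_apply,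
    zero_apply, map_zero, zero_add] at h1
  rw [← h1, add_comm]
  rfl

theorem fderiv_form_AdL (b : SU2) (w z : Im) (Y Z : Im × Im) :
    fderiv ℝ c.form (AdL b w) (AdL b z) (AdL₂ b Y) (AdL₂ b Z) = fderiv ℝ c.form w z Y Z := by
  have h1 := (c.hasFDerivAt_form_apply (AdL b w) (AdL₂ b Y) (AdL₂ b Z)).comp w
    (AdL b).hasFDerivAt
  have h2 := h1.unique ((c.hasFDerivAt_form_apply w Y Z).congr_of_eventuallyEq
    (Filter.Eventually.of_forall fun w => c.form_AdL b w Y Z))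
  exact congrArg (fun L => L z) h2

theorem fderiv_cplx_AdL (b : SU2) (w z : Im) (Y : Im × Im) :
    fderiv ℝ c.cplx (AdL b w) (AdL b z) (AdL₂ b Y) = AdL₂ b (fderiv ℝ c.cplx w z Y) := by
  have h1 := (c.hasFDerivAt_cplx_apply (AdL b w) (AdL₂ b Y)).comp w (AdL b).hasFDerivAt
  have h3 := (AdL₂ b).hasFDerivAt.comp w (c.hasFDerivAt_cplx_apply w Y)
  have h2 := h1.unique (h3.congr_of_eventuallyEq
    (Filter.Eventually.of_forall fun w => c.cplx_AdL b w Y))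
  exact congrArg (fun L => L z) h2

theorem jet_dkahler (X Y Z : Im × Im) : (c.jet η h w hw).dkahler X Y Z =
    fderiv ℝ c.form w X.2 Y Z + fderiv ℝ c.form w Y.2 Z X + fderiv ℝ c.form w Z.2 X Y
      - c.form w (brL X Y) Z - c.form w (brL Y Z) X - c.form w (brL Z X) Y := by
  simp only [HermitianJet.dkahler, jet_Dkahler, jet_kahler]
  rfl

theorem jet_nijenhuis (X Y : Im × Im) : (c.jet η h w hw).nijenhuis X Y =
    fderiv ℝ c.cplx w (c.cplx w X).2 Y - fderiv ℝ c.cplx w (c.cplx w Y).2 X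
      + c.cplx w (fderiv ℝ c.cplx w Y.2 X) - c.cplx w (fderiv ℝ c.cplx w X.2 Y)
      + brL (c.cplx w X) (c.cplx w Y) - c.cplx w (brL (c.cplx w X) Y)
      - c.cplx w (brL X (c.cplx w Y)) - brL X Y := rfl

theorem jet_dkahler_AdL (b : SU2) (hw' : ‖AdL b w‖ < η) (X Y Z : Im × Im) :
    (c.jet η h (AdL b w) hw').dkahler (AdL₂ b X) (AdL₂ b Y) (AdL₂ b Z)
      = (c.jet η h w hw).dkahler X Y Z := by
  rw [jet_dkahler, jet_dkahler]
  simp only [brL_AdL₂, form_AdL]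
  have e : ∀ u : Im × Im, (AdL₂ b u).2 = AdL b u.2 := fun _ => rfl
  simp only [e, fderiv_form_AdL]

theorem jet_nijenhuis_AdL (b : SU2) (hw' : ‖AdL b w‖ < η) (X Y : Im × Im) :
    (c.jet η h (AdL b w) hw').nijenhuis (AdL₂ b X) (AdL₂ b Y)
      = AdL₂ b ((c.jet η h w hw).nijenhuis X Y) := by
  have e : ∀ u : Im × Im, (AdL₂ b u).2 = AdL b u.2 := fun _ => rfl
  simp only [jet_nijenhuis, cplx_AdL, brL_AdL₂, e, fderiv_cplx_AdL, map_add, map_sub]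

end Jet

end Coefficients

open scoped RealInnerProductSpace

namespace Coefficients

variable {c : Coefficients} {s η : ℝ}

/-! #### Torsion at a point of the radius through `i` -/

theorem hasFDerivAt_inner_left (w x : Im) :
    HasFDerivAt (fun w : Im => ⟪w, x⟫) ((innerSL ℝ).flip x) w :=
  ((innerSL ℝ).flip x).hasFDerivAt

theorem fderiv_form_radial (hs : 0 ≤ s) (z : Im) (u v : Im × Im) :
    fderiv ℝ c.form (s • unitI) z u v =
      deriv c.α s * (z : ℍ[ℝ]).imI * (⟪u.1, v.2⟫ - ⟪v.1, u.2⟫)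
      + deriv c.β s * (z : ℍ[ℝ]).imI * s ^ 2
        * ((u.1 : ℍ[ℝ]).imI * (v.2 : ℍ[ℝ]).imI - (v.1 : ℍ[ℝ]).imI * (u.2 : ℍ[ℝ]).imI)
      + c.β s * s * (⟪z, u.1⟫ * (v.2 : ℍ[ℝ]).imI + (u.1 : ℍ[ℝ]).imI * ⟪z, v.2⟫ - ⟪z, v.1⟫
        * (u.2 : ℍ[ℝ]).imI - (v.1 : ℍ[ℝ]).imI * ⟪z, u.2⟫)
      + deriv c.δ s * (z : ℍ[ℝ]).imI * s * (cross u.1 v.1 : ℍ[ℝ]).imI + c.δ s * ⟪z, cross u.1 v.1⟫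
      + deriv c.κ s * (z : ℍ[ℝ]).imI * s * (cross u.2 v.2 : ℍ[ℝ]).imI + c.κ s
        * ⟪z, cross u.2 v.2⟫ := by
  obtain ⟨hα, hβ, hδ, hκ, -⟩ := c.smooth
  obtain ⟨eα, eβ, eδ, eκ, -⟩ := c.even
  have dα := eα.hasFDerivAt_radial hα hs norm_unitI
  have dβ := eβ.hasFDerivAt_radial hβ hs norm_unitI
  have dδ := eδ.hasFDerivAt_radial hδ hs norm_unitI
  have dκ := eκ.hasFDerivAt_radial hκ hs norm_unitI
  have hin := hasFDerivAt_inner_left (s • unitI)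
  have h1 := (((dα.mul_const (⟪u.1, v.2⟫ - ⟪v.1, u.2⟫)).add
    (dβ.mul (((hin u.1).mul (hin v.2)).sub ((hin v.1).mul (hin u.2))))).add
    (dδ.mul (hin (cross u.1 v.1)))).add (dκ.mul (hin (cross u.2 v.2)))
  have h2 := congrArg (fun L => L z) ((c.hasFDerivAt_form_apply (s • unitI) u v).unique h1)
  have hi : ∀ x : Im, ⟪unitI, x⟫ = (x : ℍ[ℝ]).imI := fun x => by simp [Im.inner_eq]
  have hi' : ∀ x : Im, ⟪s • unitI, x⟫ = s * (x : ℍ[ℝ]).imI := fun x => by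
    rw [real_inner_smul_left, hi]
  simp only [add_apply, sub_apply, smul_apply, ContinuousLinearMap.flip_apply, innerSL_apply_apply,
    Pi.mul_apply, Pi.sub_apply, smul_eq_mul, hi, hi', norm_smul_unitI hs] at h2
  rw [h2]
  ring

/-- Only arguments in the first factor are needed, because the Nijenhuis relation will be tested
there alone. -/
theorem fderiv_cplx_radial (hs : 0 ≤ s) (z x : Im) :
    fderiv ℝ c.cplx (s • unitI) z (x, 0) =
      ((deriv c.j₃ s * (z : ℍ[ℝ]).imI * s) • cross unitI x + c.j₃ s • cross z x,
        (deriv c.k₁ s * (z : ℍ[ℝ]).imI) • x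
            + (deriv c.k₂ s * (z : ℍ[ℝ]).imI * s ^ 2 * (x : ℍ[ℝ]).imI) • unitI
          + (c.k₂ s * ⟪z, x⟫ * s) • unitI + (c.k₂ s * s * (x : ℍ[ℝ]).imI) • z) := by
  obtain ⟨-, -, -, -, s1, s2, s3, s4, s5⟩ := c.smooth
  obtain ⟨-, -, -, -, e1, e2, e3, e4, e5⟩ := c.even
  have d3 := e3.hasFDerivAt_radial s3 hs norm_unitI
  have d4 := e4.hasFDerivAt_radial s4 hs norm_unitI
  have d5 := e5.hasFDerivAt_radial s5 hs norm_unitI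
  have hin := hasFDerivAt_inner_left (s • unitI) x
  have hc : HasFDerivAt (fun w => cross w x) (cross.flip x) (s • unitI) :=
    (cross.flip x).hasFDerivAt
  have h1 := (d3.smul hc).prodMk ((d4.smul_const x).add ((d5.mul hin).smul (hasFDerivAt_id _)))
  have hfun : (fun w => c.cplx w (x, 0)) = fun w : Im => (c.j₃ ‖w‖ • cross w x,
      c.k₁ ‖w‖ • x + (c.k₂ ‖w‖ * ⟪w, x⟫) • w) := by
    funext w
    simp [cplx_apply]
  have h3 := c.hasFDerivAt_cplx_apply (s • unitI) (x, 0)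
  rw [hfun] at h3
  have h2 := congrArg (fun L => L z) (h3.unique h1)
  have hi : ∀ x : Im, ⟪unitI, x⟫ = (x : ℍ[ℝ]).imI := fun x => by simp [Im.inner_eq]
  have hi' : ∀ x : Im, ⟪s • unitI, x⟫ = s * (x : ℍ[ℝ]).imI := fun x => by
    rw [real_inner_smul_left, hi]
  have hfl : innerSL ℝ x z = ⟪z, x⟫ := (innerSL_apply_apply ℝ x z).trans (real_inner_comm _ _)
  refine h2.trans ?_
  ext1
  · simp [hi, norm_smul_unitI hs]
    module
  · simp [hi, hi', hfl, norm_smul_unitI hs]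
    module

variable (h : ∀ s, |s| < η → c.HermitianAt s)

theorem norm_radial_lt (hs : 0 ≤ s) (hsη : s < η) : ‖s • unitI‖ < η := by
  rwa [norm_smul_unitI hs]

theorem jet_dkahler_radial (hs : 0 ≤ s) (hsη : s < η) (X Y Z : Im × Im) :
    (c.jet η h (s • unitI) (norm_radial_lt hs hsη)).dkahler X Y Z =
      c.A s * (((X.1 : ℍ[ℝ]).imK * ((Y.1 : ℍ[ℝ]).imI * (Z.2 : ℍ[ℝ]).imJ - (Z.1 : ℍ[ℝ]).imI
          * (Y.2 : ℍ[ℝ]).imJ)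
        + (Y.1 : ℍ[ℝ]).imK * ((Z.1 : ℍ[ℝ]).imI * (X.2 : ℍ[ℝ]).imJ - (X.1 : ℍ[ℝ]).imI
          * (Z.2 : ℍ[ℝ]).imJ)
        + (Z.1 : ℍ[ℝ]).imK * ((X.1 : ℍ[ℝ]).imI * (Y.2 : ℍ[ℝ]).imJ - (Y.1 : ℍ[ℝ]).imI
          * (X.2 : ℍ[ℝ]).imJ)) + ((X.1 : ℍ[ℝ]).imI
              * ((Y.1 : ℍ[ℝ]).imJ * (Z.2 : ℍ[ℝ]).imK - (Z.1 : ℍ[ℝ]).imJ * (Y.2 : ℍ[ℝ]).imK)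
        + (Y.1 : ℍ[ℝ]).imI * ((Z.1 : ℍ[ℝ]).imJ * (X.2 : ℍ[ℝ]).imK - (X.1 : ℍ[ℝ]).imJ
          * (Z.2 : ℍ[ℝ]).imK)
        + (Z.1 : ℍ[ℝ]).imI * ((X.1 : ℍ[ℝ]).imJ * (Y.2 : ℍ[ℝ]).imK - (Y.1 : ℍ[ℝ]).imJ
          * (X.2 : ℍ[ℝ]).imK)))
      + (-(2 * c.α s) - 2 * c.β s * s ^ 2 + c.δ s + s * deriv c.δ s)
        * ((X.1 : ℍ[ℝ]).imJ * ((Y.1 : ℍ[ℝ]).imK * (Z.2 : ℍ[ℝ]).imI - (Z.1 : ℍ[ℝ]).imK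
            * (Y.2 : ℍ[ℝ]).imI)
        + (Y.1 : ℍ[ℝ]).imJ * ((Z.1 : ℍ[ℝ]).imK * (X.2 : ℍ[ℝ]).imI - (X.1 : ℍ[ℝ]).imK
          * (Z.2 : ℍ[ℝ]).imI)
        + (Z.1 : ℍ[ℝ]).imJ * ((X.1 : ℍ[ℝ]).imK * (Y.2 : ℍ[ℝ]).imI - (Y.1 : ℍ[ℝ]).imK
          * (X.2 : ℍ[ℝ]).imI))
      + (deriv c.α s - c.β s * s) * (((X.2 : ℍ[ℝ]).imI
        * ((Y.1 : ℍ[ℝ]).imJ * (Z.2 : ℍ[ℝ]).imJ - (Z.1 : ℍ[ℝ]).imJ * (Y.2 : ℍ[ℝ]).imJ)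
        + (Y.2 : ℍ[ℝ]).imI * ((Z.1 : ℍ[ℝ]).imJ * (X.2 : ℍ[ℝ]).imJ - (X.1 : ℍ[ℝ]).imJ
          * (Z.2 : ℍ[ℝ]).imJ)
        + (Z.2 : ℍ[ℝ]).imI * ((X.1 : ℍ[ℝ]).imJ * (Y.2 : ℍ[ℝ]).imJ - (Y.1 : ℍ[ℝ]).imJ
          * (X.2 : ℍ[ℝ]).imJ)) + ((X.2 : ℍ[ℝ]).imI
              * ((Y.1 : ℍ[ℝ]).imK * (Z.2 : ℍ[ℝ]).imK - (Z.1 : ℍ[ℝ]).imK * (Y.2 : ℍ[ℝ]).imK)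
        + (Y.2 : ℍ[ℝ]).imI * ((Z.1 : ℍ[ℝ]).imK * (X.2 : ℍ[ℝ]).imK - (X.1 : ℍ[ℝ]).imK
          * (Z.2 : ℍ[ℝ]).imK)
        + (Z.2 : ℍ[ℝ]).imI * ((X.1 : ℍ[ℝ]).imK * (Y.2 : ℍ[ℝ]).imK - (Y.1 : ℍ[ℝ]).imK
          * (X.2 : ℍ[ℝ]).imK)))
      + (3 * c.κ s + s * deriv c.κ s)
        * ((X.2 : ℍ[ℝ]).imI * ((Y.2 : ℍ[ℝ]).imJ * (Z.2 : ℍ[ℝ]).imK - (Z.2 : ℍ[ℝ]).imJ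
            * (Y.2 : ℍ[ℝ]).imK)
        + (Y.2 : ℍ[ℝ]).imI * ((Z.2 : ℍ[ℝ]).imJ * (X.2 : ℍ[ℝ]).imK - (X.2 : ℍ[ℝ]).imJ
          * (Z.2 : ℍ[ℝ]).imK)
        + (Z.2 : ℍ[ℝ]).imI * ((X.2 : ℍ[ℝ]).imJ * (Y.2 : ℍ[ℝ]).imK - (Y.2 : ℍ[ℝ]).imJ
          * (X.2 : ℍ[ℝ]).imK)) := by
  rw [jet_dkahler]
  simp only [fderiv_form_radial hs, form_radial hs, brL_apply, Im.inner_eq, cross_imI, cross_imJ,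
    cross_imK, A, Im.coe_smul, Im.coe_zero, Quaternion.imI_smul, Quaternion.imJ_smul,
    Quaternion.imK_smul, smul_eq_mul, Quaternion.imI_zero, Quaternion.imJ_zero,
    Quaternion.imK_zero]
  ring

/-- The pairing of the tangential planes of the two factors entering the torsion form. -/
def tangentialPairing (u v : Im × Im) : ℝ :=
  (u.1 : ℍ[ℝ]).imJ * (v.2 : ℍ[ℝ]).imK - (u.2 : ℍ[ℝ]).imK * (v.1 : ℍ[ℝ]).imJ - (u.1 : ℍ[ℝ]).imK
      * (v.2 : ℍ[ℝ]).imJ + (u.2 : ℍ[ℝ]).imJ * (v.1 : ℍ[ℝ]).imK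

theorem tangentialPairing_skew (u v : Im × Im) :
    tangentialPairing u v = -tangentialPairing v u := by
  simp only [tangentialPairing]
  ring

theorem tangentialPairing_cplx (hs : 0 ≤ s) (u v : Im × Im) :
    tangentialPairing (c.cplx (s • unitI) u) v =
      c.j₁ s * ((u.2 : ℍ[ℝ]).imJ * (v.2 : ℍ[ℝ]).imK - (u.2 : ℍ[ℝ]).imK * (v.2 : ℍ[ℝ]).imJ) + c.k₁ s
          * ((u.1 : ℍ[ℝ]).imJ * (v.1 : ℍ[ℝ]).imK - (u.1 : ℍ[ℝ]).imK * (v.1 : ℍ[ℝ]).imJ)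
      - s * c.j₃ s * ((u.1 : ℍ[ℝ]).imK * (v.2 : ℍ[ℝ]).imK - (u.2 : ℍ[ℝ]).imK * (v.1 : ℍ[ℝ]).imK
        + (u.1 : ℍ[ℝ]).imJ * (v.2 : ℍ[ℝ]).imJ - (u.2 : ℍ[ℝ]).imJ * (v.1 : ℍ[ℝ]).imJ) := by
  obtain ⟨a1, a2, a3, a4, a5, a6⟩ := cplx_radial (c := c) hs u
  simp only [tangentialPairing, a2, a3, a5, a6]
  ring

/-- This symmetry makes B(u, v) = T(u, v) - i T(Ju, v) a complex bilinear form, where T denotes the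
pairing. The radial covector ζ(X) = X₁ - i τ X₂, with X₁ and X₂ the radial components of X, is
complex linear by τσ = -1. The cyclic sum of ζ(X) B(Y, Z) is then of type (3,0), and dω is A times
its real part. -/
theorem tangentialPairing_cplx_left (hs : 0 ≤ s) (u v : Im × Im) :
    tangentialPairing (c.cplx (s • unitI) u) v = tangentialPairing u (c.cplx (s • unitI) v) := by
  rw [tangentialPairing_skew u, tangentialPairing_cplx hs, tangentialPairing_cplx hs]
  ring

theorem tangentialPairing_neg_left (u v : Im × Im) :
    tangentialPairing (-u) v = -tangentialPairing u v := by
  simp only [tangentialPairing, Prod.fst_neg, Prod.snd_neg, Im.coe_neg, Quaternion.imJ_neg,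
    Quaternion.imK_neg]
  ring

/-- The exterior derivative of the Kähler form is the real part of a form of type `(3,0)`. -/
theorem TorsionAt.jet_dkahler_eq (ht : c.TorsionAt s) (hs : 0 ≤ s) (hsη : s < η)
    (X Y Z : Im × Im) :
    (c.jet η h (s • unitI) (norm_radial_lt hs hsη)).dkahler X Y Z = c.A s *
      ((X.1 : ℍ[ℝ]).imI * tangentialPairing Y Z + (Y.1 : ℍ[ℝ]).imI * tangentialPairing Z X
        + (Z.1 : ℍ[ℝ]).imI * tangentialPairing X Y
        - c.τ s * ((X.2 : ℍ[ℝ]).imI * tangentialPairing (c.cplx (s • unitI) Y) Z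
        + (Y.2 : ℍ[ℝ]).imI * tangentialPairing (c.cplx (s • unitI) Z) X
        + (Z.2 : ℍ[ℝ]).imI * tangentialPairing (c.cplx (s • unitI) X) Y)) := by
  rw [jet_dkahler_radial h hs hsη, ht.d_α, ht.d_κ, ht.d_δ]
  simp only [tangentialPairing_cplx hs]
  simp only [tangentialPairing]
  ring

theorem TorsionAt.jet_dkahler_cplx (ht : c.TorsionAt s) (hs : 0 ≤ s) (hsη : s < η)
    (X Y Z : Im × Im) :
    (c.jet η h (s • unitI) (norm_radial_lt hs hsη)).dkahler X (c.cplx (s • unitI) Y)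
      (c.cplx (s • unitI) Z) =
    -(c.jet η h (s • unitI) (norm_radial_lt hs hsη)).dkahler X Y Z := by
  have hh := h s (by rwa [abs_of_nonneg hs])
  have hJ := hh.cplx_cplx_radial hs
  have e := hh.τ_mul_σ
  obtain ⟨a1, -, -, a4, -, -⟩ := cplx_radial (c := c) hs Y
  obtain ⟨b1, -, -, b4, -, -⟩ := cplx_radial (c := c) hs Z
  rw [ht.jet_dkahler_eq h hs hsη, ht.jet_dkahler_eq h hs hsη]
  rw [hJ, hJ, tangentialPairing_neg_left, tangentialPairing_neg_left, a1, b1, a4, b4,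
    ← tangentialPairing_cplx_left hs (c.cplx (s • unitI) Y), hJ, tangentialPairing_neg_left,
    ← tangentialPairing_cplx_left hs X Y,
    ← tangentialPairing_cplx_left hs (c.cplx (s • unitI) X), hJ, tangentialPairing_neg_left,
    ← tangentialPairing_cplx_left hs Y Z]
  linear_combination c.A s * ((Y.1 : ℍ[ℝ]).imI * tangentialPairing Z X + (Z.1 : ℍ[ℝ]).imI
      * tangentialPairing X Y) * e

/-- A nonzero vector does not annihilate the exterior derivative of the Kähler form. -/
theorem TorsionAt.exists_jet_dkahler_ne_zero (ht : c.TorsionAt s) (hs : 0 ≤ s) (hsη : s < η)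
    {X : Im × Im} (hX : X ≠ 0) :
    ∃ Y Z, (c.jet η h (s • unitI) (norm_radial_lt hs hsη)).dkahler X Y Z ≠ 0 := by
  have hh := h s (by rwa [abs_of_nonneg hs])
  by_contra! hzero
  apply hX
  have hτ : c.τ s ≠ 0 := left_ne_zero_of_mul (hh.τ_mul_σ.trans_ne (by norm_num))
  obtain ⟨e₂, p1, p2, p3⟩ : ∃ e : Im, (e : ℍ[ℝ]).imI = 0 ∧ (e : ℍ[ℝ]).imJ = 1 ∧ (e : ℍ[ℝ]).imK =
      0 :=
    ⟨toIm (su2Coord.symm ![0, 1, 0]), rfl, rfl, rfl⟩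
  obtain ⟨e₃, q1, q2, q3⟩ : ∃ e : Im, (e : ℍ[ℝ]).imI = 0 ∧ (e : ℍ[ℝ]).imJ = 0 ∧ (e : ℍ[ℝ]).imK =
      1 :=
    ⟨toIm (su2Coord.symm ![0, 0, 1]), rfl, rfl, rfl⟩
  have key : ∀ Y Z : Im × Im, (X.1 : ℍ[ℝ]).imI * tangentialPairing Y Z + (Y.1 : ℍ[ℝ]).imI
      * tangentialPairing Z X
        + (Z.1 : ℍ[ℝ]).imI * tangentialPairing X Y
        - c.τ s * ((X.2 : ℍ[ℝ]).imI * tangentialPairing (c.cplx (s • unitI) Y) Z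
        + (Y.2 : ℍ[ℝ]).imI * tangentialPairing (c.cplx (s • unitI) Z) X
        + (Z.2 : ℍ[ℝ]).imI * tangentialPairing (c.cplx (s • unitI) X) Y) = 0 := by
    intro Y Z
    have h1 := hzero Y Z
    rw [ht.jet_dkahler_eq h hs hsη] at h1
    exact (mul_eq_zero.1 h1).resolve_left ht.A_ne_zero
  simp only [tangentialPairing_cplx hs] at key
  simp only [tangentialPairing] at key
  -- Pairing the radial vector (i, 0) with tangential ones isolates the tangential components of X.
  -- The last two choices give the radial components, the second factor first, thanks to τ ≠ 0 and
  -- k₁ ≠ 0.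
  have k1 := key (unitI, 0) (0, e₂)
  have k2 := key (unitI, 0) (0, e₃)
  have k3 := key (unitI, 0) (e₂, 0)
  have k4 := key (unitI, 0) (e₃, 0)
  have k5 := key (e₂, 0) (e₃, 0)
  have k6 := key (e₂, 0) (0, e₃)
  simp [p1, p2, p3, q1, q2, q3, hτ, ht.k₁_ne_zero] at k1 k2 k3 k4 k5
  simp [p1, p2, p3, q1, q2, q3, k5] at k6
  ext1 <;> apply Im.ext <;> simp [k1, k2, k3, k4, k5, k6]

/-- On the first factor, N(y, z) is built from y × z and three scalars: one radial and two
tangential coefficients, the component along the radial direction of the second factor being zero.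
Pairing with X under ω gives exactly the three Nijenhuis identities of `TorsionAt`. -/
theorem TorsionAt.jet_nijenhuis_eq (ht : c.TorsionAt s) (hs : 0 ≤ s) (hsη : s < η)
    (X : Im × Im) (y z : Im) :
    (c.jet η h (s • unitI) (norm_radial_lt hs hsη)).kahler
      ((c.jet η h (s • unitI) (norm_radial_lt hs hsη)).nijenhuis (y, 0) (z, 0)) X =
    4 / 3 * (c.jet η h (s • unitI) (norm_radial_lt hs hsη)).dkahler X (y, 0) (z, 0) := by
  have hh := h s (by rwa [abs_of_nonneg hs])
  have hJ := cplx_radial (c := c) hs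
  rw [ht.jet_dkahler_eq h hs hsη, jet_kahler, form_radial hs]
  simp only [tangentialPairing_cplx hs]
  simp only [tangentialPairing]
  obtain ⟨N, hN⟩ : ∃ N, N = (c.jet η h (s • unitI) (norm_radial_lt hs hsη)).nijenhuis (y, 0) (z, 0)
      :=
    ⟨_, rfl⟩
  have hN' := hN
  rw [jet_nijenhuis, fderiv_cplx_radial hs, fderiv_cplx_radial hs, map_zero, zero_apply,
    zero_apply, map_zero, add_zero, sub_zero] at hN'
  have n1 : (N.1 : ℍ[ℝ]).imI = (2 * c.k₁ s * c.j₃ s + 2 * s ^ 2 * c.j₃ s ^ 2 - 2)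
      * ((y : ℍ[ℝ]).imJ * (z : ℍ[ℝ]).imK - (y : ℍ[ℝ]).imK * (z : ℍ[ℝ]).imJ) := by
    rw [hN']
    simp only [Prod.fst_add, Prod.snd_add, Prod.fst_sub, Prod.snd_sub, Im.coe_add, Im.coe_sub,
        Im.coe_smul,
      Im.coe_zero, Quaternion.imI_add, Quaternion.imJ_add, Quaternion.imK_add, Quaternion.imI_sub,
      Quaternion.imJ_sub, Quaternion.imK_sub, Quaternion.imI_smul, Quaternion.imJ_smul,
      Quaternion.imK_smul, Quaternion.imI_zero, Quaternion.imJ_zero, Quaternion.imK_zero,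
          smul_eq_mul,
      hJ, brL_apply, cross_imI, cross_imJ, cross_imK, Im.inner_eq, unitI_imI, unitI_imJ, unitI_imK]
    ring
  have n2 : (N.1 : ℍ[ℝ]).imJ = (c.σ s * (c.j₃ s + s * deriv c.j₃ s) + c.k₁ s * c.j₃ s
      + 2 * s ^ 2 * c.j₃ s ^ 2 - 2) * ((y : ℍ[ℝ]).imK * (z : ℍ[ℝ]).imI - (y : ℍ[ℝ]).imI
        * (z : ℍ[ℝ]).imK) := by
    rw [hN']
    simp only [Prod.fst_add, Prod.snd_add, Prod.fst_sub, Prod.snd_sub, Im.coe_add, Im.coe_sub,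
        Im.coe_smul,
      Im.coe_zero, Quaternion.imI_add, Quaternion.imJ_add, Quaternion.imK_add, Quaternion.imI_sub,
      Quaternion.imJ_sub, Quaternion.imK_sub, Quaternion.imI_smul, Quaternion.imJ_smul,
      Quaternion.imK_smul, Quaternion.imI_zero, Quaternion.imJ_zero, Quaternion.imK_zero,
          smul_eq_mul,
      hJ, brL_apply, cross_imI, cross_imJ, cross_imK, Im.inner_eq, unitI_imI, unitI_imJ, unitI_imK]
    ring
  have n3 : (N.1 : ℍ[ℝ]).imK = (c.σ s * (c.j₃ s + s * deriv c.j₃ s) + c.k₁ s * c.j₃ s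
      + 2 * s ^ 2 * c.j₃ s ^ 2 - 2) * ((y : ℍ[ℝ]).imI * (z : ℍ[ℝ]).imJ - (y : ℍ[ℝ]).imJ
        * (z : ℍ[ℝ]).imI) := by
    rw [hN']
    simp only [Prod.fst_add, Prod.snd_add, Prod.fst_sub, Prod.snd_sub, Im.coe_add, Im.coe_sub,
        Im.coe_smul,
      Im.coe_zero, Quaternion.imI_add, Quaternion.imJ_add, Quaternion.imK_add, Quaternion.imI_sub,
      Quaternion.imJ_sub, Quaternion.imK_sub, Quaternion.imI_smul, Quaternion.imJ_smul,
      Quaternion.imK_smul, Quaternion.imI_zero, Quaternion.imJ_zero, Quaternion.imK_zero,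
          smul_eq_mul,
      hJ, brL_apply, cross_imI, cross_imJ, cross_imK, Im.inner_eq, unitI_imI, unitI_imJ, unitI_imK]
    ring
  have m1 : (N.2 : ℍ[ℝ]).imI = 0 := by
    rw [hN']
    simp only [Prod.fst_add, Prod.snd_add, Prod.fst_sub, Prod.snd_sub, Im.coe_add, Im.coe_sub,
        Im.coe_smul,
      Im.coe_zero, Quaternion.imI_add, Quaternion.imJ_add, Quaternion.imK_add, Quaternion.imI_sub,
      Quaternion.imJ_sub, Quaternion.imK_sub, Quaternion.imI_smul, Quaternion.imJ_smul,
      Quaternion.imK_smul, Quaternion.imI_zero, Quaternion.imJ_zero, Quaternion.imK_zero,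
          smul_eq_mul,
      hJ, brL_apply, cross_imI, cross_imJ, cross_imK, Im.inner_eq, unitI_imI, unitI_imJ, unitI_imK]
    ring
  have m2 : (N.2 : ℍ[ℝ]).imJ = (c.σ s * deriv c.k₁ s - s * c.k₁ s * c.k₂ s + 2 * s * c.k₁ s
      * c.j₃ s)
      * ((y : ℍ[ℝ]).imI * (z : ℍ[ℝ]).imJ - (y : ℍ[ℝ]).imJ * (z : ℍ[ℝ]).imI) := by
    rw [hN']
    simp only [Prod.fst_add, Prod.snd_add, Prod.fst_sub, Prod.snd_sub, Im.coe_add, Im.coe_sub,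
        Im.coe_smul,
      Im.coe_zero, Quaternion.imI_add, Quaternion.imJ_add, Quaternion.imK_add, Quaternion.imI_sub,
      Quaternion.imJ_sub, Quaternion.imK_sub, Quaternion.imI_smul, Quaternion.imJ_smul,
      Quaternion.imK_smul, Quaternion.imI_zero, Quaternion.imJ_zero, Quaternion.imK_zero,
          smul_eq_mul,
      hJ, brL_apply, cross_imI, cross_imJ, cross_imK, Im.inner_eq, unitI_imI, unitI_imJ, unitI_imK]
    ring
  have m3 : (N.2 : ℍ[ℝ]).imK = -(c.σ s * deriv c.k₁ s - s * c.k₁ s * c.k₂ s + 2 * s * c.k₁ s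
      * c.j₃ s)
      * ((y : ℍ[ℝ]).imK * (z : ℍ[ℝ]).imI - (y : ℍ[ℝ]).imI * (z : ℍ[ℝ]).imK) := by
    rw [hN']
    simp only [Prod.fst_add, Prod.snd_add, Prod.fst_sub, Prod.snd_sub, Im.coe_add, Im.coe_sub,
        Im.coe_smul,
      Im.coe_zero, Quaternion.imI_add, Quaternion.imJ_add, Quaternion.imK_add, Quaternion.imI_sub,
      Quaternion.imJ_sub, Quaternion.imK_sub, Quaternion.imI_smul, Quaternion.imJ_smul,
      Quaternion.imK_smul, Quaternion.imI_zero, Quaternion.imJ_zero, Quaternion.imK_zero,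
          smul_eq_mul,
      hJ, brL_apply, cross_imI, cross_imJ, cross_imK, Im.inner_eq, unitI_imI, unitI_imJ, unitI_imK]
    ring
  rw [← hN, n1, n2, n3, m1, m2, m3]
  simp only [Im.coe_zero, Quaternion.imI_zero, Quaternion.imJ_zero, Quaternion.imK_zero]
  linear_combination ((y : ℍ[ℝ]).imJ * (z : ℍ[ℝ]).imK - (y : ℍ[ℝ]).imK * (z : ℍ[ℝ]).imJ)
      * (X.2 : ℍ[ℝ]).imI * ht.nijenhuis_radial
    + (((y : ℍ[ℝ]).imI * (z : ℍ[ℝ]).imJ - (y : ℍ[ℝ]).imJ * (z : ℍ[ℝ]).imI) * (X.2 : ℍ[ℝ]).imK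
      + ((y : ℍ[ℝ]).imK * (z : ℍ[ℝ]).imI - (y : ℍ[ℝ]).imI * (z : ℍ[ℝ]).imK) * (X.2 : ℍ[ℝ]).imJ)
        * ht.nijenhuis_y
    + (((y : ℍ[ℝ]).imK * (z : ℍ[ℝ]).imI - (y : ℍ[ℝ]).imI * (z : ℍ[ℝ]).imK) * (X.1 : ℍ[ℝ]).imK
      - ((y : ℍ[ℝ]).imI * (z : ℍ[ℝ]).imJ - (y : ℍ[ℝ]).imJ * (z : ℍ[ℝ]).imI) * (X.1 : ℍ[ℝ]).imJ)
        * ht.nijenhuis_x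

variable {w : Im} (ht : ∀ s, |s| < η → c.TorsionAt s) (hw : ‖w‖ < η)

/-- The subspace of vectors tangent to the first factor. -/
def fstSubmodule : Submodule ℝ (Im × Im) := LinearMap.ker (LinearMap.snd ℝ Im Im)

theorem mem_fstSubmodule {X : Im × Im} : X ∈ fstSubmodule ↔ X.2 = 0 := Iff.rfl

/-- The block of J from the first factor to the second is diagonal with entries σ, k₁, k₁, hence
invertible; the first factor therefore spans over the complex numbers. -/
theorem exists_eq_add_cplx_radial (hs : 0 ≤ s) (hh : c.HermitianAt s) (hk : c.k₁ s ≠ 0)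
    (X : Im × Im) : ∃ Y ∈ fstSubmodule, ∃ Z ∈ fstSubmodule, X = Y + c.cplx (s • unitI) Z := by
  have hσ := hh.pos_σ.ne'
  obtain ⟨z, z1, z2, z3⟩ : ∃ z : Im, (z : ℍ[ℝ]).imI = (X.2 : ℍ[ℝ]).imI / c.σ s ∧ (z : ℍ[ℝ]).imJ =
      (X.2 : ℍ[ℝ]).imJ / c.k₁ s ∧
      (z : ℍ[ℝ]).imK = (X.2 : ℍ[ℝ]).imK / c.k₁ s :=
    ⟨toIm (su2Coord.symm ![(X.2 : ℍ[ℝ]).imI / c.σ s, (X.2 : ℍ[ℝ]).imJ / c.k₁ s,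
        (X.2 : ℍ[ℝ]).imK / c.k₁ s]), rfl, rfl, rfl⟩
  obtain ⟨-, -, -, a4, a5, a6⟩ := cplx_radial (c := c) hs (z, 0)
  refine ⟨X - c.cplx (s • unitI) (z, 0), ?_, (z, 0), rfl, by abel⟩
  rw [mem_fstSubmodule, Prod.snd_sub, sub_eq_zero]
  simp only [z1, z2, z3, Im.coe_zero, Quaternion.imJ_zero, Quaternion.imK_zero] at a4 a5 a6
  apply Im.ext
  · rw [a4]
    field_simp
  · rw [a5]
    field_simp
    ring
  · rw [a6]
    field_simp
    ring

theorem exists_radial_of_norm_lt (hw : ‖w‖ < η) : ∃ s, 0 ≤ s ∧ s < η ∧ ∃ b : SU2,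
    w = AdL b (s • unitI) ∧ ∀ u : Im × Im, ∃ v, u = AdL₂ b v := by
  obtain ⟨b, hb, hu⟩ := exists_radial w
  exact ⟨‖w‖, norm_nonneg w, hw, b, hb.symm, hu⟩

include ht

theorem jet_dkahler_type (X Y Z : Im × Im) :
    (c.jet η h w hw).dkahler X ((c.jet η h w hw).J Y) ((c.jet η h w hw).J Z)
      = -(c.jet η h w hw).dkahler X Y Z := by
  obtain ⟨s, hs, hsη, b, rfl, hu⟩ := exists_radial_of_norm_lt hw
  obtain ⟨X, rfl⟩ := hu X
  obtain ⟨Y, rfl⟩ := hu Y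
  obtain ⟨Z, rfl⟩ := hu Z
  change (c.jet η h _ _).dkahler _ (c.cplx _ _) (c.cplx _ _) = _
  rw [cplx_AdL, cplx_AdL, jet_dkahler_AdL h (norm_radial_lt hs hsη),
    jet_dkahler_AdL h (norm_radial_lt hs hsη)]
  exact (ht s (by rwa [abs_of_nonneg hs])).jet_dkahler_cplx h hs hsη X Y Z

theorem jet_nijenhuis_relation (X Y Z : Im × Im) :
    (c.jet η h w hw).kahler ((c.jet η h w hw).nijenhuis Y Z) X
      = 4 / 3 * (c.jet η h w hw).dkahler X Y Z := by
  obtain ⟨s, hs, hsη, b, rfl, hu⟩ := exists_radial_of_norm_lt hw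
  obtain ⟨X, rfl⟩ := hu X
  obtain ⟨Y, rfl⟩ := hu Y
  obtain ⟨Z, rfl⟩ := hu Z
  have hsη' : |s| < η := by rwa [abs_of_nonneg hs]
  rw [jet_kahler, jet_nijenhuis_AdL h (norm_radial_lt hs hsη),
    jet_dkahler_AdL h (norm_radial_lt hs hsη), form_AdL, ← jet_kahler h (norm_radial_lt hs hsη)]
  refine HermitianJet.nijenhuis_relation_of_span _ (W := fstSubmodule)
    (exists_eq_add_cplx_radial hs (h s hsη') (ht s hsη').k₁_ne_zero)
    (jet_dkahler_type h (ht := ht) (norm_radial_lt hs hsη)) ?_ X Y Z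
  rintro X ⟨y, y'⟩ hY ⟨z, z'⟩ hZ
  obtain rfl : y' = 0 := hY
  obtain rfl : z' = 0 := hZ
  exact (ht s hsη').jet_nijenhuis_eq h hs hsη X y z

theorem jet_exists_dkahler_ne_zero {X : Im × Im} (hX : X ≠ 0) :
    ∃ Y Z, (c.jet η h w hw).dkahler X Y Z ≠ 0 := by
  obtain ⟨s, hs, hsη, b, rfl, hu⟩ := exists_radial_of_norm_lt hw
  obtain ⟨X, rfl⟩ := hu X
  obtain ⟨Y, Z, hYZ⟩ := (ht s (by rwa [abs_of_nonneg hs])).exists_jet_dkahler_ne_zero h hs hsη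
    (X := X) (fun h0 => hX (by rw [h0, map_zero]))
  exact ⟨AdL₂ b Y, AdL₂ b Z, by rwa [jet_dkahler_AdL h (norm_radial_lt hs hsη)]⟩


end Coefficients

/-! ### Tensors and connections in a parallelism -/

open Bundle

section VectorValued

variable {E : Type*} [NormedAddCommGroup E] [NormedSpace ℝ E]
  {H : Type*} [TopologicalSpace H] {I : ModelWithCorners ℝ E H}
  {M : Type*} [TopologicalSpace M] [ChartedSpace H M]
  {F F' : Type*} [NormedAddCommGroup F] [NormedSpace ℝ F] [NormedAddCommGroup F'] [NormedSpace ℝ F']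

theorem mvfderiv_comp_fderiv {g : F → F'} {f : M → F} {x : M} (hg : DifferentiableAt ℝ g (f x))
    (hf : MDifferentiableAt I 𝓘(ℝ, F) f x) (v : TangentSpace I x) :
    mvfderiv I (fun y => g (f y)) x v = fderiv ℝ g (f x) (mvfderiv I f x v) := by
  have h := mfderiv_comp_apply x hg.mdifferentiableAt hf v
  rw [mfderiv_eq_fderiv] at h
  exact h

theorem mvfderiv_prodMk {f : M → F} {g : M → F'} {x : M} (hf : MDifferentiableAt I 𝓘(ℝ, F) f x)
    (hg : MDifferentiableAt I 𝓘(ℝ, F') g x) (v : TangentSpace I x) :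
    mvfderiv I (fun y => (f y, g y)) x v = (mvfderiv I f x v, mvfderiv I g x v) := by
  have h := hf.prodMk_space hg
  ext1
  · have h1 := mvfderiv_comp_fderiv (g := Prod.fst) differentiableAt_fst h v
    rw [fderiv_fst] at h1
    exact h1.symm
  · have h1 := mvfderiv_comp_fderiv (g := Prod.snd) differentiableAt_snd h v
    rw [fderiv_snd] at h1
    exact h1.symm

theorem mvfderiv_clm_apply {L : M → F →L[ℝ] F'} {f : M → F} {x : M}
    (hL : MDifferentiableAt I 𝓘(ℝ, F →L[ℝ] F') L x) (hf : MDifferentiableAt I 𝓘(ℝ, F) f x)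
    (v : TangentSpace I x) :
    mvfderiv I (fun y => L y (f y)) x v = mvfderiv I L x v (f x) + L x (mvfderiv I f x v) := by
  have h0 := (hasFDerivAt_fst (𝕜 := ℝ) (p := (L x, f x))).clm_apply
    (hasFDerivAt_snd (𝕜 := ℝ) (p := (L x, f x)))
  have h1 := mvfderiv_comp_fderiv (g := fun p : (F →L[ℝ] F') × F => p.1 p.2)
      (f := fun y => (L y, f y))
    h0.differentiableAt (hL.prodMk_space hf) v
  refine h1.trans ?_
  rw [h0.fderiv, mvfderiv_prodMk hL hf]
  simp [add_comm]

theorem mvfderiv_congr {f g : M → F} {x : M} (h : f =ᶠ[nhds x] g) :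
    mvfderiv I f x = mvfderiv I g x := by
  ext v
  simp only [mvfderiv, ContinuousLinearMap.comp_apply, h.mfderiv_eq]
  rfl

end VectorValued

section Parallelism

variable {E : Type*} [NormedAddCommGroup E] [NormedSpace ℝ E] [CompleteSpace E]
  {H : Type*} [TopologicalSpace H] (I : ModelWithCorners ℝ E H)
  (M : Type*) [TopologicalSpace M] [ChartedSpace H M] [IsManifold I ∞ M]
  (V : Type*) [NormedAddCommGroup V] [NormedSpace ℝ V]

/-- A smooth parallelism of `M`, i.e. a smooth trivialization of the tangent bundle, with constant
structure functions `br`. -/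
structure Parallelism where
  θ : ∀ x : M, TangentSpace I x ≃L[ℝ] V
  br : V →L[ℝ] V →L[ℝ] V
  smooth : ∀ x₀ : M, ContMDiffAt I 𝓘(ℝ, E →L[ℝ] V) ∞
    (fun x => (θ x : TangentSpace I x →L[ℝ] V) ∘L
      (trivializationAt E (TangentSpace I) x₀).symmL ℝ x) x₀
  bracket : ∀ (x : M) (X Y : ∀ x : M, TangentSpace I x),
    VectorFieldDiffAt I X x → VectorFieldDiffAt I Y x →
    θ x (VectorField.mlieBracket I X Y x) = mvfderiv I (fun y => θ y (Y y)) x (X x)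
      - mvfderiv I (fun y => θ y (X y)) x (Y x) + br (θ x (X x)) (θ x (Y x))

namespace Parallelism

variable {I M V} (P : Parallelism I M V)

/-- The parallelism in the trivialization of the tangent bundle at `x₀`. -/
def coord (x₀ x : M) : E →L[ℝ] V := (P.θ x : TangentSpace I x →L[ℝ] V) ∘L
  (trivializationAt E (TangentSpace I) x₀).symmL ℝ x

theorem coord_eq {x₀ x : M} (hx : x ∈ (trivializationAt E (TangentSpace I) x₀).baseSet) :
    P.coord x₀ x = (((trivializationAt E (TangentSpace I) x₀).continuousLinearEquivAt ℝ x
        hx).symm.trans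
      (P.θ x) : E ≃L[ℝ] V) := by
  ext v
  exact congrArg (P.θ x) (congrFun (Trivialization.symm_continuousLinearEquivAt_eq _ hx) v).symm

variable (I) in
theorem eventually_mem_baseSet (x₀ : M) :
    ∀ᶠ x in nhds x₀, x ∈ (trivializationAt E (TangentSpace I) x₀).baseSet :=
  (trivializationAt E (TangentSpace I) x₀).open_baseSet.mem_nhds
    (FiberBundle.mem_baseSet_trivializationAt' x₀)

theorem contMDiffAt_coord (x₀ : M) : ContMDiffAt I 𝓘(ℝ, E →L[ℝ] V) ∞ (P.coord x₀) x₀ := P.smooth x₀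

/-- Inversion of continuous linear maps is smooth at an invertible one. -/
theorem contMDiffAt_inverse_coord (x₀ : M) :
    ContMDiffAt I 𝓘(ℝ, V →L[ℝ] E) ∞ (fun x => (P.coord x₀ x).inverse) x₀ := by
  have h1 := P.coord_eq (FiberBundle.mem_baseSet_trivializationAt' x₀)
  have h2 : ContDiffAt ℝ ∞ (ContinuousLinearMap.inverse : (E →L[ℝ] V) → (V →L[ℝ] E))
      (P.coord x₀ x₀) := by
    rw [h1]
    exact contDiffAt_map_inverse _
  exact h2.contMDiffAt.comp x₀ (P.contMDiffAt_coord x₀)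

theorem coord_apply {x₀ x : M} (hx : x ∈ (trivializationAt E (TangentSpace I) x₀).baseSet)
    (v : TangentSpace I x) :
    P.coord x₀ x (trivializationAt E (TangentSpace I) x₀ ⟨x, v⟩).2 = P.θ x v := by
  have h1 := (trivializationAt E (TangentSpace I) x₀).symmL_continuousLinearMapAt (R := ℝ) hx v
  rw [Trivialization.continuousLinearMapAt_apply_of_mem _ _ hx] at h1
  exact congrArg (P.θ x) h1

theorem inverse_coord_apply {x₀ x : M} (hx : x ∈ (trivializationAt E (TangentSpace I) x₀).baseSet)
    (v : V) : (P.coord x₀ x).inverse v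
      = (trivializationAt E (TangentSpace I) x₀ ⟨x, (P.θ x).symm v⟩).2 := by
  rw [P.coord_eq hx, ContinuousLinearMap.inverse_equiv]
  rfl

/-- The parallelism and its inverse depend smoothly on the point in the bundle trivialization, so
applying either preserves differentiability. -/
theorem vectorFieldDiffAt_iff {X : ∀ x : M, TangentSpace I x} {x₀ : M} :
    VectorFieldDiffAt I X x₀ ↔ MDifferentiableAt I 𝓘(ℝ, V) (fun x => P.θ x (X x)) x₀ := by
  have h0 : VectorFieldDiffAt I X x₀ ↔ MDifferentiableAt I 𝓘(ℝ, E)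
      (fun x => (trivializationAt E (TangentSpace I) x₀ ⟨x, X x⟩).2) x₀ := by
    refine (mdifferentiableAt_totalSpace (IB := I) (E := (TangentSpace I : M → Type _))
      (fun y => (⟨y, X y⟩ : TangentBundle I M))).trans ?_
    exact and_iff_right mdifferentiableAt_id
  rw [h0]
  constructor
  · intro h
    have h1 := ((P.contMDiffAt_coord x₀).mdifferentiableAt (by simp)).clm_apply h
    refine h1.congr_of_eventuallyEq ?_
    filter_upwards [eventually_mem_baseSet I x₀] with x hx
    exact (P.coord_apply hx _).symm
  · intro h
    have h1 := ((P.contMDiffAt_inverse_coord x₀).mdifferentiableAt (by simp)).clm_apply h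
    refine h1.congr_of_eventuallyEq ?_
    filter_upwards [eventually_mem_baseSet I x₀] with x hx
    rw [P.inverse_coord_apply hx, ContinuousLinearEquiv.symm_apply_apply]

/-- The bilinear form which is `G x` in the parallelism. -/
def bilin (G : M → V →L[ℝ] V →L[ℝ] ℝ) (x : M) : TangentSpace I x →L[ℝ] TangentSpace I x →L[ℝ] ℝ :=
  show E →L[ℝ] E →L[ℝ] ℝ from (G x).bilinearComp (P.θ x : TangentSpace I x →L[ℝ] V)
    (P.θ x : TangentSpace I x →L[ℝ] V)

theorem bilin_apply (G : M → V →L[ℝ] V →L[ℝ] ℝ) (x : M) (v w : TangentSpace I x) :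
    P.bilin G x v w = G x (P.θ x v) (P.θ x w) := rfl

/-- The endomorphism which is `J x` in the parallelism. -/
def endo (J : M → V →L[ℝ] V) (x : M) : TangentSpace I x →L[ℝ] TangentSpace I x :=
  ((P.θ x).symm : V →L[ℝ] TangentSpace I x) ∘L J x ∘L (P.θ x : TangentSpace I x →L[ℝ] V)

theorem θ_endo (J : M → V →L[ℝ] V) (x : M) (v : TangentSpace I x) :
    P.θ x (P.endo J x v) = J x (P.θ x v) :=
  (P.θ x).apply_symm_apply _

theorem contMDiffAt_endo {J : M → V →L[ℝ] V} {x₀ : M}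
    (hJ : ContMDiffAt I 𝓘(ℝ, V →L[ℝ] V) ∞ J x₀) :
    ContMDiffAt I (I.prod 𝓘(ℝ, E →L[ℝ] E)) ∞
    (fun x => Bundle.TotalSpace.mk' (E →L[ℝ] E)
      (E := fun x : M => TangentSpace I x →L[ℝ] TangentSpace I x) x (P.endo J x)) x₀ := by
  refine (contMDiffAt_hom_bundle _).2 ⟨contMDiffAt_id, ?_⟩
  have h1 := (P.contMDiffAt_inverse_coord x₀).clm_comp (hJ.clm_comp (P.contMDiffAt_coord x₀))
  refine h1.congr_of_eventuallyEq ?_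
  filter_upwards [eventually_mem_baseSet I x₀] with x hx
  ext v
  rw [ContinuousLinearMap.comp_apply, P.inverse_coord_apply hx]
  simp only [ContinuousLinearMap.inCoordinates, ContinuousLinearMap.comp_apply]
  rw [Trivialization.continuousLinearMapAt_apply_of_mem _ _ hx]
  rfl

theorem contMDiffAt_bilin {G : M → V →L[ℝ] V →L[ℝ] ℝ} {x₀ : M}
    (hG : ContMDiffAt I 𝓘(ℝ, V →L[ℝ] V →L[ℝ] ℝ) ∞ G x₀) :
    ContMDiffAt I (I.prod 𝓘(ℝ, E →L[ℝ] E →L[ℝ] ℝ)) ∞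
    (fun x => Bundle.TotalSpace.mk' (E →L[ℝ] E →L[ℝ] ℝ)
      (E := fun x : M => TangentSpace I x →L[ℝ] TangentSpace I x →L[ℝ] ℝ) x (P.bilin G x)) x₀ := by
  refine (contMDiffAt_hom_bundle _).2 ⟨contMDiffAt_id, ?_⟩
  have h1 : ContMDiffAt I 𝓘(ℝ, E →L[ℝ] E →L[ℝ] ℝ) ∞
      (fun x => (G x).bilinearComp (P.coord x₀ x) (P.coord x₀ x)) x₀ := by
    -- The two arguments are precomposed one at a time, with a flip in between, so that only
    -- smoothness of composition is used.
    have h2 := hG.clm_comp (P.contMDiffAt_coord x₀)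
    have h3 := ((ContinuousLinearMap.flipₗᵢ ℝ E V ℝ).toContinuousLinearEquiv :
      (E →L[ℝ] V →L[ℝ] ℝ) →L[ℝ] (V →L[ℝ] E →L[ℝ] ℝ)).contMDiff.contMDiffAt.comp x₀ h2
    have h4 := h3.clm_comp (P.contMDiffAt_coord x₀)
    exact ((ContinuousLinearMap.flipₗᵢ ℝ E E ℝ).toContinuousLinearEquiv :
      (E →L[ℝ] E →L[ℝ] ℝ) →L[ℝ] (E →L[ℝ] E →L[ℝ] ℝ)).contMDiff.contMDiffAt.comp x₀ h4
  refine h1.congr_of_eventuallyEq ?_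
  filter_upwards [eventually_mem_baseSet I x₀] with x hx
  ext v w
  refine (inCoordinates_apply_eq₂ (F₃ := ℝ) (E₃ := Bundle.Trivial M ℝ) hx hx (mem_univ _)).trans ?_
  rw [Trivialization.linearMapAt_apply]
  have e : ∀ v, P.coord x₀ x v
      = P.θ x ((trivializationAt E (TangentSpace I) x₀).symm x v) := fun v =>
    congrArg (P.θ x) (Trivialization.symmL_apply _ hx v)
  simp only [ContinuousLinearMap.bilinearComp_apply, e]
  simp
  rfl

theorem exists_vectorField (x : M) (v : V) :
    ∃ X : ∀ x : M, TangentSpace I x, VectorFieldDiffAt I X x ∧ P.θ x (X x) = v := by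
  refine ⟨fun y => (P.θ y).symm v, P.vectorFieldDiffAt_iff.2 ?_, (P.θ x).apply_symm_apply v⟩
  simp only [ContinuousLinearEquiv.apply_symm_apply]
  exact mdifferentiableAt_const

variable [FiniteDimensional ℝ V]

/-- The covariant derivative with Christoffel tensor `Γ` in the parallelism. -/
def cov (Γ : M → V →ₗ[ℝ] V →ₗ[ℝ] V) (Y : ∀ x : M, TangentSpace I x) (x : M) :
    TangentSpace I x →L[ℝ] TangentSpace I x :=
  ((P.θ x).symm : V →L[ℝ] TangentSpace I x) ∘L (mvfderiv I (fun y => P.θ y (Y y)) x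
    + LinearMap.toContinuousLinearMap ((Γ x).flip (P.θ x (Y x))) ∘L
      (P.θ x : TangentSpace I x →L[ℝ] V))

theorem θ_cov (Γ : M → V →ₗ[ℝ] V →ₗ[ℝ] V) (Y : ∀ x : M, TangentSpace I x) (x : M)
    (v : TangentSpace I x) : P.θ x (P.cov Γ Y x v) =
      mvfderiv I (fun y => P.θ y (Y y)) x v + Γ x (P.θ x v) (P.θ x (Y x)) :=
  (P.θ x).apply_symm_apply _

theorem isCovariantDerivativeOn_cov (Γ : M → V →ₗ[ℝ] V →ₗ[ℝ] V) (U : Set M) :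
    IsCovariantDerivativeOn E (P.cov Γ) U where
  add {X Y x} hX hY _ := by
    have h1 := P.vectorFieldDiffAt_iff.1 hX
    have h2 := P.vectorFieldDiffAt_iff.1 hY
    ext v
    apply (P.θ x).injective
    rw [add_apply, map_add, θ_cov, θ_cov, θ_cov]
    simp only [Pi.add_apply, map_add]
    have h3 := mvfderiv_add h1 h2
    have h4 := congrArg (fun L => L v) h3
    refine (congrArg (· + _) h4).trans ?_
    simp only [add_apply]
    abel
  leibniz {X f x} hX hf _ := by
    have h1 := P.vectorFieldDiffAt_iff.1 hX
    ext v
    apply (P.θ x).injective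
    rw [add_apply, map_add, θ_cov, smul_apply, map_smul, θ_cov]
    have h4 := congrArg (fun L => L v) (mvfderiv_smul hf h1)
    have h5 : (fun y => P.θ y ((f • X) y)) = f • fun y => P.θ y (X y) := by
      funext y
      exact map_smul (P.θ y) (f y) (X y)
    rw [h5]
    refine (congrArg (· + _) h4).trans ?_
    simp
    abel

/-- A structure whose jets in a parallelism satisfy the nearly Kähler conditions is a strict nearly
Kähler structure. -/
theorem isStrictNearlyKahlerOn {G : M → V →L[ℝ] V →L[ℝ] ℝ} {J : M → V →L[ℝ] V} {U : Set M}
    (hG : ∀ x ∈ U, ContMDiffAt I 𝓘(ℝ, V →L[ℝ] V →L[ℝ] ℝ) ∞ G x)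
    (hJ : ∀ x ∈ U, ContMDiffAt I 𝓘(ℝ, V →L[ℝ] V) ∞ J x)
    (jet : ∀ x ∈ U, HermitianJet V) (hg : ∀ x hx, (jet x hx).g = G x)
    (hj : ∀ x hx, (jet x hx).J = J x)
    (hDg : ∀ x hx v, (jet x hx).Dg (P.θ x v) = mvfderiv I G x v)
    (hDJ : ∀ x hx v, (jet x hx).DJ (P.θ x v) = mvfderiv I J x v)
    (hbr : ∀ x hx, (jet x hx).br = P.br)
    (htype : ∀ x hx X Y Z, (jet x hx).dkahler X ((jet x hx).J Y) ((jet x hx).J Z)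
      = -(jet x hx).dkahler X Y Z)
    (hnij : ∀ x hx X Y Z, (jet x hx).kahler ((jet x hx).nijenhuis Y Z) X
      = 4 / 3 * (jet x hx).dkahler X Y Z)
    (hne : ∀ x hx X, X ≠ 0 → ∃ Y Z, (jet x hx).dkahler X Y Z ≠ 0) :
    IsStrictNearlyKahlerOn I (P.bilin G) (P.endo J) U := by
  -- The Christoffel tensor is chosen independently at each point, and is 0 off U. The axioms to be
  -- verified involve Γ only pointwise, so no regularity in x is required.
  have hΓ : ∀ x, ∃ Γ : V →ₗ[ℝ] V →ₗ[ℝ] V, ∀ hx : x ∈ U, (jet x hx).IsLeviCivita Γ := by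
    intro x
    by_cases hx : x ∈ U
    · obtain ⟨Γ, h⟩ := (jet x hx).exists_isLeviCivita
      exact ⟨Γ, fun _ => h⟩
    · exact ⟨0, fun h => absurd h hx⟩
  choose Γ hΓ using hΓ
  have hcovJ : ∀ x (hx : x ∈ U) (Y : ∀ x : M, TangentSpace I x) (v : TangentSpace I x),
      VectorFieldDiffAt I Y x →
      P.θ x (covJ I (P.cov Γ) (P.endo J) Y x v) = (jet x hx).nablaJ (Γ x) (P.θ x v) (P.θ x (Y x)) :=
          by
    intro x hx Y v hY
    have h1 := mvfderiv_clm_apply ((hJ x hx).mdifferentiableAt (by simp))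
      (P.vectorFieldDiffAt_iff.1 hY) v
    rw [covJ, map_sub, θ_cov, θ_endo, θ_endo, θ_cov]
    simp only [θ_endo]
    rw [h1, HermitianJet.nablaJ, hDJ, hj, map_add]
    abel
  refine ⟨⟨?_, ?_, ?_⟩, ⟨?_, ?_⟩, ?_, P.cov Γ, ⟨P.isCovariantDerivativeOn_cov Γ U, ?_, ?_⟩, ?_, ?_⟩
  · intro x hx v w
    rw [bilin_apply, bilin_apply, ← hg x hx, (jet x hx).g_symm]
  · intro x hx v hv
    rw [bilin_apply, ← hg x hx]
    exact (jet x hx).g_pos _ (by simpa using hv)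
  · exact fun x hx => (P.contMDiffAt_bilin (hG x hx)).contMDiffWithinAt
  · intro x hx v
    apply (P.θ x).injective
    rw [θ_endo, θ_endo, ← hj x hx, (jet x hx).J_sq, map_neg]
  · exact fun x hx => (P.contMDiffAt_endo (hJ x hx)).contMDiffWithinAt
  · intro x hx v w
    rw [bilin_apply, bilin_apply, θ_endo, θ_endo, ← hg x hx, ← hj x hx, (jet x hx).g_J]
  · intro x hx v Y Z hY hZ
    have hY' := P.vectorFieldDiffAt_iff.1 hY
    have hZ' := P.vectorFieldDiffAt_iff.1 hZ
    have hG' := (hG x hx).mdifferentiableAt (by simp)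
    have h1 := mvfderiv_clm_apply (hG'.clm_apply hY') hZ' v
    rw [mvfderiv_clm_apply hG' hY' v] at h1
    have h2 := (hΓ x hx).metric (P.θ x v) (P.θ x (Y x)) (P.θ x (Z x))
    rw [hDg, hg] at h2
    simp only [bilin_apply, θ_cov]
    refine h1.trans ?_
    simp only [map_add, add_apply]
    linear_combination h2
  · intro x hx X Y hX hY
    apply (P.θ x).injective
    have h2 := (hΓ x hx).torsionFree (P.θ x (X x)) (P.θ x (Y x))
    rw [P.bracket x X Y hX hY, ← hbr x hx, ← h2, map_sub, θ_cov, θ_cov]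
    abel
  · intro x hx X hX
    apply (P.θ x).injective
    rw [hcovJ x hx X _ hX, (jet x hx).nablaJ_self (hΓ x hx) (htype x hx) (hnij x hx), map_zero]
  · intro x hx v hv
    obtain ⟨Y, Z, hYZ⟩ := hne x hx (P.θ x v) (by simpa using hv)
    obtain ⟨Y', hY', rfl⟩ := P.exists_vectorField x Y
    refine ⟨Y', hY', fun h0 => hYZ ?_⟩
    have h1 := (jet x hx).g_nablaJ_eq (hΓ x hx) (htype x hx) (hnij x hx) (P.θ x v) (P.θ x (Y' x)) Z
    rw [← hcovJ x hx Y' v hY', h0, map_zero, map_zero, zero_apply] at h1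
    linarith

end Parallelism

end Parallelism

/-! ### The Lie bracket acting on vector-valued functions -/

section Bracket

variable {E : Type*} [NormedAddCommGroup E] [NormedSpace ℝ E] [CompleteSpace E]
  {H : Type*} [TopologicalSpace H] {I : ModelWithCorners ℝ E H} [I.Boundaryless]
  {M : Type*} [TopologicalSpace M] [ChartedSpace H M] [IsManifold I ∞ M]
  {F : Type*} [NormedAddCommGroup F] [NormedSpace ℝ F]

theorem fderiv_comp_extChartAt_symm {h : M → F} {x : M} {z : E} (hz : z ∈ (extChartAt I x).target)
    (hh : MDifferentiableAt I 𝓘(ℝ, F) h ((extChartAt I x).symm z)) (X : ∀ x : M, TangentSpace I x) :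
    fderiv ℝ (h ∘ (extChartAt I x).symm) z
      (VectorField.mpullbackWithin 𝓘(ℝ, E) I (extChartAt I x).symm X (range I) z)
    = mvfderiv I h ((extChartAt I x).symm z) (X ((extChartAt I x).symm z)) := by
  have hinv := isInvertible_mfderivWithin_extChartAt_symm (I := I) hz
  have hd : MDifferentiableWithinAt 𝓘(ℝ, E) I (extChartAt I x).symm (range I) z :=
    ((contMDiffOn_extChartAt_symm (I := I) (n := ∞) x z hz).mdifferentiableWithinAt
      (by simp)).mono_of_mem_nhdsWithin (extChartAt_target_mem_nhdsWithin_of_mem hz)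
  have hcomp := mfderiv_comp_mfderivWithin z hh hd
    (I.uniqueMDiffOn z (extChartAt_target_subset_range x hz))
  obtain ⟨e, he⟩ := hinv
  have h1 : mfderivWithin 𝓘(ℝ, E) I (extChartAt I x).symm (range I) z
      (VectorField.mpullbackWithin 𝓘(ℝ, E) I (extChartAt I x).symm X (range I) z)
      = X ((extChartAt I x).symm z) := by
    rw [VectorField.mpullbackWithin_apply, ← he, ContinuousLinearMap.inverse_equiv]
    exact e.apply_symm_apply _
  have h2 := congrArg (fun L => L (VectorField.mpullbackWithin 𝓘(ℝ, E) I (extChartAt I x).symm X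
    (range I) z)) hcomp
  refine Eq.trans ?_ (h2.trans (congrArg _ h1))
  rw [I.range_eq_univ, mfderivWithin_univ, mfderiv_eq_fderiv]
  rfl

/-- In the chart at x this is the symmetry of the second derivative of f. Every iterated derivative
is pulled back to the chart, where the vector-space statement applies, and then pushed forward. -/
theorem mvfderiv_mlieBracket {f : M → F} {x : M} (hf : ContMDiff I 𝓘(ℝ, F) ∞ f)
    {X Y : ∀ x : M, TangentSpace I x} (hX : VectorFieldDiffAt I X x) (hY : VectorFieldDiffAt I Y x)
    (hfX : MDifferentiableAt I 𝓘(ℝ, F) (fun y => mvfderiv I f y (X y)) x)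
    (hfY : MDifferentiableAt I 𝓘(ℝ, F) (fun y => mvfderiv I f y (Y y)) x) :
    mvfderiv I f x (VectorField.mlieBracket I X Y x) =
      mvfderiv I (fun y => mvfderiv I f y (Y y)) x (X x)
      - mvfderiv I (fun y => mvfderiv I f y (X y)) x (Y x) := by
  have hr : range I = univ := I.range_eq_univ
  have : IsManifold I 2 M := IsManifold.of_le (n := ∞) (by norm_cast)
  have dX := MDifferentiableWithinAt.differentiableWithinAt_mpullbackWithin_vectorField
    (s := univ) (V := X) (x := x) (mdifferentiableWithinAt_univ.2 hX)
  have dY := MDifferentiableWithinAt.differentiableWithinAt_mpullbackWithin_vectorField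
    (s := univ) (V := Y) (x := x) (mdifferentiableWithinAt_univ.2 hY)
  simp only [preimage_univ, hr, inter_univ] at dX dY
  replace dX := differentiableWithinAt_univ.1 dX
  replace dY := differentiableWithinAt_univ.1 dY
  have hx0 : (extChartAt I x).symm (extChartAt I x x) = x := extChartAt_to_inv x
  have hd : ∀ y, MDifferentiableAt I 𝓘(ℝ, F) f y := fun y => (hf y).mdifferentiableAt (by simp)
  have hf' : ContDiffAt ℝ ∞ (f ∘ (extChartAt I x).symm) (extChartAt I x x) := by
    have := (contMDiffAt_iff.1 (hf x)).2
    rw [hr] at this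
    exact contDiffWithinAt_univ.1 this
  have key : ∀ (X Y : ∀ x : M, TangentSpace I x),
      MDifferentiableAt I 𝓘(ℝ, F) (fun y => mvfderiv I f y (Y y)) x →
      fderiv ℝ (fun z => fderiv ℝ (f ∘ (extChartAt I x).symm) z
        (VectorField.mpullbackWithin 𝓘(ℝ, E) I (extChartAt I x).symm Y (range I) z))
        (extChartAt I x x)
        (VectorField.mpullbackWithin 𝓘(ℝ, E) I (extChartAt I x).symm X (range I) (extChartAt I x x))
      = mvfderiv I (fun y => mvfderiv I f y (Y y)) x (X x) := by
    intro X Y hY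
    have h1 : (fun z => fderiv ℝ (f ∘ (extChartAt I x).symm) z
        (VectorField.mpullbackWithin 𝓘(ℝ, E) I (extChartAt I x).symm Y (range I) z))
        =ᶠ[nhds (extChartAt I x x)]
        (fun y => mvfderiv I f y (Y y)) ∘ (extChartAt I x).symm := by
      filter_upwards [extChartAt_target_mem_nhds (I := I) x] with z hz
      exact fderiv_comp_extChartAt_symm hz (hd _) Y
    rw [h1.fderiv_eq]
    have h2 := fderiv_comp_extChartAt_symm (h := fun y => mvfderiv I f y (Y y))
      (mem_extChartAt_target x) (by rwa [hx0]) X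
    rw [hx0] at h2
    exact h2
  simp only [hr] at key
  have hbr := VectorField.fderiv_apply_lieBracket hf'
    (by rw [minSmoothness_of_isRCLikeNormedField]; norm_cast) dY dX
  rw [key X Y hfY, key Y X hfX] at hbr
  obtain ⟨e, he⟩ := isInvertible_mfderiv_extChartAt (I := I) (mem_extChartAt_source x)
  have hev : f =ᶠ[nhds x] (f ∘ (extChartAt I x).symm) ∘ extChartAt I x := by
    filter_upwards [extChartAt_source_mem_nhds (I := I) x] with y hy
    exact congrArg f ((extChartAt I x).left_inv hy).symm
  have hb : ∀ b : E, mvfderiv I f x ((mfderiv I 𝓘(ℝ, E) (extChartAt I x) x).inverse b)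
      = fderiv ℝ (f ∘ (extChartAt I x).symm) (extChartAt I x x) b := by
    intro b
    rw [← he, ContinuousLinearMap.inverse_equiv]
    have hc := mfderiv_comp_apply x
      ((hf'.differentiableAt (by simp)).mdifferentiableAt) (mdifferentiableAt_extChartAt
        (mem_chart_source H x)) (e.symm b)
    rw [mvfderiv_congr hev]
    refine Eq.trans hc ?_
    rw [mfderiv_eq_fderiv, ← he]
    exact congrArg _ (e.apply_symm_apply b)
  rw [← hbr, ← VectorField.mlieBracketWithin_univ, VectorField.mlieBracketWithin_apply]
  simp only [hr, preimage_univ, inter_univ]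
  exact (hb _).trans (congrArg _ (congrFun VectorField.lieBracketWithin_univ _))

end Bracket

section TangentMap

variable {E : Type*} [NormedAddCommGroup E] [NormedSpace ℝ E]
  {H : Type*} [TopologicalSpace H] {I : ModelWithCorners ℝ E H}
  {M : Type*} [TopologicalSpace M] [ChartedSpace H M] [IsManifold I ∞ M]
  {F : Type*} [NormedAddCommGroup F] [NormedSpace ℝ F]

theorem contMDiffAt_mvfderiv_comp_symmL {f : M → F} {x₀ : M} (hf : ContMDiff I 𝓘(ℝ, F) ∞ f) :
    ContMDiffAt I 𝓘(ℝ, E →L[ℝ] F) ∞ (fun x => (mvfderiv I f x : TangentSpace I x →L[ℝ] F) ∘L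
      (trivializationAt E (TangentSpace I) x₀).symmL ℝ x) x₀ := by
  have h := (hf x₀).mfderiv_const (m := ∞) (by simp)
  refine h.congr_of_eventuallyEq (Filter.Eventually.of_forall fun x => ?_)
  ext v
  simp only [inTangentCoordinates, ContinuousLinearMap.inCoordinates]
  rw [TangentBundle.continuousLinearMapAt_model_space]
  rfl

theorem VectorFieldDiffAt.mvfderiv_apply {f : M → F} {x : M} (hf : ContMDiff I 𝓘(ℝ, F) ∞ f)
    {X : ∀ x : M, TangentSpace I x} (hX : VectorFieldDiffAt I X x) :
    MDifferentiableAt I 𝓘(ℝ, F) (fun y => mvfderiv I f y (X y)) x := by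
  have h1 := ((hf.contMDiff_tangentMap (m := 1) (by norm_cast)).mdifferentiableAt one_ne_zero).comp
      x
    hX
  have h2 := ((mdifferentiableAt_totalSpace (IB := 𝓘(ℝ, F))
      (E := (TangentSpace 𝓘(ℝ, F) : F → Type _))
      _).1 h1).2
  refine h2.congr_of_eventuallyEq (Filter.Eventually.of_forall fun y => ?_)
  simp
  rfl

end TangentMap

/-! ### The left invariant parallelism of M -/

/-- The embedding of `M = SU(2) × su(2)` into `ℍ × su(2)`. -/
def emb (p : TotSpace) : ℍ[ℝ] × Im := ((p.1 : ℍ[ℝ]), toIm p.2)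

theorem contMDiff_coe_SU2 : ContMDiff (𝓡 3) 𝓘(ℝ, ℍ[ℝ]) ∞ (fun q : SU2 => (q : ℍ[ℝ])) :=
  contMDiff_coe_sphere

theorem contMDiff_coe_fst : ContMDiff 𝓘M 𝓘(ℝ, ℍ[ℝ]) ∞ (fun p : TotSpace => (p.1 : ℍ[ℝ])) :=
  contMDiff_coe_SU2.comp contMDiff_fst

theorem contMDiff_toIm_snd : ContMDiff 𝓘M 𝓘(ℝ, Im) ∞ (fun p : TotSpace => toIm p.2) :=
  (toIm : su2 →L[ℝ] Im).contMDiff.comp contMDiff_snd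

theorem contMDiff_emb : ContMDiff 𝓘M 𝓘(ℝ, ℍ[ℝ] × Im) ∞ emb :=
  contMDiff_coe_fst.prodMk_space contMDiff_toIm_snd

theorem mvfderiv_emb (p : TotSpace) (v : TangentSpace 𝓘M p) :
    mvfderiv 𝓘M emb p v = (mvfderiv (𝓡 3) (fun q : SU2 => (q : ℍ[ℝ])) p.1 v.1, toIm v.2) := by
  have h1 := mvfderiv_prodMk ((contMDiff_coe_fst p).mdifferentiableAt (by simp))
    ((contMDiff_toIm_snd p).mdifferentiableAt (by simp)) v
  refine Eq.trans h1 ?_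
  ext1
  · have := mfderiv_comp_apply p ((contMDiff_coe_SU2 p.1).mdifferentiableAt (by simp))
      (mdifferentiableAt_fst (I := 𝓡 3) (I' := 𝓘(ℝ, su2))) v
    refine Eq.trans this ?_
    rw [mfderiv_fst]
    rfl
  · have := mvfderiv_comp_fderiv (g := toIm) (toIm : su2 →L[ℝ] Im).differentiableAt
      (mdifferentiableAt_snd (I := 𝓡 3) (I' := 𝓘(ℝ, su2)) (x := p)) v
    refine Eq.trans this ?_
    rw [ContinuousLinearEquiv.fderiv]
    refine congrArg toIm ?_
    have h2 := mfderiv_snd (I := 𝓡 3) (I' := 𝓘(ℝ, su2)) (x := p)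
    exact congrArg (fun L => L v) h2

theorem mvfderiv_emb_injective (p : TotSpace) : Function.Injective (mvfderiv 𝓘M emb p) := by
  intro v w h
  rw [mvfderiv_emb, mvfderiv_emb] at h
  have h1 := injective_mvfderiv_subtypeVal_sphere (n := 3) p.1 (congrArg Prod.fst h)
  have h2 := toIm.injective (congrArg Prod.snd h)
  exact Prod.ext h1 h2

theorem coe_inv_eq_star (b : SU2) : ((b⁻¹ : SU2) : ℍ[ℝ]) = star (b : ℍ[ℝ]) := by
  have h2 : star (b : ℍ[ℝ]) * (b : ℍ[ℝ]) = 1 := by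
    rw [Quaternion.star_mul_self, Quaternion.normSq_eq_norm_mul_self, norm_eq_of_mem_sphere]
    simp
  calc ((b⁻¹ : SU2) : ℍ[ℝ]) = (star (b : ℍ[ℝ]) * (b : ℍ[ℝ])) * ((b⁻¹ : SU2) : ℍ[ℝ]) := by
        rw [h2, one_mul]
    _ = star (b : ℍ[ℝ]) := by rw [mul_assoc, coe_mul_inv_self, mul_one]

theorem star_coe_mul_self (b : SU2) : star (b : ℍ[ℝ]) * (b : ℍ[ℝ]) = 1 := by
  rw [← coe_inv_eq_star, coe_inv_mul_self]

theorem coe_mul_star_self (b : SU2) : (b : ℍ[ℝ]) * star (b : ℍ[ℝ]) = 1 := by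
  rw [← coe_inv_eq_star, coe_mul_inv_self]

/-- The imaginary part of a quaternion. -/
def imPart : ℍ[ℝ] →L[ℝ] Im := LinearMap.toContinuousLinearMap
  { toFun := fun h => toIm ⟨h.im, Quaternion.re_im h⟩
    map_add' := fun x y => by
      apply Im.coe_injective
      simp
    map_smul' := fun c x => by
      apply Im.coe_injective
      simp }

theorem coe_imPart (h : ℍ[ℝ]) : (imPart h : ℍ[ℝ]) = h.im := rfl

theorem coe_imPart_of_re {h : ℍ[ℝ]} (hre : h.re = 0) : (imPart h : ℍ[ℝ]) = h := by
  rw [coe_imPart]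
  apply Quaternion.ext <;> simp [hre]

theorem imPart_coe (x : Im) : imPart (x : ℍ[ℝ]) = x :=
  Im.coe_injective (coe_imPart_of_re x.re)

/-- Left translation of imaginary quaternions, with values in `ℍ × su(2)`. -/
def leftTransl : ℍ[ℝ] →L[ℝ] (Im × Im) →L[ℝ] ℍ[ℝ] × Im :=
  continuousBilin <| LinearMap.mk₂ ℝ (fun q u => (q * (u.1 : ℍ[ℝ]), (0 : Im)))
  (fun x x' y => by simp [add_mul]) (fun c x y => by simp)
  (fun x y y' => by simp [mul_add]) (fun c x y => by simp)

theorem leftTransl_apply (q : ℍ[ℝ]) (u : Im × Im) : leftTransl q u = (q * (u.1 : ℍ[ℝ]), 0) := rfl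

/-- The differential of `emb` in the left invariant frame. -/
def unframe (q : ℍ[ℝ]) : (Im × Im) →L[ℝ] ℍ[ℝ] × Im :=
  leftTransl q + (0 : Im × Im →L[ℝ] ℍ[ℝ]).prod (ContinuousLinearMap.snd ℝ Im Im)

theorem unframe_apply (q : ℍ[ℝ]) (u : Im × Im) : unframe q u = (q * (u.1 : ℍ[ℝ]), u.2) := by
  simp [unframe, leftTransl_apply]

/-- The projection of `ℍ × su(2)` onto the tangent space in the left invariant frame. -/
def toFrame (q : ℍ[ℝ]) : (ℍ[ℝ] × Im) →L[ℝ] Im × Im :=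
  (imPart ∘L ContinuousLinearMap.mul ℝ ℍ[ℝ] (star q)).prodMap (ContinuousLinearMap.id ℝ Im)

theorem toFrame_apply (q : ℍ[ℝ]) (u : ℍ[ℝ] × Im) : toFrame q u = (imPart (star q * u.1), u.2) := rfl

theorem toFrame_unframe (q : SU2) (u : Im × Im) : toFrame q (unframe q u) = u := by
  rw [toFrame_apply, unframe_apply]
  simp only
  rw [← mul_assoc, star_coe_mul_self, one_mul, imPart_coe]

theorem unframe_toFrame (q : SU2) {u : ℍ[ℝ] × Im} (hu : (star (q : ℍ[ℝ]) * u.1).re = 0) :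
    unframe q (toFrame q u) = u := by
  rw [toFrame_apply, unframe_apply]
  simp only
  rw [coe_imPart_of_re hu, ← mul_assoc, coe_mul_star_self, one_mul]

theorem contDiff_toFrame : ContDiff ℝ ∞ toFrame := by
  have h1 : ContDiff ℝ ∞ (fun q : ℍ[ℝ] => star q) := (LinearMap.toContinuousLinearMap
    { toFun := fun q : ℍ[ℝ] => star q, map_add' := star_add, map_smul' := fun c q => by
        simp }).contDiff
  have h2 : ContDiff ℝ ∞ (fun q : ℍ[ℝ] => (imPart ∘L ContinuousLinearMap.mul ℝ ℍ[ℝ] (star q))) :=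
    contDiff_const.clm_comp ((ContinuousLinearMap.mul ℝ ℍ[ℝ]).contDiff.comp h1)
  have h3 : ContDiff ℝ ∞ (fun q : ℍ[ℝ] => (imPart ∘L ContinuousLinearMap.mul ℝ ℍ[ℝ] (star q)) ∘L
    ContinuousLinearMap.fst ℝ ℍ[ℝ] Im) := h2.clm_comp contDiff_const
  have h4 : ContDiff ℝ ∞ (fun q : ℍ[ℝ] => ContinuousLinearMap.inl ℝ Im Im ∘L
    ((imPart ∘L ContinuousLinearMap.mul ℝ ℍ[ℝ] (star q)) ∘L ContinuousLinearMap.fst ℝ ℍ[ℝ] Im)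
    + ContinuousLinearMap.inr ℝ Im Im ∘L ContinuousLinearMap.snd ℝ ℍ[ℝ] Im) :=
    (contDiff_const.clm_comp h3).add contDiff_const
  convert h4 using 2 with q
  ext u <;> simp [toFrame]

/-- Differentiate ‖q‖² = 1 on the sphere. -/
theorem re_star_mul_mvfderiv (p : TotSpace) (v : TangentSpace 𝓘M p) :
    (star (p.1 : ℍ[ℝ]) * (mvfderiv 𝓘M emb p v).1).re = 0 := by
  rw [mvfderiv_emb]
  simp only
  have hd : DifferentiableAt ℝ (fun q : ℍ[ℝ] => ‖q‖ ^ 2) (p.1 : ℍ[ℝ]) :=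
    (hasStrictFDerivAt_norm_sq _).hasFDerivAt.differentiableAt
  have h1 := mvfderiv_comp_fderiv hd ((contMDiff_coe_SU2 p.1).mdifferentiableAt (by simp)) v.1
  have h2 : (fun q : SU2 => ‖(q : ℍ[ℝ])‖ ^ 2) = fun _ => (1 : ℝ) := by
    funext q
    simp [norm_eq_of_mem_sphere]
  rw [h2, (hasStrictFDerivAt_norm_sq _).hasFDerivAt.fderiv] at h1
  have h3 : mvfderiv (𝓡 3) (fun _ : SU2 => (1 : ℝ)) p.1 v.1 = 0 := by
    rw [mvfderiv_const]
    rfl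
  rw [h3] at h1
  simp [Quaternion.inner_def] at h1
  simp
  linarith

theorem unframe_toFrame_mvfderiv (p : TotSpace) (v : TangentSpace 𝓘M p) :
    unframe p.1 (toFrame p.1 (mvfderiv 𝓘M emb p v)) = mvfderiv 𝓘M emb p v :=
  unframe_toFrame _ (re_star_mul_mvfderiv p v)

/-- The left invariant frame on `M`. -/
def frameMap (p : TotSpace) : TangentSpace 𝓘M p →L[ℝ] Im × Im :=
  toFrame p.1 ∘L (mvfderiv 𝓘M emb p : TangentSpace 𝓘M p →L[ℝ] ℍ[ℝ] × Im)

theorem unframe_frameMap (p : TotSpace) (v : TangentSpace 𝓘M p) :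
    unframe p.1 (frameMap p v) = mvfderiv 𝓘M emb p v := unframe_toFrame_mvfderiv p v

theorem frameMap_injective (p : TotSpace) : Function.Injective (frameMap p) := by
  intro v w h
  apply mvfderiv_emb_injective p
  rw [← unframe_frameMap, ← unframe_frameMap, h]

instance (p : TotSpace) : FiniteDimensional ℝ (TangentSpace 𝓘M p) :=
  inferInstanceAs (FiniteDimensional ℝ (EuclideanSpace ℝ (Fin 3) × su2))

instance (p : TotSpace) : T2Space (TangentSpace 𝓘M p) :=
  inferInstanceAs (T2Space (EuclideanSpace ℝ (Fin 3) × su2))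

theorem finrank_tangentSpace (p : TotSpace) : Module.finrank ℝ (TangentSpace 𝓘M p) = 6 := by
  have h : Module.finrank ℝ su2 = 3 := Im.finrank
  have : Module.finrank ℝ (EuclideanSpace ℝ (Fin 3) × su2) = 6 := by
    rw [Module.finrank_prod, h]
    simp
  exact this

/-- The left invariant frame on `M`, as an equivalence. -/
def frameEquiv (p : TotSpace) : TangentSpace 𝓘M p ≃L[ℝ] Im × Im :=
  (LinearEquiv.ofInjectiveOfFinrankEq (frameMap p : TangentSpace 𝓘M p →ₗ[ℝ] Im × Im)
    (frameMap_injective p)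
    ((finrank_tangentSpace p).trans
        (by rw [Module.finrank_prod, Im.finrank]))).toContinuousLinearEquiv

theorem frameEquiv_apply (p : TotSpace) (v : TangentSpace 𝓘M p) :
    frameEquiv p v = frameMap p v := rfl

theorem leftTransl_bracket (q : ℍ[ℝ]) (u v : Im × Im) :
    leftTransl (leftTransl q u).1 v - leftTransl (leftTransl q v).1 u
      = unframe q (brL u v) := by
  rw [brL_apply, unframe_apply, coe_two_smul_cross]
  simp [leftTransl_apply, mul_sub, mul_assoc]

theorem mdifferentiableAt_frameMap {X : ∀ p : TotSpace, TangentSpace 𝓘M p} {p : TotSpace}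
    (hX : VectorFieldDiffAt 𝓘M X p) :
    MDifferentiableAt 𝓘M 𝓘(ℝ, Im × Im) (fun y => frameMap y (X y)) p := by
  have h1 : MDifferentiableAt 𝓘M 𝓘(ℝ, (ℍ[ℝ] × Im) →L[ℝ] Im × Im)
      (fun y : TotSpace => toFrame (y.1 : ℍ[ℝ])) p :=
    ((contDiff_toFrame.contMDiff.comp contMDiff_coe_fst) p).mdifferentiableAt (by simp)
  exact h1.clm_apply (hX.mvfderiv_apply contMDiff_emb)

/-- The first derivative of `emb` along Y is `unframe q` applied to the frame components of Y. The
product rule gives the derivative of these components plus the term q·x·y from the variation of q,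
with x, y the first components of X and Y. Antisymmetrizing the latter yields the structure
constants in `leftTransl_bracket`. -/
theorem mvfderiv_mvfderiv_emb {X Y : ∀ p : TotSpace, TangentSpace 𝓘M p} {p : TotSpace}
    (hY : VectorFieldDiffAt 𝓘M Y p) :
    mvfderiv 𝓘M (fun y => mvfderiv 𝓘M emb y (Y y)) p (X p) =
      leftTransl (leftTransl p.1 (frameMap p (X p))).1 (frameMap p (Y p))
      + unframe p.1 (mvfderiv 𝓘M (fun y => frameMap y (Y y)) p (X p)) := by
  have h0 : (fun y => mvfderiv 𝓘M emb y (Y y))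
      = fun y : TotSpace => unframe (y.1 : ℍ[ℝ]) (frameMap y (Y y)) := by
    funext y
    rw [unframe_frameMap]
  have hq : MDifferentiableAt 𝓘M 𝓘(ℝ, ℍ[ℝ]) (fun y : TotSpace => (y.1 : ℍ[ℝ])) p :=
    (contMDiff_coe_fst p).mdifferentiableAt (by simp)
  have hu : HasFDerivAt unframe leftTransl (p.1 : ℍ[ℝ]) :=
    leftTransl.hasFDerivAt.add_const _
  have h1 := mvfderiv_clm_apply (L := fun y : TotSpace => unframe (y.1 : ℍ[ℝ]))
    (hu.differentiableAt.mdifferentiableAt.comp p hq) (mdifferentiableAt_frameMap hY) (X p)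
  rw [h0]
  refine h1.trans ?_
  have h4 := mvfderiv_comp_fderiv (f := fun y : TotSpace => (y.1 : ℍ[ℝ])) hu.differentiableAt hq
      (X p)
  rw [h4, hu.fderiv]
  congr 3
  have h2 := mvfderiv_prodMk hq ((contMDiff_toIm_snd p).mdifferentiableAt (by simp)) (X p)
  have h3 := (unframe_frameMap p (X p)).trans h2
  rw [unframe_apply] at h3
  exact (congrArg Prod.fst h3).symm

theorem frameMap_mlieBracket {X Y : ∀ p : TotSpace, TangentSpace 𝓘M p} {p : TotSpace}
    (hX : VectorFieldDiffAt 𝓘M X p) (hY : VectorFieldDiffAt 𝓘M Y p) :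
    frameMap p (VectorField.mlieBracket 𝓘M X Y p) = mvfderiv 𝓘M (fun y => frameMap y (Y y)) p (X p)
      - mvfderiv 𝓘M (fun y => frameMap y (X y)) p (Y p)
      + brL (frameMap p (X p)) (frameMap p (Y p)) := by
  have h1 := mvfderiv_mlieBracket contMDiff_emb hX hY (hX.mvfderiv_apply contMDiff_emb)
    (hY.mvfderiv_apply contMDiff_emb)
  rw [mvfderiv_mvfderiv_emb hX, mvfderiv_mvfderiv_emb hY] at h1
  have h2 := congrArg (toFrame p.1) h1
  rw [add_sub_add_comm, leftTransl_bracket, map_add, map_sub, toFrame_unframe, toFrame_unframe,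
    toFrame_unframe] at h2
  exact h2.trans (add_comm _ _)

theorem contMDiffAt_frameMap_comp_symmL (p : TotSpace) :
    ContMDiffAt 𝓘M 𝓘(ℝ, (EuclideanSpace ℝ (Fin 3) × su2) →L[ℝ] Im × Im) ∞
    (fun x => (frameMap x : TangentSpace 𝓘M x →L[ℝ] Im × Im) ∘L
      (trivializationAt (EuclideanSpace ℝ (Fin 3) × su2) (TangentSpace 𝓘M) p).symmL ℝ x) p := by
  have h1 : ContMDiffAt 𝓘M 𝓘(ℝ, (ℍ[ℝ] × Im) →L[ℝ] Im × Im) ∞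
      (fun y : TotSpace => toFrame (y.1 : ℍ[ℝ])) p :=
    (contDiff_toFrame.contMDiff.comp contMDiff_coe_fst) p
  have h2 := contMDiffAt_mvfderiv_comp_symmL (x₀ := p) contMDiff_emb
  have h3 := h1.clm_comp h2
  exact h3

/-- The left invariant parallelism of `M`. -/
def leftParallelism : Parallelism 𝓘M TotSpace (Im × Im) where
  θ := frameEquiv
  br := brL
  smooth := contMDiffAt_frameMap_comp_symmL
  bracket _ _ _ hX hY := by
    have h := frameMap_mlieBracket hX hY
    simp only [frameEquiv_apply]
    exact h

/-! ### The group action in the left invariant frame -/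

theorem contMDiff_of_components {E : Type*} [NormedAddCommGroup E] [NormedSpace ℝ E]
    {H : Type*} [TopologicalSpace H] {I : ModelWithCorners ℝ E H}
    {N : Type*} [TopologicalSpace N] [ChartedSpace H N] [IsManifold I ∞ N] {f : N → TotSpace}
    (h1 : ContMDiff I 𝓘(ℝ, ℍ[ℝ]) ∞ (fun x => ((f x).1 : ℍ[ℝ])))
    (h2 : ContMDiff I 𝓘(ℝ, Im) ∞ (fun x => toIm (f x).2)) : ContMDiff I 𝓘M ∞ f := by
  have e1 : ContMDiff I (𝓡 3) ∞ (fun x => (f x).1) :=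
    h1.codRestrict_sphere (fun x => (f x).1.2)
  have e2 : ContMDiff I 𝓘(ℝ, su2) ∞ (fun x => (f x).2) :=
    (toIm.symm : Im →L[ℝ] su2).contMDiff.comp h2
  exact e1.prodMk e2

theorem contMDiff_act (a : SU2 × SU2) : ContMDiff 𝓘M 𝓘M ∞ (act a) := by
  refine contMDiff_of_components ?_ ?_
  · have h : ContDiff ℝ ∞ (fun q : ℍ[ℝ] => (a.1 : ℍ[ℝ]) * q * ((a.2⁻¹ : SU2) : ℍ[ℝ])) :=
      (contDiff_const.mul contDiff_id).mul contDiff_const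
    exact h.contMDiff.comp contMDiff_coe_fst
  · exact (AdL a.2).contMDiff.comp contMDiff_toIm_snd

/-- The linear map which induces the action of `a` on `M`. -/
def actL (a : SU2 × SU2) : (ℍ[ℝ] × Im) →L[ℝ] ℍ[ℝ] × Im :=
  (LinearMap.toContinuousLinearMap
    { toFun := fun q : ℍ[ℝ] => (a.1 : ℍ[ℝ]) * q * ((a.2⁻¹ : SU2) : ℍ[ℝ])
      map_add' := fun x y => by simp [mul_add, add_mul]
      map_smul' := fun c x => by simp }).prodMap (AdL a.2)

theorem actL_apply (a : SU2 × SU2) (u : ℍ[ℝ] × Im) :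
    actL a u = ((a.1 : ℍ[ℝ]) * u.1 * ((a.2⁻¹ : SU2) : ℍ[ℝ]), AdL a.2 u.2) := rfl

/-- The identity is a₁(qx)a₂⁻¹ = (a₁qa₂⁻¹)(a₂xa₂⁻¹): the left factor is absorbed by the base point,
and only the adjoint action of a₂ remains. -/
theorem actL_unframe (a : SU2 × SU2) (p : TotSpace) (u : Im × Im) :
    actL a (unframe p.1 u) = unframe (act a p).1 (AdL₂ a.2 u) := by
  rw [actL_apply, unframe_apply, unframe_apply, AdL₂_apply]
  ext1
  · simp only [act, coe_AdL, Metric.unitSphere.coe_mul]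
    have h := coe_inv_mul_self a.2
    simp only [mul_assoc]
    rw [← mul_assoc _ (a.2 : ℍ[ℝ]), h, one_mul]
  · rfl

theorem frameMap_act (a : SU2 × SU2) (p : TotSpace) (v : TangentSpace 𝓘M p) :
    frameMap (act a p) (mfderiv 𝓘M 𝓘M (act a) p v) = AdL₂ a.2 (frameMap p v) := by
  have h1 := mfderiv_comp_apply p ((contMDiff_emb (act a p)).mdifferentiableAt (by simp))
    ((contMDiff_act a p).mdifferentiableAt (by simp)) v
  have h2 := mvfderiv_comp_fderiv (actL a).differentiableAt
    ((contMDiff_emb p).mdifferentiableAt (by simp)) v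
  rw [(actL a).fderiv, ← unframe_frameMap, actL_unframe] at h2
  have h3 : mvfderiv 𝓘M emb (act a p) (mfderiv 𝓘M 𝓘M (act a) p v)
      = unframe (act a p).1 (AdL₂ a.2 (frameMap p v)) := Eq.trans h1.symm h2
  rw [← unframe_frameMap] at h3
  have h4 := congrArg (toFrame (act a p).1) h3
  rwa [toFrame_unframe, toFrame_unframe] at h4

theorem frameMap_snd (p : TotSpace) (v : TangentSpace 𝓘M p) :
    (frameMap p v).2 = mvfderiv 𝓘M (fun p : TotSpace => toIm p.2) p v := by
  have h2 := mvfderiv_prodMk ((contMDiff_coe_fst p).mdifferentiableAt (by simp))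
    ((contMDiff_toIm_snd p).mdifferentiableAt (by simp)) v
  have h3 := (unframe_frameMap p v).trans h2
  rw [unframe_apply] at h3
  exact congrArg Prod.snd h3

/-! ### The invariant structure on the tube -/

/-- The set of points `(q, w)` of `M` with `‖w‖ < η`. -/
def normTube (η : ℝ) : Set TotSpace := {p | ‖toIm p.2‖ < η}

theorem isOpen_normTube (η : ℝ) : IsOpen (normTube η) :=
  isOpen_lt (toIm.continuous.comp continuous_snd).norm continuous_const

namespace Coefficients

variable (c : Coefficients)

/-- The invariant metric on `M` with coefficients `c`. -/
def metricM : ∀ p : TotSpace, TangentSpace 𝓘M p →L[ℝ] TangentSpace 𝓘M p →L[ℝ] ℝ :=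
  leftParallelism.bilin fun p => c.metric (toIm p.2)

/-- The invariant almost complex structure on `M` with coefficients `c`. -/
def cplxM : ∀ p : TotSpace, TangentSpace 𝓘M p →L[ℝ] TangentSpace 𝓘M p :=
  leftParallelism.endo fun p => c.cplx (toIm p.2)

theorem metricM_apply (p : TotSpace) (v w : TangentSpace 𝓘M p) :
    c.metricM p v w = c.metric (toIm p.2) (frameMap p v) (frameMap p w) := rfl

theorem frameMap_cplxM (p : TotSpace) (v : TangentSpace 𝓘M p) :
    frameMap p (c.cplxM p v) = c.cplx (toIm p.2) (frameMap p v) :=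
  leftParallelism.θ_endo _ p v

theorem isInvariantOn (η : ℝ) : IsInvariantOn 𝓘M act c.metricM c.cplxM (normTube η) := by
  intro a p hp
  have hw : toIm (act a p).2 = AdL a.2 (toIm p.2) := rfl
  refine ⟨?_, ?_, ?_⟩
  · change ‖toIm (act a p).2‖ < η
    rw [hw, norm_AdL]
    exact hp
  · intro v w
    rw [metricM_apply, metricM_apply, frameMap_act, frameMap_act, hw, metric_AdL]
  · intro v
    apply frameMap_injective
    rw [frameMap_cplxM, frameMap_act, frameMap_act, frameMap_cplxM, hw, cplx_AdL]

/-- In the left parallelism the tensors depend on w only and the second frame component is dw, so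
their derivatives along M are those recorded in the jet at w. -/
theorem isStrictNearlyKahlerOn {η : ℝ} (h : ∀ s, |s| < η → c.HermitianAt s)
    (ht : ∀ s, |s| < η → c.TorsionAt s) :
    IsStrictNearlyKahlerOn 𝓘M c.metricM c.cplxM (normTube η) := by
  have hm : ∀ p : TotSpace, MDifferentiableAt 𝓘M 𝓘(ℝ, Im) (fun p : TotSpace => toIm p.2) p :=
    fun p => (contMDiff_toIm_snd p).mdifferentiableAt (by simp)
  refine leftParallelism.isStrictNearlyKahlerOn
    (fun p _ => (c.contDiff_metric.contMDiff.comp contMDiff_toIm_snd) p)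
    (fun p _ => (c.contDiff_cplx.contMDiff.comp contMDiff_toIm_snd) p)
    (fun p hp => c.jet η h (toIm p.2) hp) (fun _ _ => rfl) (fun _ _ => rfl) ?_ ?_ (fun _ _ => rfl)
    (fun p hp => jet_dkahler_type h ht hp) (fun p hp => jet_nijenhuis_relation h ht hp)
    (fun p hp X hX => jet_exists_dkahler_ne_zero h ht hp hX)
  · intro p hp v
    have h1 := mvfderiv_comp_fderiv ((c.contDiff_metric.differentiable (by simp)) _) (hm p) v
    rw [← frameMap_snd] at h1
    exact h1.symm
  · intro p hp v
    have h1 := mvfderiv_comp_fderiv ((c.contDiff_cplx.differentiable (by simp)) _) (hm p) v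
    rw [← frameMap_snd] at h1
    exact h1.symm

end Coefficients

/-! ### The frame along `γ` -/

theorem frameMap_velocity {c : ℝ → TotSpace} (hc : ContMDiff 𝓘(ℝ, ℝ) 𝓘M ∞ c) {s : ℝ}
    {h : ℍ[ℝ]} {y : Im} (h1 : HasDerivAt (fun s => ((c s).1 : ℍ[ℝ])) h s)
    (h2 : HasDerivAt (fun s => toIm (c s).2) y s) :
    frameMap (c s) (mfderiv 𝓘(ℝ, ℝ) 𝓘M c s (1 : ℝ)) = (imPart (star ((c s).1 : ℍ[ℝ]) * h), y) := by
  have e1 := mfderiv_comp_apply s ((contMDiff_emb (c s)).mdifferentiableAt (by simp))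
    ((hc s).mdifferentiableAt (by simp)) (1 : ℝ)
  have e2 : HasDerivAt (emb ∘ c) (h, y) s := h1.prodMk h2
  rw [mfderiv_eq_fderiv, e2.hasFDerivAt.fderiv] at e1
  have e3 : mvfderiv 𝓘M emb (c s) (mfderiv 𝓘(ℝ, ℝ) 𝓘M c s (1 : ℝ)) = (h, y) := by
    refine Eq.trans e1.symm ?_
    exact one_smul ℝ (h, y)
  exact congrArg (toFrame (c s).1) e3

theorem frameMap_transport {p q : TotSpace} (h : q = p) (v : TangentSpace 𝓘M q) :
    frameMap p (h ▸ v) = frameMap q v := by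
  subst h
  rfl

theorem coe_expSU2 (x : su2) : (expSU2 x : ℍ[ℝ]) = NormedSpace.exp (x : ℍ[ℝ]) := rfl

theorem coe_inv_expSU2 (x : su2) :
    (((expSU2 x)⁻¹ : SU2) : ℍ[ℝ]) = NormedSpace.exp (-(x : ℍ[ℝ])) := by
  let _ : NormedAlgebra ℚ ℍ[ℝ] := NormedAlgebra.restrictScalars ℚ ℝ ℍ[ℝ]
  rw [Metric.unitSphere.coe_inv, coe_expSU2, NormedSpace.exp_neg]

theorem contDiff_exp_smul (x : ℍ[ℝ]) : ContDiff ℝ ∞ fun s : ℝ => NormedSpace.exp (s • x) := by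
  have h : ContDiff ℝ ∞ (NormedSpace.exp : ℍ[ℝ] → ℍ[ℝ]) :=
    contDiff_iff_contDiffAt.2 fun x => (NormedSpace.exp_analytic (𝕂 := ℝ) x).contDiffAt
  exact h.comp (contDiff_id.smul contDiff_const)

theorem hasDerivAt_exp_smul_zero (x : ℍ[ℝ]) :
    HasDerivAt (fun s : ℝ => NormedSpace.exp (s • x)) x 0 := by
  simpa using hasDerivAt_exp_smul_const x (0 : ℝ)

theorem coe_orbitCurve_fst (X : su2 × su2) (p : TotSpace) (s : ℝ) :
    ((orbitCurve X p s).1 : ℍ[ℝ]) = NormedSpace.exp (s • (X.1 : ℍ[ℝ])) * p.1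
      * NormedSpace.exp (s • -(X.2 : ℍ[ℝ])) := by
  rw [smul_neg]
  exact congrArg (NormedSpace.exp (s • (X.1 : ℍ[ℝ])) * (p.1 : ℍ[ℝ]) * ·) (coe_inv_expSU2 (s • X.2))

theorem toIm_orbitCurve_snd (X : su2 × su2) (p : TotSpace) (s : ℝ) :
    toIm (orbitCurve X p s).2 = imPart (NormedSpace.exp (s • (X.2 : ℍ[ℝ])) * (p.2 : ℍ[ℝ])
      * NormedSpace.exp (s • -(X.2 : ℍ[ℝ]))) := by
  have h : (toIm (orbitCurve X p s).2 : ℍ[ℝ]) = NormedSpace.exp (s • (X.2 : ℍ[ℝ])) * (p.2 : ℍ[ℝ])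
      * NormedSpace.exp (s • -(X.2 : ℍ[ℝ])) := by
    rw [smul_neg]
    exact congrArg (NormedSpace.exp (s • (X.2 : ℍ[ℝ])) * (p.2 : ℍ[ℝ]) * ·)
        (coe_inv_expSU2 (s • X.2))
  rw [← h, imPart_coe]

theorem contMDiff_orbitCurve (X : su2 × su2) (p : TotSpace) :
    ContMDiff 𝓘(ℝ, ℝ) 𝓘M ∞ (orbitCurve X p) := by
  refine contMDiff_of_components ?_ ?_
  · simp only [coe_orbitCurve_fst]
    exact (((contDiff_exp_smul _).mul contDiff_const).mul (contDiff_exp_smul _)).contMDiff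
  · simp only [toIm_orbitCurve_snd]
    exact (imPart.contDiff.comp
      (((contDiff_exp_smul _).mul contDiff_const).mul (contDiff_exp_smul _))).contMDiff

theorem frameMap_fundVec (X : su2 × su2) (p : TotSpace) : frameMap p (fundVec X p)
    = (imPart (star (p.1 : ℍ[ℝ]) * ((X.1 : ℍ[ℝ]) * p.1 - p.1 * (X.2 : ℍ[ℝ]))),
      imPart ((X.2 : ℍ[ℝ]) * p.2 - p.2 * (X.2 : ℍ[ℝ]))) := by
  rw [fundVec, frameMap_transport]
  have h : ∀ x y z : ℍ[ℝ], HasDerivAt (fun s : ℝ => NormedSpace.exp (s • x) * z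
      * NormedSpace.exp (s • -y)) (x * z - z * y) 0 := by
    intro x y z
    have := ((hasDerivAt_exp_smul_zero x).mul_const z).mul (hasDerivAt_exp_smul_zero (-y))
    convert! this using 1
    simp [sub_eq_add_neg]
  have h1 : HasDerivAt (fun s => ((orbitCurve X p s).1 : ℍ[ℝ]))
      ((X.1 : ℍ[ℝ]) * p.1 - p.1 * (X.2 : ℍ[ℝ])) 0 := by
    simp only [coe_orbitCurve_fst]
    exact h _ _ _
  have h2 : HasDerivAt (fun s => toIm (orbitCurve X p s).2)
      (imPart ((X.2 : ℍ[ℝ]) * p.2 - p.2 * (X.2 : ℍ[ℝ]))) 0 := by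
    simp only [toIm_orbitCurve_snd]
    exact imPart.hasFDerivAt.comp_hasDerivAt 0 (h _ _ _)
  rw [frameMap_velocity (contMDiff_orbitCurve X p) h1 h2, orbitCurve_zero]

theorem γ_eq (t : ℝ) : γ t = (1, t • vecH) := by
  simp [γ, proj, Ad_one]

theorem contMDiff_γ : ContMDiff 𝓘(ℝ, ℝ) 𝓘M ∞ γ := by
  refine contMDiff_of_components ?_ ?_
  · simp only [γ_eq]
    exact contMDiff_const
  · simp only [γ_eq, map_smul]
    exact (contDiff_id.smul contDiff_const).contMDiff

theorem frameMap_velocity_γ (t : ℝ) :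
    frameMap (γ t) (mfderiv 𝓘(ℝ, ℝ) 𝓘M γ t (1 : ℝ)) = (0, toIm vecH) := by
  have h1 : HasDerivAt (fun s => ((γ s).1 : ℍ[ℝ])) 0 t := by
    simp only [γ_eq]
    exact hasDerivAt_const _ _
  have h2 : HasDerivAt (fun s => toIm (γ s).2) (toIm vecH) t := by
    simp only [γ_eq, map_smul]
    simpa using (hasDerivAt_id t).smul_const (toIm vecH)
  rw [frameMap_velocity contMDiff_γ h1 h2]
  simp

theorem frameMap_fundVec_γ (X : su2 × su2) (t : ℝ) : frameMap (γ t) (fundVec X (γ t))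
    = (toIm (X.1 - X.2), t • toIm (ad X.2 vecH)) := by
  rw [frameMap_fundVec]
  ext1
  · simp only [γ_eq, Metric.unitSphere.coe_one, star_one, one_mul, mul_one]
    exact imPart_coe (toIm (X.1 - X.2))
  · simp only [γ_eq]
    rw [← imPart_coe (t • toIm (ad X.2 vecH))]
    congr 1
    simp [ad, smul_sub]

/-- The coordinates in the frame along `γ`, as functions on `su(2) × su(2)`. -/
def frameCoord (t : ℝ) : Im × Im →ₗ[ℝ] (Fin 6 → ℝ) where
  toFun u := ![2 * (u.2 : ℍ[ℝ]).imI, (u.1 : ℍ[ℝ]).imI,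
    2 * √2 * ((u.1 : ℍ[ℝ]).imJ - (u.2 : ℍ[ℝ]).imK / t),
    2 * √2 * ((u.1 : ℍ[ℝ]).imK + (u.2 : ℍ[ℝ]).imJ / t),
    -(2 * √2 * ((u.2 : ℍ[ℝ]).imK / t)), 2 * √2 * ((u.2 : ℍ[ℝ]).imJ / t)]
  map_add' u v := by
    ext n
    fin_cases n <;> simp <;> ring
  map_smul' r u := by
    ext n
    fin_cases n <;> simp <;> ring

theorem frameCoord_injective {t : ℝ} (ht : t ≠ 0) : Function.Injective (frameCoord t) := by
  rw [← LinearMap.ker_eq_bot, LinearMap.ker_eq_bot']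
  intro u hu
  have h0 := congrFun hu 0
  have h1 := congrFun hu 1
  have h2 := congrFun hu 2
  have h3 := congrFun hu 3
  have h4 := congrFun hu 4
  have h5 := congrFun hu 5
  simp [frameCoord, ht] at h0 h1 h2 h3 h4 h5
  simp only [h4, h5, zero_div, sub_zero, add_zero] at h2 h3
  ext1
  · apply Im.ext <;> simp [h1, h2, h3]
  · apply Im.ext <;> simp [h0, h4, h5]

/-- The coordinates in the frame at `γ t`. -/
def frameCoordEquiv (t : ℝ) (ht : t ≠ 0) : TangentSpace 𝓘M (γ t) ≃ₗ[ℝ] (Fin 6 → ℝ) :=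
  (frameEquiv (γ t)).toLinearEquiv.trans
    (LinearEquiv.ofInjectiveOfFinrankEq (frameCoord t) (frameCoord_injective ht)
      (by rw [Module.finrank_prod, Im.finrank]; simp))

theorem frameCoordEquiv_apply (t : ℝ) (ht : t ≠ 0) (v : TangentSpace 𝓘M (γ t)) :
    frameCoordEquiv t ht v = frameCoord t (frameMap (γ t) v) := rfl

/-- The frame at `γ t`, as a basis. -/
def frameBasis (t : ℝ) (ht : t ≠ 0) : Module.Basis (Fin 6) ℝ (TangentSpace 𝓘M (γ t)) :=
  Module.Basis.ofEquivFun (frameCoordEquiv t ht)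

theorem frameBasis_coord (t : ℝ) (ht : t ≠ 0) (i : Fin 6) (v : TangentSpace 𝓘M (γ t)) :
    (frameBasis t ht).coord i v = frameCoord t (frameMap (γ t) v) i := rfl

theorem frameCoord_apply (t : ℝ) (u : Im × Im) : frameCoord t u =
    ![2 * (u.2 : ℍ[ℝ]).imI, (u.1 : ℍ[ℝ]).imI,
    2 * √2 * ((u.1 : ℍ[ℝ]).imJ - (u.2 : ℍ[ℝ]).imK / t),
    2 * √2 * ((u.1 : ℍ[ℝ]).imK + (u.2 : ℍ[ℝ]).imJ / t),
    -(2 * √2 * ((u.2 : ℍ[ℝ]).imK / t)), 2 * √2 * ((u.2 : ℍ[ℝ]).imJ / t)] := rfl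

theorem im_vecH : (vecH : ℍ[ℝ]).imI = 1 / 2 ∧ (vecH : ℍ[ℝ]).imJ = 0 ∧ (vecH : ℍ[ℝ]).imK = 0 :=
  ⟨rfl, rfl, rfl⟩

theorem im_vecE : (vecE : ℍ[ℝ]).imI = 0 ∧ (vecE : ℍ[ℝ]).imJ = 1 / (2 * √2) ∧
    (vecE : ℍ[ℝ]).imK = 0 := ⟨rfl, rfl, rfl⟩

theorem im_vecV : (vecV : ℍ[ℝ]).imI = 0 ∧ (vecV : ℍ[ℝ]).imJ = 0 ∧
    (vecV : ℍ[ℝ]).imK = 1 / (2 * √2) := ⟨rfl, rfl, rfl⟩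

theorem ad_skew (x y : su2) : ad x y = -ad y x := by
  apply Subtype.ext
  simp [ad]

/-- In the left frame at γ_t the six vectors are ξ = (0, H), A = (2H, 0), E₁ = (E, 0), V₁ = (V, 0),
E₂ = (-E, -tV), V₂ = (-V, tE). The formulas of `frameCoord` invert this system, with H = i/2, E =
j/(2√2), V = k/(2√2). -/
theorem frameBasis_apply (t : ℝ) (ht : t ≠ 0) (i : Fin 6) : frameBasis t ht i = frame t i := by
  have h2 : √2 ≠ 0 := by positivity
  rw [frameBasis, Module.Basis.coe_ofEquivFun, LinearEquiv.symm_apply_eq, frameCoordEquiv_apply]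
  have key : ∀ {i : Fin 6} {u : Im × Im}, frameMap (γ t) (frame t i) = u →
      frameCoord t u = Pi.single i 1 →
      Pi.single i 1 = frameCoord t (frameMap (γ t) (frame t i)) := fun h1 h3 => by rw [h1, h3]
  have a1 : ad (-vecH) vecH = 0 := by
    apply Subtype.ext
    simp [ad]
  have a2 : ad (0 : su2) vecH = 0 := by
    apply Subtype.ext
    simp [ad]
  have a3 : ad vecE vecH = -vecV := by rw [ad_skew, bracket_H_E]
  have a4 : ad vecV vecH = vecE := by rw [ad_skew, bracket_H_V, neg_neg]
  fin_cases i
  · refine key (i := 0) (frameMap_velocity_γ t) ?_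
    rw [frameCoord_apply]
    ext n
    fin_cases n <;> simp [im_vecH]
  · refine key (i := 1) (frameMap_fundVec_γ (vecH, -vecH) t) ?_
    simp only [a1, frameCoord_apply]
    ext n
    fin_cases n <;> simp [im_vecH]
    norm_num
  · refine key (i := 2) (frameMap_fundVec_γ (vecE, 0) t) ?_
    simp only [a2, frameCoord_apply]
    ext n
    fin_cases n <;> simp [im_vecE]
    field_simp
  · refine key (i := 3) (frameMap_fundVec_γ (vecV, 0) t) ?_
    simp only [a2, frameCoord_apply]
    ext n
    fin_cases n <;> simp [im_vecV]
    field_simp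
  · refine key (i := 4) (frameMap_fundVec_γ (0, vecE) t) ?_
    simp only [a3, frameCoord_apply]
    ext n
    fin_cases n <;> simp [im_vecE, im_vecV] <;> field_simp
    norm_num
  · refine key (i := 5) (frameMap_fundVec_γ (0, vecV) t) ?_
    simp only [a4, frameCoord_apply]
    ext n
    fin_cases n <;> simp [im_vecE, im_vecV] <;> field_simp
    norm_num

theorem toIm_smul_vecH (t : ℝ) : toIm (t • vecH) = (t / 2) • unitI := by
  rw [map_smul, toIm_vecH, smul_smul]
  congr 1
  ring

theorem norm_toIm_γ (t : ℝ) : ‖toIm (γ t).2‖ = |t / 2| := by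
  rw [γ_eq, toIm_smul_vecH, norm_smul, norm_unitI, Real.norm_eq_abs, mul_one]

/-- The factor 2 comes from ‖H‖ = 1/2. Conversely (q, w) = (qb, b)·γ_t with t = 2‖w‖, where b
conjugates ‖w‖ i to w. -/
theorem tube_eq (η : ℝ) : tube (2 * η) = normTube η := by
  ext p
  constructor
  · rintro ⟨a, t, h0, h1, rfl⟩
    change ‖toIm (act a (γ t)).2‖ < η
    have h : toIm (act a (γ t)).2 = AdL a.2 (toIm (γ t).2) := rfl
    rw [h, norm_AdL, norm_toIm_γ, abs_of_nonneg (by linarith)]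
    linarith
  · intro hp
    have hp' : ‖toIm p.2‖ < η := hp
    obtain ⟨b, hb⟩ := exists_AdL_smul_unitI (toIm p.2)
    refine ⟨(p.1 * b, b), 2 * ‖toIm p.2‖, by positivity, by linarith, ?_⟩
    have h : toIm (Ad b ((2 * ‖toIm p.2‖) • vecH)) = toIm p.2 := by
      rw [← AdL_toIm, toIm_smul_vecH, mul_div_cancel_left₀ _ two_ne_zero, hb]
    rw [γ_eq]
    ext1
    · simp [act]
    · exact (toIm.injective h).symm

theorem singularOrbit_subset {ε : ℝ} (hε : 0 < ε) : singularOrbit ⊆ tube ε := by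
  rintro _ ⟨a, rfl⟩
  exact ⟨a, 0, le_rfl, hε, rfl⟩

/-- Comparison of the two expressions of ω in coordinates. The radius is |t/2|, but the relations
are stated with signed t, so that both signs of t are covered. -/
theorem form_radial_eq_invForm {c : Coefficients} {t : ℝ} (ht : t ≠ 0) {f₁ f₂ f₃ f₅ : ℝ}
    (hα : 8 * (f₂ + f₅) = t * c.α |t / 2|)
        (hβ : (t / 2) ^ 2 * c.β |t / 2| = -(2 * f₁) - c.α |t / 2|)
    (hδ : 16 * f₂ = t * c.δ |t / 2|) (hκ : 16 * (f₂ + f₃ + 2 * f₅) = t ^ 3 * c.κ |t / 2|)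
    (v w : TangentSpace 𝓘M (γ t)) :
    c.form (toIm (γ t).2) (frameMap (γ t) v) (frameMap (γ t) w)
      = invForm (frameBasis t ht) f₁ f₂ f₃ 0 f₅ v w := by
  simp only [invForm, wedge, frameBasis_coord, frameCoord_apply]
  generalize frameMap (γ t) v = x
  generalize frameMap (γ t) w = y
  have h2 : √2 * √2 = 2 := Real.mul_self_sqrt (by norm_num)
  have hα' : c.α |t / 2| = 8 * (f₂ + f₅) / t := by field_simp; linarith
  have hβ' : c.β |t / 2| = (-(2 * f₁) - c.α |t / 2|) * 4 / t ^ 2 := by field_simp; linarith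
  have hδ' : c.δ |t / 2| = 16 * f₂ / t := by field_simp; linarith
  have hκ' : c.κ |t / 2| = 16 * (f₂ + f₃ + 2 * f₅) / t ^ 3 := by field_simp; linarith
  rw [Coefficients.form_apply, norm_toIm_γ, γ_eq]
  simp only [toIm_smul_vecH, Im.inner_eq, cross_imI, cross_imJ, cross_imK, Im.coe_smul,
    Quaternion.imI_smul, Quaternion.imJ_smul, Quaternion.imK_smul, unitI_imI, unitI_imJ, unitI_imK,
    smul_eq_mul, hβ', hα', hδ', hκ']
  simp
  generalize √2 = r at h2 ⊢
  field_simp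
  rw [show r ^ 2 = 2 by rw [sq, h2]]
  ring

end NearlyKahler

end

/-! ### The main theorem -/

open NearlyKahler in
theorem corollary6p3 (a μ : ℝ) (ha : 0 < a) (hμ : 0 < μ) (f₁ f₂ f₃ f₄ f₅ : ℝ → ℝ)
    (hs₁ : ContDiffOn ℝ ∞ f₁ (Ioo (-a) a)) (hs₂ : ContDiffOn ℝ ∞ f₂ (Ioo (-a) a))
    (hs₃ : ContDiffOn ℝ ∞ f₃ (Ioo (-a) a)) (hs₄ : ContDiffOn ℝ ∞ f₄ (Ioo (-a) a))
    (hs₅ : ContDiffOn ℝ ∞ f₅ (Ioo (-a) a))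
    (hf₄ : ∀ t ∈ Ioo (-a) a, f₄ t = 0)
    (heven : ∀ t ∈ Ioo (-a) a, f₁ (-t) = f₁ t)
    (hneg : ∀ t ∈ Ioo (-a) a, f₁ t < 0)
    (hodd₂ : ∀ t ∈ Ioo (-a) a, f₂ (-t) = -f₂ t)
    (hodd₃ : ∀ t ∈ Ioo (-a) a, f₃ (-t) = -f₃ t)
    (hodd₅ : ∀ t ∈ Ioo (-a) a, f₅ (-t) = -f₅ t)
    (hd₃ : deriv f₃ 0 = f₁ 0 / 2 + deriv f₂ 0)
    (hd₅ : deriv f₅ 0 = -(f₁ 0 / 4) - deriv f₂ 0)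
    (hd₅' : deriv f₅ 0 ≠ 0)
    (hsys : ∀ t ∈ Ioo (-a) a, SystemAt μ f₁ f₂ f₃ f₅ t)
    (halg : ∃ t₀ ∈ Ioo (-a) a, AlgebraicConditionAt f₁ f₂ f₃ f₅ t₀) :
    ∃ ε : ℝ, 0 < ε ∧ ε ≤ a ∧ IsOpen (tube ε) ∧ singularOrbit ⊆ tube ε ∧
      ∃ (g : ∀ p : TotSpace, TangentSpace 𝓘M p →L[ℝ] TangentSpace 𝓘M p →L[ℝ] ℝ)
        (J : ∀ p : TotSpace, TangentSpace 𝓘M p →L[ℝ] TangentSpace 𝓘M p),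
        IsStrictNearlyKahlerOn 𝓘M g J (tube ε) ∧
        IsInvariantOn 𝓘M act g J (tube ε) ∧
        ∀ t : ℝ, 0 < |t| → |t| < ε →
          ∃ b : Module.Basis (Fin 6) ℝ (TangentSpace 𝓘M (γ t)), (∀ i, b i = frame t i) ∧
            ∀ v w : TangentSpace 𝓘M (γ t),
              g (γ t) (J (γ t) v) w = invForm b (f₁ t) (f₂ t) (f₃ t) (f₄ t) (f₅ t) v w := by
  obtain ⟨r, P, hr, hP⟩ := exists_profile ha hs₁ hs₂ hs₃ hs₅ heven hneg hodd₂ hodd₃ hodd₅ hd₃ hd₅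
    hd₅' hsys
  obtain ⟨c, η, hη, hηr, hrep, hherm, htor⟩ := P.exists_coefficients hμ.ne'
  refine ⟨2 * η, by linarith, by linarith, ?_, singularOrbit_subset (by linarith), c.metricM,
      c.cplxM,
    ?_, ?_, ?_⟩
  · rw [tube_eq]
    exact isOpen_normTube η
  · rw [tube_eq]
    exact c.isStrictNearlyKahlerOn hherm htor
  · rw [tube_eq]
    exact c.isInvariantOn η
  · intro t ht0 htη
    have ht : t ≠ 0 := abs_pos.1 ht0
    have hs : |(|t / 2|)| < η := by
      rw [abs_abs, abs_div, abs_two]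
      linarith
    have hta : t ∈ Ioo (-a) a := abs_lt.1 (by linarith)
    refine ⟨frameBasis t ht, frameBasis_apply t ht, fun v w => ?_⟩
    have hw : c.HermitianAt ‖toIm (γ t).2‖ := by
      rw [norm_toIm_γ]
      exact hherm _ hs
    rw [c.metricM_apply, c.frameMap_cplxM, hw.metric_cplx_left, hf₄ t hta]
    -- The coefficients are evaluated at the radius |t/2|, where the profile functions take the
    -- values fᵢ(|t|).
    have R := hrep _ hs
    obtain ⟨p₁, p₂, p₃, p₅⟩ := hP _ (hs.trans_le hηr)
    have hα := R.α_eq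
    have hβ := R.β_eq
    have hδ := R.δ_eq
    have hκ := R.κ_eq
    rw [p₂, p₅] at hα
    rw [p₁] at hβ
    rw [p₂] at hδ
    rw [p₂, p₃, p₅] at hκ
    rcases lt_or_gt_of_ne ht with hneg' | hpos
    -- For t < 0 the radius corresponds to -t. Oddness of f₂, f₃, f₅ and evenness of f₁ restore the
    -- relations at t itself, as each odd relation also carries an odd power of t.
    · have e : 2 * |t / 2| = -t := by
        rw [abs_of_neg (by linarith)]
        ring
      have e' : |t / 2| = -t / 2 := by linarith
      rw [e, hodd₂ t hta, hodd₅ t hta] at hα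
      rw [e, heven t hta, sq_abs] at hβ
      rw [e, hodd₂ t hta] at hδ
      rw [e, hodd₂ t hta, hodd₃ t hta, hodd₅ t hta] at hκ
      refine form_radial_eq_invForm ht ?_ hβ ?_ ?_ v w
      · linarith
      · generalize c.δ |t / 2| = d at *
        rw [e'] at hδ
        linarith
      · generalize c.κ |t / 2| = d at *
        rw [e'] at hκ
        linarith
    · have e : 2 * |t / 2| = t := by
        rw [abs_of_pos (by linarith)]
        ring
      have e' : |t / 2| = t / 2 := by linarith
      rw [e] at hα
      rw [e, sq_abs] at hβ
      rw [e] at hδ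
      rw [e] at hκ
      refine form_radial_eq_invForm ht hα hβ ?_ ?_ v w
      · generalize c.δ |t / 2| = d at *
        rw [e'] at hδ
        linarith
      · generalize c.κ |t / 2| = d at *
        rw [e'] at hκ
        linarith
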